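/- **Definitions.** All digraphs are finite; loops and parallel arcs are allowed. A *2-digraph* is a digraph each of whose vertices is an *entry* vertex (in-degree $0$, out-degree $2$), an *exit* vertex (in-degree $2$, out-degree $0$) or a *saturated* vertex (in- and out-degree $2$). A *2-dd* is a 2-digraph all of whose vertices are saturated. An *alternating cycle* (AC) is a set of $2r$ distinct arcs, $r\ge 1$, that can be listed as $e_0,\dots,e_{2r-1}$ so that, cyclically, $e_i$ and $e_{i+1}$ have a common end-vertex for even $i$ and a common start-vertex for odd $i$; the ACs partition the arcs of a 2-digraph. A *subgraph* $F$ of a 2-dd $G$ is here always the 2-digraph formed by a non-empty set of ACs of $G$ and the end-points of their arcs; its complement $\overline F$ is formed by the remaining ACs. A 2-dd is *clean* if no single AC, viewed as a subgraph, has a saturated vertex. A *factor* of a 2-digraph is a spanning set of arcs in which entry vertices have (in-degree, out-degree) $(0,1)$, exit vertices $(1,0)$ and saturated vertices $(1,1)$; its *index* is its number of cycles, and it is *open* if its index is $0$. The *route* of a factor is the bijection from entry to exit vertices given by its paths; an *open route* is the route of an open factor. A 2-dd is *odd* if every factor has odd index. Two 2-dds are *H-equivalent* if both or neither have a Hamiltonian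 circuit. *Splitting* a saturated vertex $v$ replaces it by two vertices, one keeping the in-arcs and one keeping the out-arcs of $v$; a 2-dd is *2-splittable* if there are two vertices whose simultaneous splitting increases the number of components (of the underlying undirected graph). *Collapsing* a subgraph $F$ that has exactly one open route $\rho$ means: delete the arcs of $F$ and the saturated vertices of $F$, and identify each entry vertex $u$ of $F$ with the exit vertex $\rho(u)$. *Replacing $F$ by a single AC* means: take a 2-digraph $F'$ that consists of a single AC with $6$ arcs and has as many entry and exit vertices as $\overline F$ has exit and entry vertices respectively, and identify the exit vertices of $F'$ with the entry vertices of $\overline F$, and the exit vertices of $\overline F$ with the entry vertices of $F'$, along some bijections. **Proposition.** Let $G$ be an odd, connected, clean 2-dd in which every AC has exactly $6$ arcs and which is not 2-splittable. Let $F$ be a subgraph of $G$ consisting of $2$ ACs and having $s$ saturated vertices. If $s>2$, then $F$ can be collapsed, or can be replaced by a single AC, in such a way that the resulting graph $G'$ is an odd 2-dd in which every AC has exactly $6$ arcs and which is H-equivalent to $G$. -/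

import Mathlib

open Set

/-- A directed multigraph with vertex type `V` and arc type `A` (loops and parallel arcs are
allowed); the arc `a` goes from `src a` to `tgt a`. -/
structure Multidigraph (V A : Type*) where
  src : A → V
  tgt : A → V

namespace Multidigraph

variable {V A V₁ A₁ V₂ A₂ : Type*}

/-! ### Degrees, 2-digraphs, 2-dds

A set `K` of arcs stands for the subgraph that consists of the arcs in `K` and their
end-points; `K = univ` is the whole graph. -/

/-- Number of arcs of `K` that end at `v`. -/
noncomputable def inDeg (G : Multidigraph V A) (K : Set A) (v : V) : ℕ :=
  {a | a ∈ K ∧ G.tgt a = v}.ncard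

/-- Number of arcs of `K` that start at `v`. -/
noncomputable def outDeg (G : Multidigraph V A) (K : Set A) (v : V) : ℕ :=
  {a | a ∈ K ∧ G.src a = v}.ncard

/-- `v` is an entry vertex of the 2-digraph with arc set `K`. -/
def IsEntry (G : Multidigraph V A) (K : Set A) (v : V) : Prop :=
  G.inDeg K v = 0 ∧ G.outDeg K v = 2

/-- `v` is an exit vertex of the 2-digraph with arc set `K`. -/
def IsExit (G : Multidigraph V A) (K : Set A) (v : V) : Prop :=
  G.inDeg K v = 2 ∧ G.outDeg K v = 0

/-- `v` is a saturated vertex of the 2-digraph with arc set `K`. -/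
def IsSat (G : Multidigraph V A) (K : Set A) (v : V) : Prop :=
  G.inDeg K v = 2 ∧ G.outDeg K v = 2

/-- 2-digraphs: every vertex is an entry, an exit or a saturated vertex. -/
def Is2Digraph (G : Multidigraph V A) : Prop :=
  ∀ v, G.IsEntry univ v ∨ G.IsExit univ v ∨ G.IsSat univ v

/-- 2-diregular digraphs (2-dds): every vertex is saturated. -/
def Is2dd (G : Multidigraph V A) : Prop :=
  ∀ v, G.IsSat univ v

/-! ### Alternating cycles -/

/-- `X` is the arc set of an alternating cycle: a sequence `e 0, …, e (2 * r - 1)` of distinct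
arcs such that, cyclically, `e i` and `e (i + 1)` have a common end-vertex if `i` is even and a
common start-vertex if `i` is odd. -/
def IsAC (G : Multidigraph V A) (X : Set A) : Prop :=
  ∃ (r : ℕ) (e : ℕ → A), 0 < r ∧ InjOn e (Iio (2 * r)) ∧ e '' Iio (2 * r) = X ∧
    ∀ i < 2 * r,
      (Even i → G.tgt (e i) = G.tgt (e ((i + 1) % (2 * r)))) ∧
      (Odd i → G.src (e i) = G.src (e ((i + 1) % (2 * r))))

/-- The set of (arc sets of) alternating cycles of `G`. -/
def ACs (G : Multidigraph V A) : Set (Set A) :=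
  {X | G.IsAC X}

/-- Every alternating cycle of `G` has exactly `m` arcs. -/
def ACsHaveCard (G : Multidigraph V A) (m : ℕ) : Prop :=
  ∀ X ∈ G.ACs, X.ncard = m

/-- `G` is clean: no alternating cycle, viewed as a subgraph, has a saturated vertex. -/
def Clean (G : Multidigraph V A) : Prop :=
  ∀ X ∈ G.ACs, ∀ v, ¬ G.IsSat X v

/-! ### Factors, index, routes, Hamiltonicity -/

/-- `S` contains an arc from `u` to `v`. -/
def Step (G : Multidigraph V A) (S : Set A) (u v : V) : Prop :=
  ∃ a ∈ S, G.src a = u ∧ G.tgt a = v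

/-- `S` is (the arc set of) a factor of the 2-digraph with arc set `K`: a spanning 1-digraph in
which the entry, exit and saturated vertices of `K` are entry, exit and saturated again. -/
def IsFactor (G : Multidigraph V A) (K S : Set A) : Prop :=
  S ⊆ K ∧ ∀ v,
    (G.IsEntry K v → G.inDeg S v = 0 ∧ G.outDeg S v = 1) ∧
    (G.IsExit K v → G.inDeg S v = 1 ∧ G.outDeg S v = 0) ∧
    (G.IsSat K v → G.inDeg S v = 1 ∧ G.outDeg S v = 1)

/-- The vertex sets of the cycles of a factor `S`. -/
def cycles (G : Multidigraph V A) (S : Set A) : Set (Set V) :=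
  {C | ∃ v, Relation.TransGen (G.Step S) v v ∧ C = {w | Relation.ReflTransGen (G.Step S) v w}}

/-- The index of a factor: its number of cycles. -/
noncomputable def index (G : Multidigraph V A) (S : Set A) : ℕ :=
  (G.cycles S).ncard

/-- A 2-dd is odd if each of its factors has an odd number of cycles. -/
def IsOdd (G : Multidigraph V A) : Prop :=
  ∀ S, G.IsFactor univ S → Odd (G.index S)

/-- `G` has a Hamiltonian circuit: a spanning directed cycle. -/
def Hamiltonian (G : Multidigraph V A) : Prop :=
  Nonempty V ∧ ∃ S : Set A, (∀ v, G.inDeg S v = 1 ∧ G.outDeg S v = 1) ∧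
    ∀ u v, Relation.ReflTransGen (G.Step S) u v

/-- The route of a factor `S` of `K` (a bijection from the entry vertices of `K` to its exit
vertices, given by its graph): the path of `S` that begins at `u` ends at `v`. -/
def route (G : Multidigraph V A) (K S : Set A) (u v : V) : Prop :=
  G.IsEntry K u ∧ G.IsExit K v ∧ Relation.ReflTransGen (G.Step S) u v

/-- `ρ` is an open route of `K`: the route of a factor without cycles. -/
def IsOpenRoute (G : Multidigraph V A) (K : Set A) (ρ : V → V → Prop) : Prop :=
  ∃ S, G.IsFactor K S ∧ G.index S = 0 ∧ ρ = G.route K S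

/-! ### Components and splitting -/

/-- Number of components of the underlying undirected graph. -/
noncomputable def numComponents (G : Multidigraph V A) : ℕ :=
  Nat.card (Quot (G.Step univ))

def Connected (G : Multidigraph V A) : Prop :=
  G.numComponents = 1

open Classical in
/-- Split every vertex `v ∈ T` into `v^in = inl v`, which keeps the in-arcs of `v`, and
`v^out = inr v`, which keeps its out-arcs. -/
noncomputable def split (G : Multidigraph V A) (T : Set V) : Multidigraph (V ⊕ T) A where
  src a := if h : G.src a ∈ T then Sum.inr ⟨G.src a, h⟩ else Sum.inl (G.src a)
  tgt a := Sum.inl (G.tgt a)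

/-- `T` is a split-set: a set of saturated vertices whose splitting increases the number of
components. -/
def IsSplitSet (G : Multidigraph V A) (T : Set V) : Prop :=
  (∀ v ∈ T, G.IsSat univ v) ∧ G.numComponents < (G.split T).numComponents

/-- `G` is `k`-splittable: it has a split-set with `k` elements. -/
def Splittable (G : Multidigraph V A) (k : ℕ) : Prop :=
  ∃ T : Set V, T.ncard = k ∧ G.IsSplitSet T

/-! ### Subgraphs, splicing, replacing and collapsing -/

/-- The end-points of the arcs in `K`. -/
def verts (G : Multidigraph V A) (K : Set A) : Set V :=
  {v | ∃ a ∈ K, G.src a = v ∨ G.tgt a = v}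

/-- The subgraph induced by a set of arcs, as a graph of its own. -/
def sub (G : Multidigraph V A) (K : Set A) : Multidigraph (G.verts K) K where
  src a := ⟨G.src a, a, a.2, Or.inl rfl⟩
  tgt a := ⟨G.tgt a, a, a.2, Or.inr rfl⟩

/-- Identify the vertices that are related by `ρ`. -/
def identify (G : Multidigraph V A) (ρ : V → V → Prop) : Multidigraph (Quot ρ) A where
  src a := Quot.mk ρ (G.src a)
  tgt a := Quot.mk ρ (G.tgt a)

/-- Disjoint union. -/
def disjUnion (G₁ : Multidigraph V₁ A₁) (G₂ : Multidigraph V₂ A₂) :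
    Multidigraph (V₁ ⊕ V₂) (A₁ ⊕ A₂) where
  src := Sum.map G₁.src G₂.src
  tgt := Sum.map G₁.tgt G₂.tgt

/-- The pairs of vertices that are spliced with each other when the exit vertices of `G₁` are
spliced with the entry vertices of `G₂` according to `x`, and the exit vertices of `G₂` with the
entry vertices of `G₁` according to `y`. -/
def spliceRel (G₁ : Multidigraph V₁ A₁) (G₂ : Multidigraph V₂ A₂)
    (x : {v // G₁.IsExit univ v} ≃ {v // G₂.IsEntry univ v})
    (y : {v // G₂.IsExit univ v} ≃ {v // G₁.IsEntry univ v}) (p q : V₁ ⊕ V₂) : Prop :=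
  (∃ u, p = Sum.inl u.1 ∧ q = Sum.inr (x u).1) ∨ (∃ u, p = Sum.inr u.1 ∧ q = Sum.inl (y u).1)

/-- The graph spliced from `G₁` and `G₂` along `x` and `y`. -/
def splice (G₁ : Multidigraph V₁ A₁) (G₂ : Multidigraph V₂ A₂)
    (x : {v // G₁.IsExit univ v} ≃ {v // G₂.IsEntry univ v})
    (y : {v // G₂.IsExit univ v} ≃ {v // G₁.IsEntry univ v}) :
    Multidigraph (Quot (spliceRel G₁ G₂ x y)) (A₁ ⊕ A₂) :=
  (disjUnion G₁ G₂).identify (spliceRel G₁ G₂ x y)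

/-- Collapse the subgraph `K` of `G` along the route `ρ` of `K`: delete the arcs of `K` and the
vertices saturated in `K`, and identify each entry vertex `u` of `K` with the exit vertex of `K`
to which `ρ` leads from `u`. -/
def collapse (G : Multidigraph V A) (K : Set A) (ρ : V → V → Prop) :
    Multidigraph (Quot fun u v : G.verts Kᶜ => ρ u v) (Kᶜ : Set A) :=
  (G.sub Kᶜ).identify fun u v => ρ u v

/-- `G'` is an odd 2-dd in which every alternating cycle has 6 arcs, and `G` and `G'` are either
both Hamiltonian or both non-Hamiltonian. -/
def IsHEquivalentOddReduct (G : Multidigraph V A) (G' : Multidigraph V₁ A₁) : Prop :=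
  G'.Is2dd ∧ G'.ACsHaveCard 6 ∧ G'.IsOdd ∧ (G.Hamiltonian ↔ G'.Hamiltonian)

/-- The subgraph `K` can be collapsed to an H-equivalent odd 2-dd: it has a unique open route,
along which it is collapsed. -/
def CanCollapse (G : Multidigraph V A) (K : Set A) : Prop :=
  ∃ ρ : V → V → Prop, (∀ σ, G.IsOpenRoute K σ ↔ σ = ρ) ∧
    G.IsHEquivalentOddReduct (G.collapse K ρ)

/-- The subgraph `K` can be replaced by a single alternating cycle with 6 arcs to give an
H-equivalent odd 2-dd: the complement of `K` in `G` is spliced with a 2-digraph `F'` that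
consists of one such cycle. -/
def CanReplaceBySingleAC (G : Multidigraph V A) (K : Set A) : Prop :=
  ∃ (V' A' : Type) (_ : Finite V') (_ : Finite A') (F' : Multidigraph V' A'),
    F'.Is2Digraph ∧ F'.ACsHaveCard 6 ∧ F'.ACs.ncard = 1 ∧
    ∃ (x : {v // F'.IsExit univ v} ≃ {v // (G.sub Kᶜ).IsEntry univ v})
      (y : {v // (G.sub Kᶜ).IsExit univ v} ≃ {v // F'.IsEntry univ v}),
      G.IsHEquivalentOddReduct (splice F' (G.sub Kᶜ) x y)

end Multidigraph

/-! In a 2-dd, a factor `S` is the same as a permutation of the vertices that moves every vertex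
along an arc of `S`; its index is the number of orbits, and `G` is Hamiltonian if and only if some
factor has exactly one orbit (`IsFull.index_eq_orb`, `hamiltonian_iff`). Let `K` be the arc set of
`F` and let `ins Kᶜ` be the set of vertices whose in-arcs are outside `K`. The part of `S` inside
`K` is open if and only if every orbit meets `ins Kᶜ`, and then the first return permutation to `ins
Kᶜ` has as many orbits as `S`. This permutation depends only on the part of `S` outside `K` and on
the route of the part inside `K`. So the index survives if `K` is exchanged for anything that has
the same route (`IsFull.OpenOn.orb_eq_of_route`).

Routes are compared by means of signs: the parity of the number of orbits determines the sign of a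
permutation, so that in an odd 2-dd two open routes of `K` differ by an even permutation. Hence, if
they are different, they differ at three entry vertices at least (`three_le_of_route_ne`).

Let `s` be the number of saturated vertices of `F`; there are `6 - s` entry and `6 - s` exit
vertices.
* If `s = 6`, then `F` is all of `G` by connectedness. Every factor has one or three cycles, and in
  the latter case exchanging the matching of one of the two alternating cycles gives a Hamiltonian
  circuit (`hamiltonian_of_union_eq_univ`). So `G` may be replaced by an alternating cycle on three
  vertices whose two factors have one and three cycles.
* If `s = 5`, then the entry and the exit vertex of `F` form a split-set, contrary to the
  hypothesis.
* If `s ≤ 4`, then there is an open factor (`exists_openOn`). If all open factors have the same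
  route, in particular if `s = 4`, then `F` is collapsed along it (`IsFull.OpenOn.canCollapse`).
  Otherwise `s = 3`, and two open routes differ by a 3-cycle. The six pairs that belong to the two
  routes form a hexagon, by which `F` is replaced (`IsFull.OpenOn.canReplaceBySingleAC`). Should `F`
  have a third open route, nothing is lost: if the complement of `F` can be completed to a
  Hamiltonian circuit at all, then this is possible by one of any two open routes
  (`orb_union_eq_one`), since two different permutations of three points with odd numbers of cycles
  cannot both be the identity. -/

/-! ### Orbits and first return permutations -/

namespace Equiv.Perm

variable {α τ : Type*}

/-- The number of orbits of `σ`, fixed points included. -/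
noncomputable def orb (σ : Perm α) : ℕ :=
  Nat.card (Quotient (SameCycle.setoid σ))

/-- The orbits of `σ` are its fixed points and its non-trivial cycles. -/
theorem orb_eq_card_fixed_add [Fintype α] [DecidableEq α] (σ : Perm α) :
    orb σ = (Fintype.card α - σ.support.card) + Multiset.card σ.cycleType := by
  classical
  let q : α → Quotient (SameCycle.setoid σ) := Quotient.mk _
  have hq : ∀ x y, q x = q y ↔ SameCycle σ x y := fun x y => Quotient.eq (r := SameCycle.setoid σ)
  let S : Set α := σ.support
  let f : Quotient (SameCycle.setoid σ) → Perm α :=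
    Quotient.lift (fun x => cycleOf σ x) (fun x y h => SameCycle.cycleOf_eq h)
  have hf : ∀ x, f (q x) = cycleOf σ x := fun x => rfl
  have hsplit : (univ : Set (Quotient (SameCycle.setoid σ))) = q '' Sᶜ ∪ q '' S := by
    rw [← image_union, compl_union_self, image_univ]
    exact (Set.range_eq_univ.2 Quotient.mk_surjective).symm
  have hdisj : _root_.Disjoint (q '' Sᶜ) (q '' S) := by
    rw [Set.disjoint_left]
    rintro _ ⟨x, hx, rfl⟩ ⟨y, hy, hxy⟩
    exact hx (((hq _ _).1 hxy).mem_support_iff.1 hy)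
  have h1 : (q '' Sᶜ).ncard = Fintype.card α - σ.support.card := by
    rw [InjOn.ncard_image, ncard_compl, Nat.card_eq_fintype_card, ncard_coe_finset]
    intro x hx y hy hxy
    have hx' : σ x = x := by simpa [S] using hx
    exact SameCycle.eq_of_left ((hq _ _).1 hxy) hx'
  have h2 : (q '' S).ncard = Multiset.card σ.cycleType := by
    have hinj : InjOn f (q '' S) := by
      rintro _ ⟨x, hx, rfl⟩ _ ⟨y, hy, rfl⟩ hxy
      exact (hq _ _).2 ((sameCycle_iff_cycleOf_eq_of_mem_support hx hy).2 hxy)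
    rw [← hinj.ncard_image, cycleType_def, Multiset.card_map]
    have : f '' (q '' S) = (σ.cycleFactorsFinset : Set (Perm α)) := by
      ext c
      constructor
      · rintro ⟨_, ⟨x, hx, rfl⟩, rfl⟩
        exact cycleOf_mem_cycleFactorsFinset_iff.2 hx
      · intro hc
        obtain ⟨a, ha⟩ := (mem_cycleFactorsFinset_iff.1 hc).1.nonempty_support
        exact ⟨q a, ⟨a, mem_cycleFactorsFinset_support_le hc ha, rfl⟩,
          (cycle_is_cycleOf ha hc).symm⟩
    rw [this, ncard_coe_finset]; rfl
  rw [orb, ← ncard_univ, hsplit, ncard_union_eq hdisj, h1, h2]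

theorem sign_eq_neg_one_pow_orb [Fintype α] [DecidableEq α] (σ : Perm α) :
    sign σ = (-1) ^ (Fintype.card α + orb σ) := by
  have hle : σ.support.card ≤ Fintype.card α := Finset.card_le_univ _
  rw [sign_of_cycleType, sum_cycleType, orb_eq_card_fixed_add]
  have : Fintype.card α + (Fintype.card α - σ.support.card + Multiset.card σ.cycleType)
    = (σ.support.card + Multiset.card σ.cycleType) + 2 * (Fintype.card α - σ.support.card) := by
    omega
  rw [this, pow_add _ _ (2 * _), pow_mul]
  simp

theorem orb_eq_one_iff {σ : Perm α} : orb σ = 1 ↔ Nonempty α ∧ ∀ x y, SameCycle σ x y := by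
  rw [orb, Nat.card_eq_one_iff_unique]
  constructor
  · rintro ⟨h1, ⟨x⟩⟩
    obtain ⟨a, -⟩ := Quotient.exists_rep x
    exact ⟨⟨a⟩, fun x y => Quotient.exact (s := SameCycle.setoid σ) (Subsingleton.elim _ _)⟩
  · rintro ⟨⟨a⟩, h⟩
    refine ⟨⟨fun x y => ?_⟩, ⟨Quotient.mk _ a⟩⟩
    induction x using Quotient.inductionOn
    induction y using Quotient.inductionOn
    exact Quotient.sound (h _ _)

theorem orb_le_card [Finite α] (σ : Perm α) : orb σ ≤ Nat.card α :=
  Nat.card_le_card_of_surjective _ Quotient.mk_surjective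

theorem eq_one_of_orb_eq_card [Finite α] {σ : Perm α} (h : orb σ = Nat.card α) : σ = 1 := by
  have hb : Function.Bijective (Quotient.mk (SameCycle.setoid σ)) :=
    (Nat.bijective_iff_surjective_and_card _).2 ⟨Quotient.mk_surjective, h.symm⟩
  ext x
  refine hb.1 (Quotient.sound ?_)
  exact (sameCycle_apply_left (f := σ)).2 (SameCycle.refl _ _)

theorem orb_one [Finite α] : orb (1 : Perm α) = Nat.card α := by
  refine (Nat.card_congr (Equiv.ofBijective _ ⟨fun x y h => ?_, Quotient.mk_surjective⟩)).symm
  have : SameCycle (1 : Perm α) x y := Quotient.exact h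
  simpa using this

/-- A permutation of three points with an odd number of orbits is the identity or a full cycle. -/
theorem orb_eq_one_of_card_eq_three (hc : Nat.card α = 3) {σ : Perm α} (h : Odd (orb σ))
    (h1 : σ ≠ 1) : orb σ = 1 := by
  have : Finite α := Nat.finite_of_card_ne_zero (by omega)
  have h2 := orb_le_card σ
  have h3 : orb σ ≠ Nat.card α := fun h => h1 (eq_one_of_orb_eq_card h)
  obtain ⟨k, hk⟩ := h
  omega

/-- `θ` is the first return map of `σ` to the image of `j`, pulled back along `j`. -/
def IsFirstReturn (j : τ → α) (σ : Perm α) (θ : Perm τ) : Prop :=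
  ∀ v, ∃ n, 0 < n ∧ (σ ^ n) (j v) = j (θ v) ∧ ∀ k, 0 < k → k < n → (σ ^ k) (j v) ∉ range j

theorem exists_isFirstReturn [Finite α] {j : τ → α} (hj : Function.Injective j) (σ : Perm α) :
    ∃ θ : Perm τ, IsFirstReturn j σ θ := by
  classical
  have : Finite τ := Finite.of_injective j hj
  have hex : ∀ v, ∃ n, 0 < n ∧ (σ ^ n) (j v) ∈ range j := fun v =>
    ⟨orderOf σ, orderOf_pos σ, by rw [pow_orderOf_eq_one]; exact ⟨v, rfl⟩⟩
  choose f hf using fun v => (Nat.find_spec (hex v)).2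
  have hinj' : ∀ u v, f u = f v → Nat.find (hex u) ≤ Nat.find (hex v) → u = v := by
    intro u v huv hle
    have h1 : (σ ^ Nat.find (hex u)) (j u) = (σ ^ Nat.find (hex v)) (j v) := by
      rw [← hf, ← hf, huv]
    obtain ⟨d, hd⟩ := Nat.exists_eq_add_of_le hle
    rw [hd, pow_add, mul_apply, EmbeddingLike.apply_eq_iff_eq] at h1
    rcases Nat.eq_zero_or_pos d with h0 | h0
    · subst h0
      exact hj h1
    · exact absurd ⟨h0, h1 ▸ ⟨u, rfl⟩⟩
        (Nat.find_min (hex v) (m := d) (by have := (Nat.find_spec (hex u)).1; omega))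
  have hinj : Function.Injective f := by
    intro u v huv
    rcases le_total (Nat.find (hex u)) (Nat.find (hex v)) with h | h
    · exact hinj' u v huv h
    · exact (hinj' v u huv.symm h).symm
  refine ⟨Equiv.ofBijective f (Finite.injective_iff_bijective.1 hinj), fun v =>
    ⟨Nat.find (hex v), (Nat.find_spec (hex v)).1, (hf v).symm, fun k hk hkn hr => ?_⟩⟩
  exact Nat.find_min (hex v) hkn ⟨hk, hr⟩

theorem IsFirstReturn.eq {j : τ → α} (hj : Function.Injective j) {σ : Perm α} {θ : Perm τ}
    (h : IsFirstReturn j σ θ) {v w : τ} {n : ℕ} (hn : 0 < n) (hw : (σ ^ n) (j v) = j w)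
    (hmin : ∀ k, 0 < k → k < n → (σ ^ k) (j v) ∉ range j) : θ v = w := by
  obtain ⟨m, hm, hmw, hmmin⟩ := h v
  have : m = n := by
    rcases lt_trichotomy m n with h | h | h
    · exact absurd ⟨_, hmw.symm⟩ (hmin m hm h)
    · exact h
    · exact absurd ⟨_, hw.symm⟩ (hmmin n hn h)
  subst this
  exact hj (hmw.symm.trans hw)

theorem IsFirstReturn.sameCycle_iff [Finite α] {j : τ → α} (hj : Function.Injective j)
    {σ : Perm α} {θ : Perm τ} (h : IsFirstReturn j σ θ) {u v : τ} :
    SameCycle θ u v ↔ SameCycle σ (j u) (j v) := by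
  have : Finite τ := Finite.of_injective j hj
  constructor
  · intro huv
    obtain ⟨n, -, rfl⟩ := huv.exists_pow_eq'
    clear huv
    induction n with
    | zero => exact SameCycle.refl _ _
    | succ n ih =>
      obtain ⟨m, -, hm, -⟩ := h ((θ ^ n) u)
      rw [pow_succ', mul_apply, ← hm]
      exact ih.trans ⟨m, by simp⟩
  · intro huv
    obtain ⟨n, -, hn⟩ := huv.exists_pow_eq'
    clear huv
    induction n using Nat.strong_induction_on generalizing u with
    | _ n ih =>
      rcases Nat.eq_zero_or_pos n with h0 | h0
      · subst h0
        rw [hj hn]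
      · obtain ⟨m, hm, hmw, hmin⟩ := h u
        have hmn : m ≤ n := by
          by_contra hlt
          exact hmin n h0 (by omega) ⟨v, hn.symm⟩
        refine (sameCycle_apply_left (f := θ)).1 (ih (n - m) (by omega) ?_)
        rw [← hmw, ← mul_apply, ← pow_add, Nat.sub_add_cancel hmn, hn]

/-- If every orbit of `σ` meets the image of `j`, then the first return map has as many orbits. -/
theorem IsFirstReturn.orb_eq [Finite α] {j : τ → α} (hj : Function.Injective j)
    {σ : Perm α} {θ : Perm τ} (h : IsFirstReturn j σ θ) (hσ : ∀ v, ∃ k : ℕ, (σ ^ k) v ∈ range j) :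
    orb σ = orb θ := by
  symm
  let f : Quotient (SameCycle.setoid θ) → Quotient (SameCycle.setoid σ) :=
    Quotient.map j (fun u v huv => (h.sameCycle_iff hj).1 huv)
  refine Nat.card_congr (Equiv.ofBijective f ⟨fun x y => ?_, fun x => ?_⟩)
  · induction x using Quotient.inductionOn
    induction y using Quotient.inductionOn
    intro hxy
    exact Quotient.sound ((h.sameCycle_iff hj).2 (Quotient.exact hxy))
  · induction x using Quotient.inductionOn with
    | _ x =>
      obtain ⟨k, w, hw⟩ := hσ x
      refine ⟨Quotient.mk _ w, Quotient.sound ?_⟩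
      change SameCycle σ (j w) x
      rw [hw]
      exact SameCycle.symm ⟨k, by simp⟩

/-- Two permutations with odd numbers of orbits have the same sign. So their quotient is an even
permutation, which moves at least three points unless it is the identity. -/
theorem three_le_ncard_ne_of_odd_orb [Finite τ] {θ₀ θ₁ : Perm τ}
    (h₀ : Odd (orb θ₀)) (h₁ : Odd (orb θ₁)) (hne : θ₀ ≠ θ₁) :
    3 ≤ {v | θ₀ v ≠ θ₁ v}.ncard := by
  classical
  have := Fintype.ofFinite τ
  set π := θ₀⁻¹ * θ₁ with hπ
  have hs : sign π = 1 := by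
    rw [hπ, sign_mul, sign_inv, sign_eq_neg_one_pow_orb, sign_eq_neg_one_pow_orb, ← pow_add]
    apply Even.neg_one_pow
    obtain ⟨a, ha⟩ := h₀
    obtain ⟨b, hb⟩ := h₁
    exact ⟨Fintype.card τ + a + b + 1, by omega⟩
  have hsupp : {v | θ₀ v ≠ θ₁ v} = (π.support : Set τ) := by
    ext v
    simp only [mem_ofPred_eq, Finset.mem_coe, mem_support, hπ, mul_apply, ne_eq, inv_eq_iff_eq]
    exact not_congr eq_comm
  rw [hsupp, ncard_coe_finset]
  have h1 : π ≠ 1 := fun h => hne (inv_mul_eq_one.1 h)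
  have h2 : π.support.card ≠ 2 := fun h => by
    rw [(card_support_eq_two.1 h).sign_eq] at hs
    exact absurd hs (by decide)
  have h3 : π.support.card ≠ 0 := fun h => h1 (support_eq_empty_iff.1 (Finset.card_eq_zero.1 h))
  have h4 := card_support_ne_one π
  omega

/-- Let `θ`, `θ₀`, `θ₁` agree off a set `E` of three points. The first return maps of `θ₀` and `θ₁`
to `E` are permutations of three points with odd numbers of orbits. They are different, as they
arise from that of `θ` by composition with the permutations of `E` by which `θ₀` and `θ₁` differ
from `θ`. So one of them is not the identity, hence a 3-cycle. -/
theorem orb_eq_one_or_of_agree_off [Finite τ] {θ θ₀ θ₁ : Perm τ} {E : Set τ} (hE3 : E.ncard = 3)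
    (hE₀ : ∀ v, v ∉ E → θ₀ v = θ v) (hE₁ : ∀ v, v ∉ E → θ₁ v = θ v)
    (h₀ : Odd (orb θ₀)) (h₁ : Odd (orb θ₁)) (hne : θ₀ ≠ θ₁) (h : orb θ = 1) :
    orb θ₀ = 1 ∨ orb θ₁ = 1 := by
  have hall := (orb_eq_one_iff.1 h).2
  have hj : Function.Injective (Subtype.val : E → τ) := Subtype.val_injective
  obtain ⟨κ, hκ⟩ := exists_isFirstReturn hj θ
  obtain ⟨κ₀, hκ₀⟩ := exists_isFirstReturn hj θ₀
  obtain ⟨κ₁, hκ₁⟩ := exists_isFirstReturn hj θ₁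
  have hcard : Nat.card E = 3 := hE3
  obtain ⟨e₀, he₀⟩ : E.Nonempty := nonempty_of_ncard_ne_zero (by omega)
  -- an orbit of `θ'` that misses `E` is an orbit of `θ`
  have meet : ∀ θ' : Perm τ, (∀ v, v ∉ E → θ' v = θ v) →
      ∀ v, ∃ k : ℕ, (θ' ^ k) v ∈ range (Subtype.val : E → τ) := by
    intro θ' hθ' v
    by_contra! hno
    rw [Subtype.range_val] at hno
    have hpow : ∀ k : ℕ, (θ' ^ k) v = (θ ^ k) v := by
      intro k
      induction k with
      | zero => rfl
      | succ k ih => rw [pow_succ', mul_apply, hθ' _ (hno k), ih, pow_succ', mul_apply]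
    obtain ⟨n, -, hn⟩ := (hall v e₀).exists_pow_eq'
    exact hno n (by rw [hpow, hn]; exact he₀)
  have key : ∀ (θ' : Perm τ) (κ' : Perm E), (∀ v, v ∉ E → θ' v = θ v) →
      IsFirstReturn (Subtype.val : E → τ) θ' κ' → κ' = 1 →
      ∀ e : E, θ' e = θ (κ.symm e) := by
    intro θ' κ' hθ' hκ' h1 e
    -- `θ' e` is `θ f` for some `f` in `E`
    have hf : θ.symm (θ' e) ∈ E := by
      by_contra hf
      have := hθ' _ hf
      rw [apply_symm_apply] at this
      rw [θ'.injective this] at hf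
      exact hf e.2
    obtain ⟨n, hn, hnw, hmin⟩ := hκ' e
    have hpow : ∀ k, k + 1 ≤ n → (θ' ^ (k + 1)) e = (θ ^ (k + 1)) (θ.symm (θ' e)) := by
      intro k hk
      induction k with
      | zero => simp
      | succ k ih =>
        have hk' := hmin (k + 1) (by omega) (by omega)
        rw [Subtype.range_val] at hk'
        rw [pow_succ', mul_apply, hθ' _ hk', ih (by omega), pow_succ' θ (k + 1), mul_apply]
    have hκf : κ ⟨θ.symm (θ' e), hf⟩ = e := by
      refine hκ.eq hj hn ?_ ?_
      · obtain ⟨m, rfl⟩ := Nat.exists_eq_add_of_lt hn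
        rw [← hpow _ (by omega), hnw, h1]; rfl
      · intro k hk hkn
        obtain ⟨m, rfl⟩ := Nat.exists_eq_add_of_lt hk
        rw [zero_add, ← hpow _ (by omega), ← zero_add m]
        exact hmin _ hk hkn
    rw [← hκf, symm_apply_apply, apply_symm_apply, hκf]
  rw [hκ₀.orb_eq hj (meet _ hE₀)] at h₀ ⊢
  rw [hκ₁.orb_eq hj (meet _ hE₁)] at h₁ ⊢
  by_contra! hcon
  have h0 : κ₀ = 1 := by
    by_contra hne; exact hcon.1 (orb_eq_one_of_card_eq_three hcard h₀ hne)
  have h1 : κ₁ = 1 := by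
    by_contra hne; exact hcon.2 (orb_eq_one_of_card_eq_three hcard h₁ hne)
  apply hne
  ext v
  by_cases hv : v ∈ E
  · rw [key θ₀ κ₀ hE₀ hκ₀ h0 ⟨v, hv⟩, key θ₁ κ₁ hE₁ hκ₁ h1 ⟨v, hv⟩]
  · rw [hE₀ v hv, hE₁ v hv]

end Equiv.Perm

/-! ### Factors as permutations -/

namespace Multidigraph

variable {V A : Type*}

/-- `S` contains exactly one in-arc and exactly one out-arc of every vertex. The factors of a 2-dd
are the sets with this property. -/
def IsFull (G : Multidigraph V A) (S : Set A) : Prop :=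
  ∀ v, (∃! a, a ∈ S ∧ G.tgt a = v) ∧ ∃! a, a ∈ S ∧ G.src a = v

theorem inDeg_eq_one_iff {G : Multidigraph V A} {S : Set A} {v : V} :
    G.inDeg S v = 1 ↔ ∃! a, a ∈ S ∧ G.tgt a = v := by
  rw [inDeg, ncard_eq_one]
  constructor
  · rintro ⟨a, ha⟩
    have h : ∀ b, (b ∈ S ∧ G.tgt b = v) ↔ b = a := fun b => Set.ext_iff.1 ha b
    exact ⟨a, (h a).2 rfl, fun b hb => (h b).1 hb⟩
  · rintro ⟨a, ha, h⟩
    exact ⟨a, Set.ext fun b => ⟨fun hb => h b hb,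
      fun hb => by rw [mem_singleton_iff.1 hb]; exact ha⟩⟩

theorem outDeg_eq_one_iff {G : Multidigraph V A} {S : Set A} {v : V} :
    G.outDeg S v = 1 ↔ ∃! a, a ∈ S ∧ G.src a = v :=
  inDeg_eq_one_iff (G := ⟨G.tgt, G.src⟩)

theorem isFull_iff_deg {G : Multidigraph V A} {S : Set A} :
    G.IsFull S ↔ ∀ v, G.inDeg S v = 1 ∧ G.outDeg S v = 1 := by
  simp only [IsFull, inDeg_eq_one_iff, outDeg_eq_one_iff]

theorem isFactor_univ_iff {G : Multidigraph V A} (hG : G.Is2dd) {S : Set A} :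
    G.IsFactor univ S ↔ G.IsFull S := by
  rw [isFull_iff_deg]
  constructor
  · exact fun h v => (h.2 v).2.2 (hG v)
  · refine fun h => ⟨subset_univ _, fun v => ⟨fun he => ?_, fun he => ?_, fun _ => h v⟩⟩
    · have := (hG v).1; rw [he.1] at this; omega
    · have := (hG v).2; rw [he.2] at this; omega

namespace IsFull

variable {G : Multidigraph V A} {S : Set A}

theorem eq_of_tgt (h : G.IsFull S) {a b : A} (ha : a ∈ S) (hb : b ∈ S) (hab : G.tgt a = G.tgt b) :
    a = b :=
  (h (G.tgt b)).1.unique ⟨ha, hab⟩ ⟨hb, rfl⟩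

theorem eq_of_src (h : G.IsFull S) {a b : A} (ha : a ∈ S) (hb : b ∈ S) (hab : G.src a = G.src b) :
    a = b :=
  (h (G.src b)).2.unique ⟨ha, hab⟩ ⟨hb, rfl⟩

/-- The permutation of the vertices that moves every vertex along the arc of `S` leaving it. -/
noncomputable def perm (h : G.IsFull S) : Equiv.Perm V where
  toFun v := G.tgt (h v).2.choose
  invFun v := G.src (h v).1.choose
  left_inv v := by
    have h1 := (h v).2.choose_spec.1
    have h2 := (h (G.tgt (h v).2.choose)).1.choose_spec.1
    dsimp only
    rw [h.eq_of_tgt h2.1 h1.1 h2.2, h1.2]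
  right_inv v := by
    have h1 := (h v).1.choose_spec.1
    have h2 := (h (G.src (h v).1.choose)).2.choose_spec.1
    dsimp only
    rw [h.eq_of_src h2.1 h1.1 h2.2, h1.2]

theorem perm_src (h : G.IsFull S) {a : A} (ha : a ∈ S) : h.perm (G.src a) = G.tgt a := by
  have h2 := (h (G.src a)).2.choose_spec.1
  change G.tgt _ = _
  rw [h.eq_of_src h2.1 ha h2.2]

theorem exists_arc (h : G.IsFull S) (v : V) : ∃ a ∈ S, G.src a = v ∧ G.tgt a = h.perm v := by
  obtain ⟨a, ⟨ha, rfl⟩, -⟩ := (h v).2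
  exact ⟨a, ha, rfl, (h.perm_src ha).symm⟩

theorem step_iff (h : G.IsFull S) {u v : V} : G.Step S u v ↔ h.perm u = v := by
  constructor
  · rintro ⟨a, ha, rfl, rfl⟩; exact h.perm_src ha
  · rintro rfl
    exact h.exists_arc u

theorem reflTransGen_pow (h : G.IsFull S) (u : V) (n : ℕ) :
    Relation.ReflTransGen (G.Step S) u ((h.perm ^ n) u) := by
  induction n with
  | zero => exact .refl
  | succ n ih => exact ih.tail (h.step_iff.2 (by rw [pow_succ', Equiv.Perm.mul_apply]))

theorem reflTransGen_iff [Finite V] (h : G.IsFull S) {u v : V} :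
    Relation.ReflTransGen (G.Step S) u v ↔ h.perm.SameCycle u v := by
  constructor
  · intro huv
    induction huv with
    | refl => exact Equiv.Perm.SameCycle.refl _ _
    | tail _ hbc ih =>
      rw [← h.step_iff.1 hbc]
      exact Equiv.Perm.sameCycle_apply_right.2 ih
  · intro huv
    obtain ⟨n, -, rfl⟩ := huv.exists_pow_eq'
    exact h.reflTransGen_pow u n

theorem transGen_self [Finite V] (h : G.IsFull S) (v : V) : Relation.TransGen (G.Step S) v v := by
  refine Relation.TransGen.head' (h.step_iff.2 rfl) (h.reflTransGen_iff.2 ?_)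
  exact Equiv.Perm.sameCycle_apply_left.2 (Equiv.Perm.SameCycle.refl _ _)

/-- The cycles of a factor are the orbits of its permutation. -/
theorem index_eq_orb [Finite V] (h : G.IsFull S) : G.index S = h.perm.orb := by
  let f : Quotient (Equiv.Perm.SameCycle.setoid h.perm) → Set V :=
    fun q => {w | q = Quotient.mk _ w}
  have hf : Function.Injective f := by
    intro p q hpq
    obtain ⟨w, rfl⟩ := Quotient.exists_rep p
    have : w ∈ f q := hpq ▸ (rfl : Quotient.mk _ w = Quotient.mk _ w)
    exact this.symm
  have hr : G.cycles S = range f := by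
    have hset : ∀ v, {w | Relation.ReflTransGen (G.Step S) v w} = f (Quotient.mk _ v) := by
      intro v
      ext w
      exact h.reflTransGen_iff.trans (Quotient.eq (r := Equiv.Perm.SameCycle.setoid h.perm)).symm
    ext C
    constructor
    · rintro ⟨v, -, rfl⟩
      exact ⟨_, (hset v).symm⟩
    · rintro ⟨q, rfl⟩
      obtain ⟨v, rfl⟩ := Quotient.exists_rep q
      exact ⟨v, h.transGen_self v, (hset v).symm⟩
  rw [index, hr, ← Nat.card_coe_set_eq]
  exact Nat.card_range_of_injective hf

end IsFull

theorem hamiltonian_iff [Finite V] {G : Multidigraph V A} :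
    G.Hamiltonian ↔ ∃ (S : Set A) (h : G.IsFull S), h.perm.orb = 1 := by
  constructor
  · rintro ⟨hne, S, hS, hr⟩
    refine ⟨S, isFull_iff_deg.2 hS, Equiv.Perm.orb_eq_one_iff.2 ⟨hne, fun u v => ?_⟩⟩
    exact (isFull_iff_deg.2 hS).reflTransGen_iff.1 (hr u v)
  · rintro ⟨S, h, h1⟩
    obtain ⟨hne, hall⟩ := Equiv.Perm.orb_eq_one_iff.1 h1
    exact ⟨hne, S, isFull_iff_deg.1 h, fun u v => h.reflTransGen_iff.2 (hall u v)⟩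

theorem isOdd_iff [Finite V] {G : Multidigraph V A} (hG : G.Is2dd) :
    G.IsOdd ↔ ∀ (S : Set A) (h : G.IsFull S), Odd h.perm.orb := by
  constructor
  · intro ho S h
    rw [← h.index_eq_orb]
    exact ho S ((isFactor_univ_iff hG).2 h)
  · intro ho S h
    rw [((isFactor_univ_iff hG).1 h).index_eq_orb]
    exact ho S _

/-- Every finite 2-dd has a factor, by Hall's marriage theorem. -/
theorem Is2dd.exists_isFull [Finite V] [Finite A] {G : Multidigraph V A} (hG : G.Is2dd) :
    ∃ S, G.IsFull S := by
  classical
  have := Fintype.ofFinite V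
  have := Fintype.ofFinite A
  have hin : ∀ v, (Finset.univ.filter fun a => G.tgt a = v).card = 2 := fun v => by
    rw [← (hG v).1, inDeg, ← ncard_coe_finset]; congr 1; ext; simp
  have hout : ∀ v, (Finset.univ.filter fun a => G.src a = v).card = 2 := fun v => by
    rw [← (hG v).2, outDeg, ← ncard_coe_finset]; congr 1; ext; simp
  let t : V → Finset V := fun v => (Finset.univ.filter fun a => G.src a = v).image G.tgt
  obtain ⟨f, hf, hft⟩ := (Finset.all_card_le_biUnion_card_iff_exists_injective t).1 (by
    intro s
    have h1 : (Finset.univ.filter fun a => G.src a ∈ s).card = s.card * 2 :=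
      (Finset.card_eq_sum_card_fiberwise (f := G.src) (t := s)
        (fun a ha => by simpa using ha)).trans
        (Finset.sum_const_nat fun v hv => by
          rw [Finset.filter_filter, ← hout v]
          congr 1; ext a; simp only [Finset.mem_filter, Finset.mem_univ, true_and]
          exact ⟨fun h => h.2, fun h => ⟨h ▸ hv, h⟩⟩)
    have h2 : (Finset.univ.filter fun a => G.tgt a ∈ s.biUnion t).card = (s.biUnion t).card * 2 :=
      (Finset.card_eq_sum_card_fiberwise (f := G.tgt) (t := s.biUnion t)
        (fun a ha => by simpa using ha)).trans
        (Finset.sum_const_nat fun v hv => by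
          rw [Finset.filter_filter, ← hin v]
          congr 1; ext a; simp only [Finset.mem_filter, Finset.mem_univ, true_and]
          exact ⟨fun h => h.2, fun h => ⟨h ▸ hv, h⟩⟩)
    have h3 : (Finset.univ.filter fun a => G.src a ∈ s).card ≤
        (Finset.univ.filter fun a => G.tgt a ∈ s.biUnion t).card := by
      refine Finset.card_le_card fun a ha => ?_
      simp only [Finset.mem_filter, Finset.mem_univ, true_and, Finset.mem_biUnion] at ha ⊢
      exact ⟨_, ha, by simp only [t, Finset.mem_image, Finset.mem_filter, Finset.mem_univ, true_and]
                       exact ⟨a, rfl, rfl⟩⟩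
    omega)
  have harc : ∀ v, ∃ a, G.src a = v ∧ G.tgt a = f v := fun v => by simpa [t] using hft v
  choose a ha hat using harc
  refine ⟨range a, fun v => ⟨?_, ?_⟩⟩
  · obtain ⟨u, rfl⟩ := (Finite.injective_iff_surjective.1 hf) v
    refine ⟨a u, ⟨⟨u, rfl⟩, hat u⟩, ?_⟩
    rintro _ ⟨⟨w, rfl⟩, hw⟩
    rw [hf ((hat w).symm.trans hw)]
  · refine ⟨a v, ⟨⟨v, rfl⟩, ha v⟩, ?_⟩
    rintro _ ⟨⟨w, rfl⟩, hw⟩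
    rw [← hw, ha w]

/-! ### Alternating cycles and closed sets of arcs -/

/-- With every arc, `K` contains all arcs with the same start-vertex or the same end-vertex. In a
2-digraph this says that `K` is a union of alternating cycles. -/
structure IsClosed (G : Multidigraph V A) (K : Set A) : Prop where
  mem_of_tgt : ∀ ⦃a b⦄, a ∈ K → G.tgt a = G.tgt b → b ∈ K
  mem_of_src : ∀ ⦃a b⦄, a ∈ K → G.src a = G.src b → b ∈ K

/-- No vertex has more than two in-arcs or more than two out-arcs. -/
def DegLeTwo (G : Multidigraph V A) : Prop :=
  (∀ a b c, G.tgt a = G.tgt b → G.tgt a = G.tgt c → a = b ∨ a = c ∨ b = c) ∧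
    ∀ a b c, G.src a = G.src b → G.src a = G.src c → a = b ∨ a = c ∨ b = c

theorem Is2dd.degLeTwo {G : Multidigraph V A} (hG : G.Is2dd) : G.DegLeTwo := by
  constructor
  · intro a b c hab hac
    obtain ⟨x, y, -, hxy⟩ := ncard_eq_two.1 (hG (G.tgt a)).1
    have h : ∀ d, G.tgt a = G.tgt d → d = x ∨ d = y := fun d hd =>
      (Set.ext_iff.1 hxy d).1 ⟨trivial, hd.symm⟩
    have h1 := h a rfl
    have h2 := h b hab
    have h3 := h c hac
    grind
  · intro a b c hab hac
    obtain ⟨x, y, -, hxy⟩ := ncard_eq_two.1 (hG (G.src a)).2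
    have h : ∀ d, G.src a = G.src d → d = x ∨ d = y := fun d hd =>
      (Set.ext_iff.1 hxy d).1 ⟨trivial, hd.symm⟩
    have h1 := h a rfl
    have h2 := h b hab
    have h3 := h c hac
    grind

/-- `M` and `N` are the two perfect matchings into which the alternating cycle `X` decomposes: they
partition `X`, and every arc of one of them shares its end-vertex with an arc of the other one, and
so does its start-vertex. -/
structure IsSplitting (G : Multidigraph V A) (X M N : Set A) : Prop where
  union : M ∪ N = X
  disjoint : Disjoint M N
  tgt_left : ∀ a ∈ M, ∃ b ∈ N, G.tgt b = G.tgt a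
  src_left : ∀ a ∈ M, ∃ b ∈ N, G.src b = G.src a
  tgt_right : ∀ a ∈ N, ∃ b ∈ M, G.tgt b = G.tgt a
  src_right : ∀ a ∈ N, ∃ b ∈ M, G.src b = G.src a

theorem IsSplitting.symm {G : Multidigraph V A} {X M N : Set A} (h : G.IsSplitting X M N) :
    G.IsSplitting X N M :=
  ⟨by rw [union_comm, h.union], h.disjoint.symm, h.tgt_right, h.src_right, h.tgt_left, h.src_left⟩

/-- The arcs with even and those with odd index form the two matchings. -/
theorem IsAC.exists_isSplitting {G : Multidigraph V A} {X : Set A} (hX : G.IsAC X) :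
    ∃ M N, G.IsSplitting X M N := by
  obtain ⟨r, e, hr, hinj, rfl, he⟩ := hX
  have hnext : ∀ k < r, (2 * k + 1 + 1) % (2 * r) < 2 * r ∧ Even ((2 * k + 1 + 1) % (2 * r)) := by
    intro k hk
    refine ⟨Nat.mod_lt _ (by omega), ?_⟩
    rw [show 2 * k + 1 + 1 = 2 * (k + 1) by ring, Nat.mul_mod_mul_left]
    exact even_two_mul _
  have h0 : ∀ i, i < 2 * r → Even i → i + 1 < 2 * r := by
    rintro i hi ⟨k, rfl⟩; omega
  -- the predecessor of an even index, cyclically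
  have hprev : ∀ i, i < 2 * r → Even i → ∃ l < 2 * r, Odd l ∧ (l + 1) % (2 * r) = i := by
    rintro i hi ⟨k, rfl⟩
    rcases Nat.eq_zero_or_pos k with rfl | hk
    · exact ⟨2 * r - 1, by omega, ⟨r - 1, by omega⟩, by
        rw [Nat.sub_add_cancel (by omega), Nat.mod_self]⟩
    · exact ⟨k + k - 1, by omega, ⟨k - 1, by omega⟩, by
        rw [Nat.sub_add_cancel (by omega), Nat.mod_eq_of_lt hi]⟩
  refine ⟨e '' {i | i < 2 * r ∧ Even i}, e '' {i | i < 2 * r ∧ Odd i}, ?_, ?_, ?_, ?_, ?_, ?_⟩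
  · rw [← image_union]
    congr 1
    ext i
    have := Nat.even_or_odd i
    simp only [mem_union, mem_ofPred_eq, mem_Iio]
    tauto
  · rw [Set.disjoint_left]
    rintro _ ⟨i, ⟨hi, hie⟩, rfl⟩ ⟨j, ⟨hj, hjo⟩, hij⟩
    rw [hinj hj hi hij] at hjo
    exact (Nat.not_even_iff_odd.2 hjo) hie
  · rintro _ ⟨i, ⟨hi, hie⟩, rfl⟩
    refine ⟨_, ⟨i + 1, ⟨h0 i hi hie, hie.add_one⟩, rfl⟩, ?_⟩
    have := (he i hi).1 hie
    rw [Nat.mod_eq_of_lt (h0 i hi hie)] at this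
    exact this.symm
  · rintro _ ⟨i, ⟨hi, hie⟩, rfl⟩
    obtain ⟨l, hl, hlo, rfl⟩ := hprev i hi hie
    exact ⟨_, ⟨l, ⟨hl, hlo⟩, rfl⟩, (he l hl).2 hlo⟩
  · rintro _ ⟨i, ⟨hi, hio⟩, rfl⟩
    obtain ⟨k, rfl⟩ := hio
    refine ⟨_, ⟨2 * k, ⟨by omega, even_two_mul k⟩, rfl⟩, ?_⟩
    have := (he (2 * k) (by omega)).1 (even_two_mul k)
    rwa [Nat.mod_eq_of_lt hi] at this
  · rintro _ ⟨i, ⟨hi, hio⟩, rfl⟩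
    obtain ⟨k, rfl⟩ := hio
    exact ⟨_, ⟨_, hnext k (by omega), rfl⟩, ((he _ hi).2 (odd_two_mul_add_one k)).symm⟩

section Splitting

variable {G : Multidigraph V A} {X M N : Set A}

theorem IsSplitting.eq_of_tgt (h : G.IsSplitting X M N) (hG : G.DegLeTwo) {a b : A} (ha : a ∈ M)
    (hb : b ∈ M) (hab : G.tgt a = G.tgt b) : a = b := by
  obtain ⟨c, hc, hca⟩ := h.tgt_left a ha
  have h1 : a ≠ c := fun hac => Set.disjoint_left.1 h.disjoint ha (hac ▸ hc)
  have h2 : b ≠ c := fun hac => Set.disjoint_left.1 h.disjoint hb (hac ▸ hc)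
  have := hG.1 a b c hab hca.symm
  tauto

theorem IsSplitting.eq_of_src (h : G.IsSplitting X M N) (hG : G.DegLeTwo) {a b : A} (ha : a ∈ M)
    (hb : b ∈ M) (hab : G.src a = G.src b) : a = b := by
  obtain ⟨c, hc, hca⟩ := h.src_left a ha
  have h1 : a ≠ c := fun hac => Set.disjoint_left.1 h.disjoint ha (hac ▸ hc)
  have h2 : b ≠ c := fun hac => Set.disjoint_left.1 h.disjoint hb (hac ▸ hc)
  have := hG.2 a b c hab hca.symm
  tauto

theorem IsSplitting.exists_tgt (h : G.IsSplitting X M N) {a : A} (ha : a ∈ X) :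
    ∃ b ∈ M, G.tgt b = G.tgt a := by
  rw [← h.union] at ha
  rcases ha with ha | ha
  · exact ⟨a, ha, rfl⟩
  · exact h.tgt_right a ha

theorem IsSplitting.exists_src (h : G.IsSplitting X M N) {a : A} (ha : a ∈ X) :
    ∃ b ∈ M, G.src b = G.src a := by
  rw [← h.union] at ha
  rcases ha with ha | ha
  · exact ⟨a, ha, rfl⟩
  · exact h.src_right a ha

theorem IsSplitting.subset (h : G.IsSplitting X M N) : M ⊆ X := h.union ▸ subset_union_left

/-- Since no vertex has more than two in-arcs or out-arcs, the two matchings exhaust the arcs at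
each vertex of the alternating cycle. -/
theorem IsAC.isClosed (hX : G.IsAC X) (hG : G.DegLeTwo) : G.IsClosed X := by
  obtain ⟨M, N, h⟩ := hX.exists_isSplitting
  have ht : ∀ M N, G.IsSplitting X M N → ∀ a ∈ M, ∀ b, G.tgt a = G.tgt b → b ∈ X := by
    intro M N h a ha b hab
    obtain ⟨c, hc, hca⟩ := h.tgt_left a ha
    have h1 : a ≠ c := fun hac => Set.disjoint_left.1 h.disjoint ha (hac ▸ hc)
    rcases hG.1 a b c hab hca.symm with h2 | h2 | h2
    · exact h2 ▸ h.subset ha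
    · exact absurd h2 h1
    · exact h2 ▸ h.symm.subset hc
  have hs : ∀ M N, G.IsSplitting X M N → ∀ a ∈ M, ∀ b, G.src a = G.src b → b ∈ X := by
    intro M N h a ha b hab
    obtain ⟨c, hc, hca⟩ := h.src_left a ha
    have h1 : a ≠ c := fun hac => Set.disjoint_left.1 h.disjoint ha (hac ▸ hc)
    rcases hG.2 a b c hab hca.symm with h2 | h2 | h2
    · exact h2 ▸ h.subset ha
    · exact absurd h2 h1
    · exact h2 ▸ h.symm.subset hc
  constructor
  · intro a b ha hab
    rw [← h.union] at ha
    exact ha.elim (fun ha => ht M N h a ha b hab) (fun ha => ht N M h.symm a ha b hab)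
  · intro a b ha hab
    rw [← h.union] at ha
    exact ha.elim (fun ha => hs M N h a ha b hab) (fun ha => hs N M h.symm a ha b hab)

/-- An alternating cycle is a minimal non-empty closed set of arcs. -/
theorem IsAC.subset_of_isClosed (hX : G.IsAC X) {Y : Set A} (hY : G.IsClosed Y)
    (h : (X ∩ Y).Nonempty) : X ⊆ Y := by
  obtain ⟨r, e, hr, hinj, rfl, he⟩ := hX
  obtain ⟨_, ⟨i, hi, rfl⟩, hiY⟩ := h
  have hr2 : 0 < 2 * r := by omega
  have hk : ∀ k, e ((i + k) % (2 * r)) ∈ Y := by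
    intro k
    induction k with
    | zero => rwa [add_zero, Nat.mod_eq_of_lt hi]
    | succ k ih =>
      have hlt := Nat.mod_lt (i + k) hr2
      have hmod : (i + (k + 1)) % (2 * r) = ((i + k) % (2 * r) + 1) % (2 * r) := by
        rw [Nat.mod_add_mod, add_assoc]
      rw [hmod]
      rcases Nat.even_or_odd ((i + k) % (2 * r)) with h | h
      · exact hY.mem_of_tgt ih ((he _ hlt).1 h)
      · exact hY.mem_of_src ih ((he _ hlt).2 h)
  rintro _ ⟨l, hl, rfl⟩
  have := hk (2 * r - i + l)
  simp only [mem_Iio] at hi hl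
  rwa [show i + (2 * r - i + l) = l + 2 * r by omega, Nat.add_mod_right,
    Nat.mod_eq_of_lt hl] at this

theorem IsAC.nonempty (hX : G.IsAC X) : X.Nonempty := by
  obtain ⟨r, e, hr, -, rfl, -⟩ := hX
  exact ⟨e 0, 0, by simp only [mem_Iio]; omega, rfl⟩

theorem IsAC.eq_of_inter (hG : G.DegLeTwo) {Y : Set A} (hX : G.IsAC X) (hY : G.IsAC Y)
    (h : (X ∩ Y).Nonempty) : X = Y :=
  (hX.subset_of_isClosed (hY.isClosed hG) h).antisymm
    (hY.subset_of_isClosed (hX.isClosed hG) (inter_comm X Y ▸ h))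

/-- Two parallel arcs form an alternating cycle. -/
theorem isAC_pair {a b : A} (hab : a ≠ b) (ht : G.tgt a = G.tgt b) (hs : G.src a = G.src b) :
    G.IsAC {a, b} := by
  refine ⟨1, fun i => if i = 0 then a else b, one_pos, ?_, ?_, ?_⟩
  · intro i hi j hj hij
    simp only [mem_Iio] at hi hj
    interval_cases i <;> interval_cases j <;> simp_all
  · ext c
    simp only [mem_image, mem_Iio, mem_insert_iff, mem_singleton_iff]
    constructor
    · rintro ⟨i, -, rfl⟩
      by_cases hi : i = 0 <;> simp [hi]
    · rintro (rfl | rfl)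
      · exact ⟨0, by norm_num, by simp⟩
      · exact ⟨1, by norm_num, by simp⟩
  · intro i hi
    interval_cases i <;> simp [ht, hs]

end Splitting

theorem IsClosed.compl {G : Multidigraph V A} {K : Set A} (h : G.IsClosed K) : G.IsClosed Kᶜ :=
  ⟨fun _ _ ha hab hb => ha (h.mem_of_tgt hb hab.symm),
    fun _ _ ha hab hb => ha (h.mem_of_src hb hab.symm)⟩

theorem IsClosed.union {G : Multidigraph V A} {K L : Set A} (h : G.IsClosed K) (h' : G.IsClosed L) :
    G.IsClosed (K ∪ L) :=
  ⟨fun _ _ ha hab => ha.imp (h.mem_of_tgt · hab) (h'.mem_of_tgt · hab),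
    fun _ _ ha hab => ha.imp (h.mem_of_src · hab) (h'.mem_of_src · hab)⟩

end Multidigraph

/-! ### Open factors and their routes -/

namespace Multidigraph

variable {V A : Type*}

/-- The end-vertices of the arcs in `K`. -/
def ins (G : Multidigraph V A) (K : Set A) : Set V := G.tgt '' K

/-- The start-vertices of the arcs in `K`. -/
def outs (G : Multidigraph V A) (K : Set A) : Set V := G.src '' K

section Closed

variable {G : Multidigraph V A} {K : Set A}

/-! In a 2-dd, the entry vertices of a closed set `K` of arcs are those in `ins Kᶜ` but not in `outs
Kᶜ`, its exit vertices those in `outs Kᶜ` but not in `ins Kᶜ`, and its saturated vertices those in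
neither set. -/

theorem Is2dd.exists_tgt (hG : G.Is2dd) (v : V) : ∃ a, G.tgt a = v := by
  obtain ⟨a, -, ha⟩ := nonempty_of_ncard_ne_zero (s := {a | a ∈ univ ∧ G.tgt a = v})
    (by rw [← inDeg, (hG v).1]; norm_num)
  exact ⟨a, ha⟩

theorem Is2dd.exists_src (hG : G.Is2dd) (v : V) : ∃ a, G.src a = v := by
  obtain ⟨a, -, ha⟩ := nonempty_of_ncard_ne_zero (s := {a | a ∈ univ ∧ G.src a = v})
    (by rw [← outDeg, (hG v).2]; norm_num)
  exact ⟨a, ha⟩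

theorem IsClosed.tgt_mem_ins (hK : G.IsClosed K) {a : A} : G.tgt a ∈ G.ins K ↔ a ∈ K :=
  ⟨fun ⟨_, hb, hab⟩ => hK.mem_of_tgt hb hab, fun h => ⟨a, h, rfl⟩⟩

theorem IsClosed.src_mem_outs (hK : G.IsClosed K) {a : A} : G.src a ∈ G.outs K ↔ a ∈ K :=
  ⟨fun ⟨_, hb, hab⟩ => hK.mem_of_src hb hab, fun h => ⟨a, h, rfl⟩⟩

theorem IsClosed.mem_ins_compl (hK : G.IsClosed K) (hG : G.Is2dd) {v : V} :
    v ∈ G.ins Kᶜ ↔ v ∉ G.ins K := by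
  obtain ⟨a, rfl⟩ := hG.exists_tgt v
  rw [hK.compl.tgt_mem_ins, hK.tgt_mem_ins, mem_compl_iff]

theorem IsClosed.mem_outs_compl (hK : G.IsClosed K) (hG : G.Is2dd) {v : V} :
    v ∈ G.outs Kᶜ ↔ v ∉ G.outs K := by
  obtain ⟨a, rfl⟩ := hG.exists_src v
  rw [hK.compl.src_mem_outs, hK.src_mem_outs, mem_compl_iff]

theorem IsClosed.inDeg_of_mem (hK : G.IsClosed K) (hG : G.Is2dd) {v : V} (hv : v ∈ G.ins K) :
    G.inDeg K v = 2 := by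
  rw [← (hG v).1, inDeg, inDeg]
  congr 1
  ext a
  refine ⟨fun h => ⟨trivial, h.2⟩, fun h => ⟨?_, h.2⟩⟩
  rw [← hK.tgt_mem_ins, h.2]
  exact hv

theorem inDeg_of_notMem {v : V} (hv : v ∉ G.ins K) : G.inDeg K v = 0 := by
  have : {a | a ∈ K ∧ G.tgt a = v} = ∅ :=
    eq_empty_iff_forall_notMem.2 fun a h => hv ⟨a, h.1, h.2⟩
  rw [inDeg, this, ncard_empty]

theorem IsClosed.outDeg_of_mem (hK : G.IsClosed K) (hG : G.Is2dd) {v : V} (hv : v ∈ G.outs K) :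
    G.outDeg K v = 2 := by
  rw [← (hG v).2, outDeg, outDeg]
  congr 1
  ext a
  refine ⟨fun h => ⟨trivial, h.2⟩, fun h => ⟨?_, h.2⟩⟩
  rw [← hK.src_mem_outs, h.2]
  exact hv

theorem outDeg_of_notMem {v : V} (hv : v ∉ G.outs K) : G.outDeg K v = 0 := by
  have : {a | a ∈ K ∧ G.src a = v} = ∅ :=
    eq_empty_iff_forall_notMem.2 fun a h => hv ⟨a, h.1, h.2⟩
  rw [outDeg, this, ncard_empty]

theorem IsClosed.isEntry_iff (hK : G.IsClosed K) (hG : G.Is2dd) {v : V} :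
    G.IsEntry K v ↔ v ∈ G.ins Kᶜ ∧ v ∉ G.outs Kᶜ := by
  rw [hK.mem_ins_compl hG, hK.mem_outs_compl hG, not_not]
  constructor
  · rintro ⟨h1, h2⟩
    refine ⟨fun h => ?_, by_contra fun h => ?_⟩
    · rw [hK.inDeg_of_mem hG h] at h1; omega
    · rw [outDeg_of_notMem h] at h2; omega
  · exact fun ⟨h1, h2⟩ => ⟨inDeg_of_notMem h1, hK.outDeg_of_mem hG h2⟩

theorem IsClosed.isExit_iff (hK : G.IsClosed K) (hG : G.Is2dd) {v : V} :
    G.IsExit K v ↔ v ∉ G.ins Kᶜ ∧ v ∈ G.outs Kᶜ := by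
  rw [hK.mem_ins_compl hG, hK.mem_outs_compl hG, not_not]
  constructor
  · rintro ⟨h1, h2⟩
    refine ⟨by_contra fun h => ?_, fun h => ?_⟩
    · rw [inDeg_of_notMem h] at h1; omega
    · rw [hK.outDeg_of_mem hG h] at h2; omega
  · exact fun ⟨h1, h2⟩ => ⟨hK.inDeg_of_mem hG h1, outDeg_of_notMem h2⟩

theorem IsClosed.isSat_iff (hK : G.IsClosed K) (hG : G.Is2dd) {v : V} :
    G.IsSat K v ↔ v ∉ G.ins Kᶜ ∧ v ∉ G.outs Kᶜ := by
  rw [hK.mem_ins_compl hG, hK.mem_outs_compl hG, not_not, not_not]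
  constructor
  · rintro ⟨h1, h2⟩
    refine ⟨by_contra fun h => ?_, by_contra fun h => ?_⟩
    · rw [inDeg_of_notMem h] at h1; omega
    · rw [outDeg_of_notMem h] at h2; omega
  · exact fun ⟨h1, h2⟩ => ⟨hK.inDeg_of_mem hG h1, hK.outDeg_of_mem hG h2⟩

theorem IsFull.isFactor_inter {S : Set A} (h : G.IsFull S) (hK : G.IsClosed K) (hG : G.Is2dd) :
    G.IsFactor K (S ∩ K) := by
  have hin : ∀ v, v ∈ G.ins K → G.inDeg (S ∩ K) v = 1 := by
    intro v hv
    rw [inDeg_eq_one_iff]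
    obtain ⟨a, ⟨ha, rfl⟩, hu⟩ := (h v).1
    exact ⟨a, ⟨⟨ha, hK.tgt_mem_ins.1 hv⟩, rfl⟩, fun b hb => hu b ⟨hb.1.1, hb.2⟩⟩
  have hout : ∀ v, v ∈ G.outs K → G.outDeg (S ∩ K) v = 1 := by
    intro v hv
    rw [outDeg_eq_one_iff]
    obtain ⟨a, ⟨ha, rfl⟩, hu⟩ := (h v).2
    exact ⟨a, ⟨⟨ha, hK.src_mem_outs.1 hv⟩, rfl⟩, fun b hb => hu b ⟨hb.1.1, hb.2⟩⟩
  have hin' : ∀ v, v ∉ G.ins K → G.inDeg (S ∩ K) v = 0 := fun v hv =>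
    inDeg_of_notMem fun ⟨a, ha, hav⟩ => hv ⟨a, ha.2, hav⟩
  have hout' : ∀ v, v ∉ G.outs K → G.outDeg (S ∩ K) v = 0 := fun v hv =>
    outDeg_of_notMem fun ⟨a, ha, hav⟩ => hv ⟨a, ha.2, hav⟩
  refine ⟨inter_subset_right, fun v => ⟨fun hv => ?_, fun hv => ?_, fun hv => ?_⟩⟩
  · rw [hK.isEntry_iff hG, hK.mem_ins_compl hG, hK.mem_outs_compl hG, not_not] at hv
    exact ⟨hin' v hv.1, hout v hv.2⟩
  · rw [hK.isExit_iff hG, hK.mem_ins_compl hG, hK.mem_outs_compl hG, not_not] at hv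
    exact ⟨hin v hv.1, hout' v hv.2⟩
  · rw [hK.isSat_iff hG, hK.mem_ins_compl hG, hK.mem_outs_compl hG, not_not, not_not] at hv
    exact ⟨hin v hv.1, hout v hv.2⟩

/-- A factor of `K` replaces the part inside `K` of a factor of the whole 2-dd. -/
theorem IsFactor.isFull_union {F S : Set A} (hF : G.IsFactor K F) (h : G.IsFull S)
    (hK : G.IsClosed K) (hG : G.Is2dd) : G.IsFull (F ∪ S ∩ Kᶜ) := by
  intro v
  constructor
  · by_cases hv : v ∈ G.ins K
    · have h1 : G.inDeg F v = 1 := by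
        by_cases ho : v ∈ G.outs K
        · exact ((hF.2 v).2.2 ⟨hK.inDeg_of_mem hG hv, hK.outDeg_of_mem hG ho⟩).1
        · exact ((hF.2 v).2.1 ⟨hK.inDeg_of_mem hG hv, outDeg_of_notMem ho⟩).1
      obtain ⟨a, ⟨ha, rfl⟩, hu⟩ := inDeg_eq_one_iff.1 h1
      refine ⟨a, ⟨Or.inl ha, rfl⟩, ?_⟩
      rintro b ⟨hb | hb, hbv⟩
      · exact hu b ⟨hb, hbv⟩
      · exact absurd (hK.tgt_mem_ins.1 (hbv ▸ hv)) hb.2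
    · obtain ⟨a, ⟨ha, rfl⟩, hu⟩ := (h v).1
      refine ⟨a, ⟨Or.inr ⟨ha, fun haK => hv ⟨a, haK, rfl⟩⟩, rfl⟩, ?_⟩
      rintro b ⟨hb | hb, hbv⟩
      · exact absurd ⟨b, hF.1 hb, hbv⟩ hv
      · exact hu b ⟨hb.1, hbv⟩
  · by_cases hv : v ∈ G.outs K
    · have h1 : G.outDeg F v = 1 := by
        by_cases ho : v ∈ G.ins K
        · exact ((hF.2 v).2.2 ⟨hK.inDeg_of_mem hG ho, hK.outDeg_of_mem hG hv⟩).2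
        · exact ((hF.2 v).1 ⟨inDeg_of_notMem ho, hK.outDeg_of_mem hG hv⟩).2
      obtain ⟨a, ⟨ha, rfl⟩, hu⟩ := outDeg_eq_one_iff.1 h1
      refine ⟨a, ⟨Or.inl ha, rfl⟩, ?_⟩
      rintro b ⟨hb | hb, hbv⟩
      · exact hu b ⟨hb, hbv⟩
      · exact absurd (hK.src_mem_outs.1 (hbv ▸ hv)) hb.2
    · obtain ⟨a, ⟨ha, rfl⟩, hu⟩ := (h v).2
      refine ⟨a, ⟨Or.inr ⟨ha, fun haK => hv ⟨a, haK, rfl⟩⟩, rfl⟩, ?_⟩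
      rintro b ⟨hb | hb, hbv⟩
      · exact absurd ⟨b, hF.1 hb, hbv⟩ hv
      · exact hu b ⟨hb.1, hbv⟩

theorem union_inter_compl_inter {F S : Set A} (hF : F ⊆ K) : (F ∪ S ∩ Kᶜ) ∩ K = F := by
  ext a
  have := @hF a
  simp only [mem_inter_iff, mem_union, mem_compl_iff]
  tauto

namespace IsFull

variable {S S' : Set A}

theorem union (h : G.IsFull S) (h' : G.IsFull S') (hK : G.IsClosed K) (hG : G.Is2dd) :
    G.IsFull (S ∩ K ∪ S' ∩ Kᶜ) :=
  (h.isFactor_inter hK hG).isFull_union h' hK hG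

theorem perm_congr (h : G.IsFull S) (h' : G.IsFull S') (hK : G.IsClosed K) (hSS' : S ∩ K = S' ∩ K)
    {v : V} (hv : v ∈ G.outs K) : h.perm v = h'.perm v := by
  obtain ⟨a, ha, rfl, hav⟩ := h.exists_arc v
  have haK : a ∈ S ∩ K := ⟨ha, hK.src_mem_outs.1 hv⟩
  rw [hSS'] at haK
  rw [← hav, h'.perm_src haK.1]

theorem perm_mem_ins (h : G.IsFull S) (hK : G.IsClosed K) {v : V} :
    h.perm v ∈ G.ins K ↔ v ∈ G.outs K := by
  obtain ⟨a, ha, rfl, hav⟩ := h.exists_arc v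
  rw [← hav, hK.tgt_mem_ins, hK.src_mem_outs]

/-- The factor `S` has no cycle within `K`: all its cycles contain vertices whose in-arcs are
outside `K`. -/
def OpenOn (h : G.IsFull S) (K : Set A) : Prop :=
  ∀ v, ∃ k : ℕ, (h.perm ^ k) v ∈ G.ins Kᶜ

theorem step_inter_iff (h : G.IsFull S) (hK : G.IsClosed K) {u v : V} :
    G.Step (S ∩ K) u v ↔ h.perm u = v ∧ u ∈ G.outs K := by
  constructor
  · rintro ⟨a, ha, rfl, rfl⟩
    exact ⟨h.perm_src ha.1, a, ha.2, rfl⟩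
  · rintro ⟨rfl, hu⟩
    obtain ⟨a, ha, rfl, hav⟩ := h.exists_arc u
    exact ⟨a, ⟨ha, hK.src_mem_outs.1 hu⟩, rfl, hav⟩

theorem reflTransGen_inter_iff (h : G.IsFull S) (hK : G.IsClosed K) {u v : V} :
    Relation.ReflTransGen (G.Step (S ∩ K)) u v ↔
      ∃ n, (h.perm ^ n) u = v ∧ ∀ k < n, (h.perm ^ k) u ∈ G.outs K := by
  constructor
  · intro huv
    induction huv with
    | refl => exact ⟨0, rfl, fun k hk => absurd hk (Nat.not_lt_zero k)⟩
    | tail _ hbc ih =>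
      obtain ⟨n, rfl, hn⟩ := ih
      rw [h.step_inter_iff hK] at hbc
      refine ⟨n + 1, by rw [pow_succ', Equiv.Perm.mul_apply, hbc.1], fun k hk => ?_⟩
      rcases Nat.lt_succ_iff_lt_or_eq.1 hk with hk | rfl
      · exact hn k hk
      · exact hbc.2
  · rintro ⟨n, rfl, hn⟩
    induction n with
    | zero => exact .refl
    | succ n ih =>
      refine (ih fun k hk => hn k (by omega)).tail ((h.step_inter_iff hK).2 ⟨?_, hn n (by omega)⟩)
      rw [pow_succ', Equiv.Perm.mul_apply]

/-- `S` is open on `K` if and only if its part inside `K` is an open factor of `K`. -/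
theorem openOn_iff [Finite V] (h : G.IsFull S) (hK : G.IsClosed K) (hG : G.Is2dd) :
    h.OpenOn K ↔ G.index (S ∩ K) = 0 := by
  rw [index, ncard_eq_zero, eq_empty_iff_forall_notMem]
  constructor
  · rintro ho _ ⟨v, hv, -⟩
    -- the vertices on closed walks of `S ∩ K` through `v` form an orbit that avoids `ins Kᶜ`
    let Z : Set V := {w | Relation.TransGen (G.Step (S ∩ K)) w v ∧
      Relation.TransGen (G.Step (S ∩ K)) v w}
    have hZ : ∀ w ∈ Z, h.perm w ∈ Z := by
      rintro w ⟨hwv, hvw⟩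
      obtain ⟨u, hwu, huv⟩ := Relation.TransGen.head'_iff.1 hwv
      rw [((h.step_inter_iff hK).1 hwu).1]
      exact ⟨(Relation.TransGen.trans_right huv hv), hvw.tail hwu⟩
    have hk : ∀ k : ℕ, (h.perm ^ k) v ∈ Z := by
      intro k
      induction k with
      | zero => exact ⟨hv, hv⟩
      | succ k ih => rw [pow_succ', Equiv.Perm.mul_apply]; exact hZ _ ih
    obtain ⟨k, hkT⟩ := ho v
    obtain ⟨u, -, a, ha, -, hau⟩ := Relation.TransGen.tail'_iff.1 (hk k).2
    rw [hK.mem_ins_compl hG] at hkT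
    exact hkT ⟨a, ha.2, hau⟩
  · intro hc v
    by_contra! hno
    apply hc _ ⟨v, ?_, rfl⟩
    have hout : ∀ k : ℕ, (h.perm ^ k) v ∈ G.outs K := fun k => by
      rw [← h.perm_mem_ins hK, ← Equiv.Perm.mul_apply, ← pow_succ']
      exact by_contra fun h' => hno _ ((hK.mem_ins_compl hG).2 h')
    refine Relation.TransGen.head' ((h.step_inter_iff hK).2 ⟨rfl, hout 0⟩)
      ((h.reflTransGen_inter_iff hK).2 ⟨orderOf h.perm - 1, ?_, fun k _ => ?_⟩)
    · rw [← Equiv.Perm.mul_apply, ← pow_succ, Nat.sub_add_cancel (orderOf_pos _),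
        pow_orderOf_eq_one, Equiv.Perm.one_apply]
    · rw [← Equiv.Perm.mul_apply, ← pow_succ]
      exact hout _

theorem OpenOn.congr [Finite V] {h : G.IsFull S} (ho : h.OpenOn K) (h' : G.IsFull S')
    (hK : G.IsClosed K) (hG : G.Is2dd) (hSS' : S ∩ K = S' ∩ K) : h'.OpenOn K := by
  rw [h'.openOn_iff hK hG, ← hSS', ← h.openOn_iff hK hG]
  exact ho

/-- The route from `u` consists of the iterates of `u` up to the first one that leaves `K`. -/
theorem route_iff (h : G.IsFull S) (hK : G.IsClosed K) (hG : G.Is2dd) {u w : V} :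
    G.route K (S ∩ K) u w ↔ (u ∈ G.ins Kᶜ ∧ u ∉ G.outs Kᶜ) ∧ (w ∉ G.ins Kᶜ ∧ w ∈ G.outs Kᶜ) ∧
      ∃ n, (h.perm ^ n) u = w ∧ ∀ k < n, (h.perm ^ k) u ∉ G.outs Kᶜ := by
  rw [route, hK.isEntry_iff hG, hK.isExit_iff hG, h.reflTransGen_inter_iff hK]
  simp only [hK.mem_outs_compl hG, not_not]

theorem perm_mem_ins_compl (h : G.IsFull S) (hK : G.IsClosed K) {v : V} :
    h.perm v ∈ G.ins Kᶜ ↔ v ∈ G.outs Kᶜ := h.perm_mem_ins hK.compl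

/-- From an entry vertex, an open factor runs to an exit vertex, as it cannot stay in `K`. -/
theorem OpenOn.exists_route [Finite V] {h : G.IsFull S} (ho : h.OpenOn K) (hK : G.IsClosed K)
    (hG : G.Is2dd) {u : V} (hu : u ∈ G.ins Kᶜ) (hu' : u ∉ G.outs Kᶜ) :
    ∃ w, G.route K (S ∩ K) u w := by
  classical
  have hex : ∃ n : ℕ, (h.perm ^ n) u ∈ G.outs Kᶜ := by
    obtain ⟨k, hk⟩ := ho (h.perm u)
    refine ⟨k, ?_⟩
    rwa [← h.perm_mem_ins_compl hK, ← Equiv.Perm.mul_apply, ← pow_succ', pow_succ,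
      Equiv.Perm.mul_apply]
  refine ⟨_, (h.route_iff hK hG).2 ⟨⟨hu, hu'⟩, ⟨fun hT => ?_, Nat.find_spec hex⟩, Nat.find hex, rfl,
    fun k hk => Nat.find_min hex hk⟩⟩
  rcases Nat.eq_zero_or_pos (Nat.find hex) with h0 | h0
  · have := Nat.find_spec hex
    rw [h0] at this
    exact hu' this
  · obtain ⟨m, hm⟩ := Nat.exists_eq_add_of_lt h0
    rw [zero_add] at hm
    rw [hm, pow_succ', Equiv.Perm.mul_apply, h.perm_mem_ins_compl hK] at hT
    exact Nat.find_min hex (by omega) hT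

theorem OpenOn.exists_route' [Finite V] {h : G.IsFull S} (ho : h.OpenOn K) (hK : G.IsClosed K)
    (hG : G.Is2dd) {w : V} (hw : w ∉ G.ins Kᶜ) (hw' : w ∈ G.outs Kᶜ) :
    ∃ u, G.route K (S ∩ K) u w := by
  classical
  have hex : ∃ n : ℕ, ((h.perm⁻¹) ^ n) w ∈ G.ins Kᶜ := by
    obtain ⟨k, hk⟩ := ho w
    have : (h.perm⁻¹).SameCycle w ((h.perm ^ k) w) := by
      rw [Equiv.Perm.sameCycle_inv]; exact ⟨k, by simp⟩
    obtain ⟨n, -, hn⟩ := this.exists_pow_eq'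
    exact ⟨n, by rwa [hn]⟩
  set n := Nat.find hex with hn
  have hnT : ((h.perm⁻¹) ^ n) w ∈ G.ins Kᶜ := Nat.find_spec hex
  have hpow : ∀ k ≤ n, (h.perm ^ k) (((h.perm⁻¹) ^ n) w) = ((h.perm⁻¹) ^ (n - k)) w := by
    intro k hk
    rw [← Equiv.Perm.mul_apply]
    congr 1
    rw [inv_pow, inv_pow, ← Nat.sub_add_cancel hk, Nat.add_sub_cancel, pow_add]
    group
  have hout : ∀ k < n, (h.perm ^ k) (((h.perm⁻¹) ^ n) w) ∉ G.outs Kᶜ := by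
    intro k hk hkO
    rw [← h.perm_mem_ins_compl hK, ← Equiv.Perm.mul_apply, ← pow_succ', hpow _ (by omega)] at hkO
    exact Nat.find_min hex (by omega) hkO
  have hn0 : 0 < n := Nat.pos_of_ne_zero fun h0 => hw (by rw [h0] at hnT; exact hnT)
  refine ⟨_, (h.route_iff hK hG).2 ⟨⟨hnT, hout 0 hn0⟩, ⟨hw, hw'⟩, n, ?_, hout⟩⟩
  rw [hpow n le_rfl, Nat.sub_self, pow_zero, Equiv.Perm.one_apply]

theorem route_right_unique (h : G.IsFull S) (hK : G.IsClosed K) (hG : G.Is2dd) {u w w' : V}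
    (hw : G.route K (S ∩ K) u w) (hw' : G.route K (S ∩ K) u w') : w = w' := by
  rw [h.route_iff hK hG] at hw hw'
  obtain ⟨-, hw, n, rfl, hn⟩ := hw
  obtain ⟨-, hw', m, rfl, hm⟩ := hw'
  rcases lt_trichotomy m n with hmn | rfl | hmn
  · exact absurd hw'.2 (hn m hmn)
  · rfl
  · exact absurd hw.2 (hm n hmn)

theorem route_left_unique (h : G.IsFull S) (hK : G.IsClosed K) (hG : G.Is2dd) {u u' w : V}
    (hu : G.route K (S ∩ K) u w) (hu' : G.route K (S ∩ K) u' w) : u = u' := by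
  rw [h.route_iff hK hG] at hu hu'
  obtain ⟨hu, -, n, rfl, hn⟩ := hu
  obtain ⟨hu', -, m, hmn, hm⟩ := hu'
  have key : ∀ (u u' : V) (n m : ℕ), n ≤ m → u ∈ G.ins Kᶜ → (h.perm ^ m) u' = (h.perm ^ n) u →
      (∀ k < m, (h.perm ^ k) u' ∉ G.outs Kᶜ) → u = u' := by
    intro u u' n m hle hu hmn hm
    obtain ⟨d, rfl⟩ := Nat.exists_eq_add_of_le hle
    rw [pow_add, Equiv.Perm.mul_apply, EmbeddingLike.apply_eq_iff_eq] at hmn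
    rcases Nat.eq_zero_or_pos d with rfl | hd
    · exact hmn.symm
    · obtain ⟨c, rfl⟩ := Nat.exists_eq_add_of_lt hd
      rw [zero_add, pow_succ', Equiv.Perm.mul_apply] at hmn
      rw [← hmn, h.perm_mem_ins_compl hK] at hu
      exact absurd hu (hm c (by omega))
  rcases le_total n m with hle | hle
  · exact key u u' n m hle hu.1 hmn hm
  · exact (key u' u m n hle hu'.1 hmn.symm hn).symm

section FirstReturn

variable {θ : Equiv.Perm (G.ins Kᶜ)}

theorem firstReturn_of_mem (h : G.IsFull S) (hK : G.IsClosed K)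
    (hθ : Equiv.Perm.IsFirstReturn Subtype.val h.perm θ)
    {v : G.ins Kᶜ} (hv : (v : V) ∈ G.outs Kᶜ) : (θ v : V) = h.perm v := by
  rw [hθ.eq Subtype.val_injective (w := ⟨h.perm v, (h.perm_mem_ins_compl hK).2 hv⟩) one_pos
    (by rw [pow_one]) (fun k hk hk' => by omega)]

/-- From an entry vertex, the factor returns to `ins Kᶜ` one step after the end of the route. -/
theorem firstReturn_of_route (h : G.IsFull S) (hK : G.IsClosed K) (hG : G.Is2dd)
    (hθ : Equiv.Perm.IsFirstReturn Subtype.val h.perm θ)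
    {v : G.ins Kᶜ} {w : V} (hv : G.route K (S ∩ K) v w) : (θ v : V) = h.perm w := by
  obtain ⟨-, hw, n, rfl, hn⟩ := (h.route_iff hK hG).1 hv
  rw [hθ.eq Subtype.val_injective (w := ⟨_, (h.perm_mem_ins_compl hK).2 hw.2⟩) n.succ_pos
    (by rw [pow_succ', Equiv.Perm.mul_apply]) (fun k hk hk' => ?_)]
  obtain ⟨m, rfl⟩ := Nat.exists_eq_add_of_lt hk
  rw [Subtype.range_val, zero_add, pow_succ', Equiv.Perm.mul_apply, h.perm_mem_ins_compl hK]
  exact hn m (by omega)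

theorem OpenOn.orb_eq [Finite V] {h : G.IsFull S} (ho : h.OpenOn K)
    (hθ : Equiv.Perm.IsFirstReturn Subtype.val h.perm θ) : h.perm.orb = θ.orb :=
  hθ.orb_eq Subtype.val_injective (fun v => by rw [Subtype.range_val]; exact ho v)

/-- The number of cycles of a factor `S` that is open on `K` depends only on the part of `S` outside
`K` and the route of the part inside `K`: any permutation `σ` that imitates both, in the
sense that it takes the vertices with in-arcs outside `K` to their successors, respectively to the
successors of the other ends of their routes, has as many orbits as `S` has cycles. -/
theorem OpenOn.orb_eq_of_route [Finite V] {V' : Type*} [Finite V'] {h : G.IsFull S}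
    (ho : h.OpenOn K) (hK : G.IsClosed K) (hG : G.Is2dd) {j : G.ins Kᶜ → V'}
    (hj : Function.Injective j) {σ : Equiv.Perm V'} (hσ : ∀ v, ∃ k : ℕ, (σ ^ k) v ∈ range j)
    (h1 : ∀ v u : G.ins Kᶜ, (v : V) ∈ G.outs Kᶜ → h.perm v = u → σ (j v) = j u)
    (h2 : ∀ (v u : G.ins Kᶜ) (w : V), G.route K (S ∩ K) v w → h.perm w = u →
      ∃ n, 0 < n ∧ (σ ^ n) (j v) = j u ∧ ∀ k, 0 < k → k < n → (σ ^ k) (j v) ∉ range j) :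
    h.perm.orb = σ.orb := by
  obtain ⟨θ, hθ⟩ := Equiv.Perm.exists_isFirstReturn (j := (Subtype.val : G.ins Kᶜ → V))
    Subtype.val_injective h.perm
  rw [ho.orb_eq hθ]
  symm
  refine Equiv.Perm.IsFirstReturn.orb_eq hj (fun v => ?_) hσ
  by_cases hv : (v : V) ∈ G.outs Kᶜ
  · exact ⟨1, one_pos, by rw [pow_one]; exact h1 v _ hv (h.firstReturn_of_mem hK hθ hv).symm,
      fun k hk hk' => by omega⟩
  · obtain ⟨w, hw⟩ := ho.exists_route hK hG v.2 hv
    exact h2 v _ w hw (h.firstReturn_of_route hK hG hθ hw).symm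

end FirstReturn

theorem openOn_of_orb_eq_one [Finite V] (h : G.IsFull S) (h1 : h.perm.orb = 1)
    (hne : (G.ins Kᶜ).Nonempty) : h.OpenOn K := by
  intro v
  obtain ⟨t, ht⟩ := hne
  obtain ⟨n, -, hn⟩ := ((Equiv.Perm.orb_eq_one_iff.1 h1).2 v t).exists_pow_eq'
  exact ⟨n, hn ▸ ht⟩

end IsFull

section Routes

variable [Finite V] {S₀ S₁ S : Set A}

theorem inter_union_inter_compl (S S' : Set A) : (S ∩ K ∪ S' ∩ Kᶜ) ∩ K = S ∩ K :=
  union_inter_compl_inter inter_subset_right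

theorem inter_union_inter_compl' (S S' : Set A) : (S ∩ K ∪ S' ∩ Kᶜ) ∩ Kᶜ = S' ∩ Kᶜ := by
  ext a
  simp only [mem_inter_iff, mem_union, mem_compl_iff]
  tauto

/-- The first return permutation to `ins Kᶜ` of the factor that agrees with `S₀` inside `K` and with
`S` outside `K`. -/
theorem exists_firstReturn_union (hG : G.Is2dd) (hK : G.IsClosed K) {h₀ : G.IsFull S₀}
    (ho₀ : h₀.OpenOn K) (h : G.IsFull S) :
    ∃ θ : Equiv.Perm (G.ins Kᶜ), (h₀.union h hK hG).perm.orb = θ.orb ∧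
      (∀ v : G.ins Kᶜ, (v : V) ∈ G.outs Kᶜ → (θ v : V) = h.perm v) ∧
      ∀ (v : G.ins Kᶜ) (w : V), G.route K (S₀ ∩ K) v w → (θ v : V) = h.perm w := by
  obtain ⟨θ, hθ⟩ := Equiv.Perm.exists_isFirstReturn (j := (Subtype.val : G.ins Kᶜ → V))
    Subtype.val_injective (h₀.union h hK hG).perm
  have hperm : ∀ v, v ∈ G.outs Kᶜ → (h₀.union h hK hG).perm v = h.perm v := fun v hv =>
    IsFull.perm_congr _ h hK.compl (inter_union_inter_compl' _ _) hv
  refine ⟨θ, ?_, fun v hv => ?_, fun v w hw => ?_⟩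
  · exact (ho₀.congr (h₀.union h hK hG) hK hG (inter_union_inter_compl _ _).symm).orb_eq hθ
  · rw [IsFull.firstReturn_of_mem _ hK hθ hv, hperm _ hv]
  · rw [IsFull.firstReturn_of_route _ hK hG hθ (w := w) (by rwa [inter_union_inter_compl]),
      hperm _ ((h₀.route_iff hK hG).1 hw).2.1.2]

/-- In an odd 2-dd, two different open routes of `K` differ by an even permutation, hence at three
entry vertices at least. -/
theorem three_le_of_route_ne [Finite A] (hG : G.Is2dd) (hodd : G.IsOdd) (hK : G.IsClosed K)
    {h₀ : G.IsFull S₀} {h₁ : G.IsFull S₁} (ho₀ : h₀.OpenOn K) (ho₁ : h₁.OpenOn K)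
    (hne : G.route K (S₀ ∩ K) ≠ G.route K (S₁ ∩ K)) :
    3 ≤ {u | G.IsEntry K u ∧ ∀ w, ¬ (G.route K (S₀ ∩ K) u w ∧ G.route K (S₁ ∩ K) u w)}.ncard := by
  obtain ⟨S, h⟩ := hG.exists_isFull
  obtain ⟨θ₀, hθ₀, ha₀, hb₀⟩ := exists_firstReturn_union hG hK ho₀ h
  obtain ⟨θ₁, hθ₁, ha₁, hb₁⟩ := exists_firstReturn_union hG hK ho₁ h
  rw [isOdd_iff hG] at hodd
  have hne' : θ₀ ≠ θ₁ := by
    rintro rfl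
    apply hne
    have key : ∀ {u w w₁}, G.route K (S₀ ∩ K) u w → G.route K (S₁ ∩ K) u w₁ → w = w₁ := by
      intro u w w₁ hw hw₁
      have hu := ((h₀.route_iff hK hG).1 hw).1.1
      have := (hb₀ ⟨u, hu⟩ w hw).symm.trans (hb₁ ⟨u, hu⟩ w₁ hw₁)
      exact h.perm.injective this
    ext u w
    constructor
    · intro hw
      obtain ⟨⟨hu, hu'⟩, -⟩ := (h₀.route_iff hK hG).1 hw
      obtain ⟨w₁, hw₁⟩ := ho₁.exists_route hK hG hu hu'
      rwa [key hw hw₁]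
    · intro hw
      obtain ⟨⟨hu, hu'⟩, -⟩ := (h₁.route_iff hK hG).1 hw
      obtain ⟨w₁, hw₁⟩ := ho₀.exists_route hK hG hu hu'
      rwa [← key hw₁ hw]
  have h3 := Equiv.Perm.three_le_ncard_ne_of_odd_orb (hθ₀ ▸ hodd _ _) (hθ₁ ▸ hodd _ _) hne'
  refine h3.trans ?_
  rw [← ncard_image_of_injective _ Subtype.val_injective]
  refine ncard_le_ncard ?_ (toFinite _)
  rintro _ ⟨v, hv, rfl⟩
  have hv' : (v : V) ∉ G.outs Kᶜ := fun hvO => hv (Subtype.ext (by rw [ha₀ v hvO, ha₁ v hvO]))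
  refine ⟨(hK.isEntry_iff hG).2 ⟨v.2, hv'⟩, fun w hw => hv (Subtype.ext ?_)⟩
  rw [hb₀ v w hw.1, hb₁ v w hw.2]

/-- If `K` has three entry vertices, then the part outside `K` of a Hamiltonian circuit is completed
to a Hamiltonian circuit by a factor of `K` with one of any two different open routes. -/
theorem orb_union_eq_one (hG : G.Is2dd) (hodd : G.IsOdd) (hK : G.IsClosed K)
    {h₀ : G.IsFull S₀} {h₁ : G.IsFull S₁} (ho₀ : h₀.OpenOn K) (ho₁ : h₁.OpenOn K)
    (hne : ∃ u w, G.route K (S₀ ∩ K) u w ∧ ¬ G.route K (S₁ ∩ K) u w)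
    (h3 : {u | G.IsEntry K u}.ncard = 3) (h : G.IsFull S) (h1 : h.perm.orb = 1) :
    (h₀.union h hK hG).perm.orb = 1 ∨ (h₁.union h hK hG).perm.orb = 1 := by
  obtain ⟨u, w, hw, hnw⟩ := hne
  have hu := ((h₀.route_iff hK hG).1 hw).1
  obtain ⟨w₁, hw₁⟩ := ho₁.exists_route hK hG hu.1 hu.2
  obtain ⟨θ₀, hθ₀, ha₀, hb₀⟩ := exists_firstReturn_union hG hK ho₀ h
  obtain ⟨θ₁, hθ₁, ha₁, hb₁⟩ := exists_firstReturn_union hG hK ho₁ h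
  have ho : h.OpenOn K := h.openOn_of_orb_eq_one h1 ⟨u, hu.1⟩
  obtain ⟨θ, hθ⟩ := Equiv.Perm.exists_isFirstReturn (j := (Subtype.val : G.ins Kᶜ → V))
    Subtype.val_injective h.perm
  have ha := fun v hv => h.firstReturn_of_mem hK hθ (v := v) hv
  rw [isOdd_iff hG] at hodd
  rw [hθ₀, hθ₁]
  refine Equiv.Perm.orb_eq_one_or_of_agree_off (θ := θ) (E := {v | (v : V) ∉ G.outs Kᶜ}) ?_
    (fun v hv => ?_) (fun v hv => ?_) (hθ₀ ▸ hodd _ _) (hθ₁ ▸ hodd _ _) (fun h01 => ?_)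
    (by rw [← ho.orb_eq hθ, h1])
  · rw [← h3, ← ncard_image_of_injective _ Subtype.val_injective]
    congr 1
    ext v
    rw [mem_ofPred_eq, hK.isEntry_iff hG]
    constructor
    · rintro ⟨v, hv, rfl⟩; exact ⟨v.2, hv⟩
    · exact fun hv => ⟨⟨v, hv.1⟩, hv.2, rfl⟩
  · have hv' : (v : V) ∈ G.outs Kᶜ := not_not.1 hv
    exact Subtype.ext (by rw [ha₀ v hv', ha v hv'])
  · have hv' : (v : V) ∈ G.outs Kᶜ := not_not.1 hv
    exact Subtype.ext (by rw [ha₁ v hv', ha v hv'])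
  · subst h01
    have := (hb₀ ⟨u, hu.1⟩ w hw).symm.trans (hb₁ ⟨u, hu.1⟩ w₁ hw₁)
    exact hnw (h.perm.injective this ▸ hw₁)

end Routes

end Closed

end Multidigraph

/-! ### Gluing exit vertices to entry vertices -/

namespace Multidigraph

variable {V A V₁ A₁ V₂ A₂ : Type*}

section Map

variable {G₁ : Multidigraph V₁ A₁} {G₂ : Multidigraph V₂ A₂} {f : A₁ → A₂}

theorem IsAC.map (hf : Function.Injective f)
    (ht : ∀ a b, G₁.tgt a = G₁.tgt b → G₂.tgt (f a) = G₂.tgt (f b))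
    (hs : ∀ a b, G₁.src a = G₁.src b → G₂.src (f a) = G₂.src (f b)) {X : Set A₁}
    (hX : G₁.IsAC X) : G₂.IsAC (f '' X) := by
  obtain ⟨r, e, hr, hinj, rfl, he⟩ := hX
  exact ⟨r, f ∘ e, hr, hf.comp_injOn hinj, image_comp f e _,
    fun i hi => ⟨fun h => ht _ _ ((he i hi).1 h), fun h => hs _ _ ((he i hi).2 h)⟩⟩

/-- Only incidences matter for alternating cycles: they may be pulled back along a map of arcs that
reflects incidences. -/
theorem IsAC.of_map (ht : ∀ a b, G₂.tgt (f a) = G₂.tgt (f b) → G₁.tgt a = G₁.tgt b)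
    (hs : ∀ a b, G₂.src (f a) = G₂.src (f b) → G₁.src a = G₁.src b) {X : Set A₂}
    (hX : G₂.IsAC X) (hXf : X ⊆ range f) : ∃ Y, G₁.IsAC Y ∧ f '' Y = X := by
  obtain ⟨a₀, ha₀⟩ := hX.nonempty
  obtain ⟨b₀, -⟩ := hXf ha₀
  have : Nonempty A₁ := ⟨b₀⟩
  obtain ⟨r, e, hr, hinj, rfl, he⟩ := hX
  have hfe : ∀ i, i < 2 * r → f (Function.invFun f (e i)) = e i := fun i hi =>
    Function.invFun_eq (hXf ⟨i, hi, rfl⟩)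
  have hmod : ∀ i, (i + 1) % (2 * r) < 2 * r := fun i => Nat.mod_lt _ (by omega)
  refine ⟨Function.invFun f ∘ e '' Iio (2 * r), ⟨r, Function.invFun f ∘ e, hr, ?_, rfl, ?_⟩, ?_⟩
  · intro i hi j hj hij
    exact hinj hi hj (by rw [← hfe i hi, ← hfe j hj]; exact congrArg f hij)
  · intro i hi
    refine ⟨fun h => ht _ _ ?_, fun h => hs _ _ ?_⟩
    · have := (he i hi).1 h
      rwa [← hfe i hi, ← hfe _ (hmod i)] at this
    · have := (he i hi).2 h
      rwa [← hfe i hi, ← hfe _ (hmod i)] at this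
  · rw [← image_comp]
    exact image_congr fun i hi => hfe i hi

end Map

section TwoDigraph

variable {H : Multidigraph V A}

theorem IsEntry.tgt_ne [Finite A] {v : V} (hv : H.IsEntry univ v) (a : A) : H.tgt a ≠ v := by
  intro h
  have := (ncard_eq_zero (toFinite _)).1 hv.1
  exact (eq_empty_iff_forall_notMem.1 this) a ⟨trivial, h⟩

theorem IsExit.src_ne [Finite A] {v : V} (hv : H.IsExit univ v) (a : A) : H.src a ≠ v := by
  intro h
  have := (ncard_eq_zero (toFinite _)).1 hv.2
  exact (eq_empty_iff_forall_notMem.1 this) a ⟨trivial, h⟩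

theorem IsExit.not_isEntry {K : Set A} {v : V} (hv : H.IsExit K v) : ¬ H.IsEntry K v := fun h => by
  have := h.1.symm.trans hv.1
  omega

theorem Is2Digraph.inDeg_eq_two (hH : H.Is2Digraph) {v : V} (hv : ¬ H.IsEntry univ v) :
    H.inDeg univ v = 2 := by
  rcases hH v with h | h | h
  · exact absurd h hv
  · exact h.1
  · exact h.1

theorem Is2Digraph.outDeg_eq_two (hH : H.Is2Digraph) {v : V} (hv : ¬ H.IsExit univ v) :
    H.outDeg univ v = 2 := by
  rcases hH v with h | h | h
  · exact h.2
  · exact absurd h hv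
  · exact h.2

/-- `ρ` is the graph of a bijection from the exit vertices of `H` to its entry vertices. -/
structure IsGluing (H : Multidigraph V A) (ρ : V → V → Prop) : Prop where
  isExit : ∀ ⦃u v⦄, ρ u v → H.IsExit univ u
  isEntry : ∀ ⦃u v⦄, ρ u v → H.IsEntry univ v
  exists_right : ∀ ⦃u⦄, H.IsExit univ u → ∃ v, ρ u v
  exists_left : ∀ ⦃v⦄, H.IsEntry univ v → ∃ u, ρ u v
  right_unique : ∀ ⦃u v v'⦄, ρ u v → ρ u v' → v = v'
  left_unique : ∀ ⦃u u' v⦄, ρ u v → ρ u' v → u = u'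

namespace IsGluing

variable {ρ : V → V → Prop}

open Classical in
/-- The vertex with in-arcs in each class of identified vertices. -/
noncomputable def inRep (h : H.IsGluing ρ) : Quot ρ → V :=
  Quot.lift (fun v => if hv : H.IsEntry univ v then (h.exists_left hv).choose else v) (by
    intro u v huv
    rw [dif_neg (h.isExit huv).not_isEntry, dif_pos (h.isEntry huv)]
    exact h.left_unique huv (h.exists_left (h.isEntry huv)).choose_spec)

open Classical in
/-- The vertex with out-arcs in each class of identified vertices. -/
noncomputable def outRep (h : H.IsGluing ρ) : Quot ρ → V :=
  Quot.lift (fun v => if hv : H.IsExit univ v then (h.exists_right hv).choose else v) (by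
    intro u v huv
    rw [dif_pos (h.isExit huv), dif_neg fun hv => hv.not_isEntry (h.isEntry huv)]
    exact h.right_unique (h.exists_right (h.isExit huv)).choose_spec huv)

theorem inRep_mk (h : H.IsGluing ρ) {v : V} (hv : ¬ H.IsEntry univ v) :
    h.inRep (Quot.mk ρ v) = v := dif_neg hv

theorem outRep_mk (h : H.IsGluing ρ) {v : V} (hv : ¬ H.IsExit univ v) :
    h.outRep (Quot.mk ρ v) = v := dif_neg hv

theorem eq_of_mk_eq (h : H.IsGluing ρ) {u v : V} (hu : ¬ H.IsEntry univ u)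
    (hv : ¬ H.IsEntry univ v) (huv : Quot.mk ρ u = Quot.mk ρ v) : u = v := by
  rw [← h.inRep_mk hu, huv, h.inRep_mk hv]

theorem eq_of_mk_eq' (h : H.IsGluing ρ) {u v : V} (hu : ¬ H.IsExit univ u)
    (hv : ¬ H.IsExit univ v) (huv : Quot.mk ρ u = Quot.mk ρ v) : u = v := by
  rw [← h.outRep_mk hu, huv, h.outRep_mk hv]

theorem exists_mk_eq (h : H.IsGluing ρ) (q : Quot ρ) :
    ∃ v, ¬ H.IsEntry univ v ∧ Quot.mk ρ v = q := by
  induction q using Quot.inductionOn with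
  | _ v =>
    by_cases hv : H.IsEntry univ v
    · obtain ⟨u, hu⟩ := h.exists_left hv
      exact ⟨u, (h.isExit hu).not_isEntry, Quot.sound hu⟩
    · exact ⟨v, hv, rfl⟩

theorem exists_mk_eq' (h : H.IsGluing ρ) (q : Quot ρ) :
    ∃ v, ¬ H.IsExit univ v ∧ Quot.mk ρ v = q := by
  induction q using Quot.inductionOn with
  | _ v =>
    by_cases hv : H.IsExit univ v
    · obtain ⟨u, hu⟩ := h.exists_right hv
      exact ⟨u, fun hu' => hu'.not_isEntry (h.isEntry hu), (Quot.sound hu).symm⟩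
    · exact ⟨v, hv, rfl⟩

variable [Finite A]

theorem tgt_eq_iff (h : H.IsGluing ρ) {a b : A} :
    (H.identify ρ).tgt a = (H.identify ρ).tgt b ↔ H.tgt a = H.tgt b :=
  ⟨h.eq_of_mk_eq (fun hv => hv.tgt_ne a rfl) (fun hv => hv.tgt_ne b rfl),
    fun hab => congrArg (Quot.mk ρ) hab⟩

theorem src_eq_iff (h : H.IsGluing ρ) {a b : A} :
    (H.identify ρ).src a = (H.identify ρ).src b ↔ H.src a = H.src b :=
  ⟨h.eq_of_mk_eq' (fun hv => hv.src_ne a rfl) (fun hv => hv.src_ne b rfl),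
    fun hab => congrArg (Quot.mk ρ) hab⟩

theorem is2dd_identify (h : H.IsGluing ρ) (hH : H.Is2Digraph) : (H.identify ρ).Is2dd := by
  intro q
  constructor
  · obtain ⟨v, hv, rfl⟩ := h.exists_mk_eq q
    rw [← hH.inDeg_eq_two hv, inDeg, inDeg]
    congr 1
    ext a
    exact and_congr_right fun _ => ⟨h.eq_of_mk_eq (fun hv => hv.tgt_ne a rfl) hv,
      fun hav => congrArg (Quot.mk ρ) hav⟩
  · obtain ⟨v, hv, rfl⟩ := h.exists_mk_eq' q
    rw [← hH.outDeg_eq_two hv, outDeg, outDeg]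
    congr 1
    ext a
    exact and_congr_right fun _ => ⟨h.eq_of_mk_eq' (fun hv => hv.src_ne a rfl) hv,
      fun hav => congrArg (Quot.mk ρ) hav⟩

theorem aCsHaveCard_identify (h : H.IsGluing ρ) {m : ℕ} (hm : H.ACsHaveCard m) :
    (H.identify ρ).ACsHaveCard m := by
  intro X hX
  obtain ⟨Y, hY, hYX⟩ := IsAC.of_map (G₁ := H) (f := id) (fun a b hab => h.tgt_eq_iff.1 hab)
    (fun a b hab => h.src_eq_iff.1 hab) hX (by simp)
  rw [image_id] at hYX
  exact hYX ▸ hm Y hY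

end IsGluing

end TwoDigraph

section Sub

variable {G : Multidigraph V A} {L : Set A}

theorem inDeg_sub (v : G.verts L) : (G.sub L).inDeg univ v = G.inDeg L v := by
  rw [inDeg, inDeg, ← ncard_image_of_injective _ Subtype.val_injective]
  congr 1
  ext a
  constructor
  · rintro ⟨b, ⟨-, rfl⟩, rfl⟩; exact ⟨b.2, rfl⟩
  · rintro ⟨ha, hav⟩; exact ⟨⟨a, ha⟩, ⟨trivial, Subtype.ext hav⟩, rfl⟩

theorem outDeg_sub (v : G.verts L) : (G.sub L).outDeg univ v = G.outDeg L v := by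
  rw [outDeg, outDeg, ← ncard_image_of_injective _ Subtype.val_injective]
  congr 1
  ext a
  constructor
  · rintro ⟨b, ⟨-, rfl⟩, rfl⟩; exact ⟨b.2, rfl⟩
  · rintro ⟨ha, hav⟩; exact ⟨⟨a, ha⟩, ⟨trivial, Subtype.ext hav⟩, rfl⟩

theorem isEntry_sub {v : G.verts L} : (G.sub L).IsEntry univ v ↔ G.IsEntry L v := by
  rw [IsEntry, IsEntry, inDeg_sub, outDeg_sub]

theorem isExit_sub {v : G.verts L} : (G.sub L).IsExit univ v ↔ G.IsExit L v := by
  rw [IsExit, IsExit, inDeg_sub, outDeg_sub]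

theorem mem_verts {v : V} : v ∈ G.verts L ↔ v ∈ G.ins L ∨ v ∈ G.outs L := by
  constructor
  · rintro ⟨a, ha, h | h⟩
    exacts [Or.inr ⟨a, ha, h⟩, Or.inl ⟨a, ha, h⟩]
  · rintro (⟨a, ha, h⟩ | ⟨a, ha, h⟩)
    exacts [⟨a, ha, Or.inr h⟩, ⟨a, ha, Or.inl h⟩]

theorem IsClosed.isEntry_compl_iff {K : Set A} (hK : G.IsClosed K) (hG : G.Is2dd) {v : V} :
    G.IsEntry Kᶜ v ↔ v ∉ G.ins Kᶜ ∧ v ∈ G.outs Kᶜ := by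
  rw [hK.compl.isEntry_iff hG, compl_compl, hK.mem_ins_compl hG, hK.mem_outs_compl hG, not_not]

theorem IsClosed.isExit_compl_iff {K : Set A} (hK : G.IsClosed K) (hG : G.Is2dd) {v : V} :
    G.IsExit Kᶜ v ↔ v ∈ G.ins Kᶜ ∧ v ∉ G.outs Kᶜ := by
  rw [hK.compl.isExit_iff hG, compl_compl, hK.mem_ins_compl hG, hK.mem_outs_compl hG, not_not]

theorem IsClosed.is2Digraph_sub {K : Set A} (hK : G.IsClosed K) (hG : G.Is2dd) :
    (G.sub K).Is2Digraph := by
  intro v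
  rw [isEntry_sub, isExit_sub, IsSat, inDeg_sub, outDeg_sub]
  change _ ∨ _ ∨ G.IsSat K v
  rw [hK.isEntry_iff hG, hK.isExit_iff hG, hK.isSat_iff hG, hK.mem_ins_compl hG,
    hK.mem_outs_compl hG]
  have := mem_verts.1 v.2
  tauto

theorem aCsHaveCard_sub {m : ℕ} (hm : G.ACsHaveCard m) : (G.sub L).ACsHaveCard m := by
  intro X hX
  rw [← ncard_image_of_injective X Subtype.val_injective]
  exact hm _ (hX.map Subtype.val_injective (fun a b hab => congrArg Subtype.val hab)
    (fun a b hab => congrArg Subtype.val hab))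

end Sub

section Splice

variable {G₁ : Multidigraph V₁ A₁} {G₂ : Multidigraph V₂ A₂}

theorem inDeg_disjUnion_inl (v : V₁) :
    (disjUnion G₁ G₂).inDeg univ (Sum.inl v) = G₁.inDeg univ v := by
  rw [inDeg, inDeg, ← ncard_image_of_injective _ (Sum.inl_injective (α := A₁) (β := A₂))]
  congr 1
  ext (a | a) <;> simp [disjUnion]

theorem inDeg_disjUnion_inr (v : V₂) :
    (disjUnion G₁ G₂).inDeg univ (Sum.inr v) = G₂.inDeg univ v := by
  rw [inDeg, inDeg, ← ncard_image_of_injective _ (Sum.inr_injective (α := A₁) (β := A₂))]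
  congr 1
  ext (a | a) <;> simp [disjUnion]

theorem outDeg_disjUnion_inl (v : V₁) :
    (disjUnion G₁ G₂).outDeg univ (Sum.inl v) = G₁.outDeg univ v := by
  rw [outDeg, outDeg, ← ncard_image_of_injective _ (Sum.inl_injective (α := A₁) (β := A₂))]
  congr 1
  ext (a | a) <;> simp [disjUnion]

theorem outDeg_disjUnion_inr (v : V₂) :
    (disjUnion G₁ G₂).outDeg univ (Sum.inr v) = G₂.outDeg univ v := by
  rw [outDeg, outDeg, ← ncard_image_of_injective _ (Sum.inr_injective (α := A₁) (β := A₂))]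
  congr 1
  ext (a | a) <;> simp [disjUnion]

theorem isEntry_disjUnion_inl {v : V₁} :
    (disjUnion G₁ G₂).IsEntry univ (Sum.inl v) ↔ G₁.IsEntry univ v := by
  rw [IsEntry, IsEntry, inDeg_disjUnion_inl, outDeg_disjUnion_inl]

theorem isEntry_disjUnion_inr {v : V₂} :
    (disjUnion G₁ G₂).IsEntry univ (Sum.inr v) ↔ G₂.IsEntry univ v := by
  rw [IsEntry, IsEntry, inDeg_disjUnion_inr, outDeg_disjUnion_inr]

theorem isExit_disjUnion_inl {v : V₁} :
    (disjUnion G₁ G₂).IsExit univ (Sum.inl v) ↔ G₁.IsExit univ v := by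
  rw [IsExit, IsExit, inDeg_disjUnion_inl, outDeg_disjUnion_inl]

theorem isExit_disjUnion_inr {v : V₂} :
    (disjUnion G₁ G₂).IsExit univ (Sum.inr v) ↔ G₂.IsExit univ v := by
  rw [IsExit, IsExit, inDeg_disjUnion_inr, outDeg_disjUnion_inr]

theorem Is2Digraph.disjUnion (h₁ : G₁.Is2Digraph) (h₂ : G₂.Is2Digraph) :
    (disjUnion G₁ G₂).Is2Digraph := by
  rintro (v | v)
  · rw [isEntry_disjUnion_inl, isExit_disjUnion_inl, IsSat, inDeg_disjUnion_inl,
      outDeg_disjUnion_inl]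
    exact h₁ v
  · rw [isEntry_disjUnion_inr, isExit_disjUnion_inr, IsSat, inDeg_disjUnion_inr,
      outDeg_disjUnion_inr]
    exact h₂ v

theorem aCsHaveCard_disjUnion {m : ℕ} (h₁ : G₁.ACsHaveCard m) (h₂ : G₂.ACsHaveCard m) :
    (disjUnion G₁ G₂).ACsHaveCard m := by
  intro X hX
  have hl : (Multidigraph.disjUnion G₁ G₂).IsClosed (range Sum.inl) := by
    constructor
    · rintro _ (b | b) ⟨a, rfl⟩ hab
      · exact ⟨b, rfl⟩
      · exact absurd hab Sum.inl_ne_inr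
    · rintro _ (b | b) ⟨a, rfl⟩ hab
      · exact ⟨b, rfl⟩
      · exact absurd hab Sum.inl_ne_inr
  by_cases hne : (X ∩ range Sum.inl).Nonempty
  · obtain ⟨Y, hY, rfl⟩ := IsAC.of_map (G₁ := G₁) (fun a b hab => Sum.inl_injective hab)
      (fun a b hab => Sum.inl_injective hab) hX (IsAC.subset_of_isClosed hX hl hne)
    rw [ncard_image_of_injective _ Sum.inl_injective]
    exact h₁ Y hY
  · have hsub : X ⊆ range Sum.inr := by
      rintro (a | a) ha
      · exact absurd ⟨_, ha, a, rfl⟩ hne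
      · exact ⟨a, rfl⟩
    obtain ⟨Y, hY, rfl⟩ := IsAC.of_map (G₁ := G₂) (fun a b hab => Sum.inr_injective hab)
      (fun a b hab => Sum.inr_injective hab) hX hsub
    rw [ncard_image_of_injective _ Sum.inr_injective]
    exact h₂ Y hY

theorem isGluing_spliceRel (x : {v // G₁.IsExit univ v} ≃ {v // G₂.IsEntry univ v})
    (y : {v // G₂.IsExit univ v} ≃ {v // G₁.IsEntry univ v}) :
    (disjUnion G₁ G₂).IsGluing (spliceRel G₁ G₂ x y) where
  isExit := by
    rintro _ _ (⟨u, rfl, rfl⟩ | ⟨u, rfl, rfl⟩)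
    · exact isExit_disjUnion_inl.2 u.2
    · exact isExit_disjUnion_inr.2 u.2
  isEntry := by
    rintro _ _ (⟨u, rfl, rfl⟩ | ⟨u, rfl, rfl⟩)
    · exact isEntry_disjUnion_inr.2 (x u).2
    · exact isEntry_disjUnion_inl.2 (y u).2
  exists_right := by
    rintro (u | u) hu
    · exact ⟨_, Or.inl ⟨⟨u, isExit_disjUnion_inl.1 hu⟩, rfl, rfl⟩⟩
    · exact ⟨_, Or.inr ⟨⟨u, isExit_disjUnion_inr.1 hu⟩, rfl, rfl⟩⟩
  exists_left := by
    rintro (v | v) hv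
    · exact ⟨_, Or.inr ⟨y.symm ⟨v, isEntry_disjUnion_inl.1 hv⟩, rfl, by simp⟩⟩
    · exact ⟨_, Or.inl ⟨x.symm ⟨v, isEntry_disjUnion_inr.1 hv⟩, rfl, by simp⟩⟩
  right_unique := by
    rintro _ _ _ (⟨u, rfl, rfl⟩ | ⟨u, rfl, rfl⟩) (⟨u', hu, rfl⟩ | ⟨u', hu, rfl⟩)
    · rw [Subtype.ext (Sum.inl_injective hu)]
    · exact absurd hu Sum.inl_ne_inr
    · exact absurd hu Sum.inr_ne_inl
    · rw [Subtype.ext (Sum.inr_injective hu)]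
  left_unique := by
    rintro _ _ _ (⟨u, rfl, rfl⟩ | ⟨u, rfl, rfl⟩) (⟨u', rfl, hu⟩ | ⟨u', rfl, hu⟩)
    · rw [x.injective (Subtype.ext (Sum.inr_injective hu))]
    · exact absurd hu Sum.inr_ne_inl
    · exact absurd hu Sum.inl_ne_inr
    · rw [y.injective (Subtype.ext (Sum.inl_injective hu))]

end Splice

end Multidigraph

/-! ### Collapsing along a route -/

namespace Multidigraph

variable {V A V' A' : Type*}

section Embedding

variable {G : Multidigraph V A} {K : Set A}

/-- The part outside `K` of a factor may be replaced by a factor of the complement. -/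
theorem IsClosed.isFull_union (hK : G.IsClosed K) {S F : Set A} (h : G.IsFull S)
    (hF : F ⊆ Kᶜ) (hin : ∀ v ∈ G.ins Kᶜ, ∃! a, a ∈ F ∧ G.tgt a = v)
    (hout : ∀ v ∈ G.outs Kᶜ, ∃! a, a ∈ F ∧ G.src a = v) : G.IsFull (S ∩ K ∪ F) := by
  intro v
  constructor
  · by_cases hv : v ∈ G.ins Kᶜ
    · obtain ⟨a, ⟨ha, rfl⟩, hu⟩ := hin v hv
      refine ⟨a, ⟨Or.inr ha, rfl⟩, ?_⟩
      rintro b ⟨hb | hb, hbv⟩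
      · rw [← hbv, hK.compl.tgt_mem_ins] at hv
        exact absurd hb.2 hv
      · exact hu b ⟨hb, hbv⟩
    · obtain ⟨a, ⟨ha, rfl⟩, hu⟩ := (h v).1
      have haK : a ∈ K := not_not.1 fun haK => hv (hK.compl.tgt_mem_ins.2 haK)
      refine ⟨a, ⟨Or.inl ⟨ha, haK⟩, rfl⟩, ?_⟩
      rintro b ⟨hb | hb, hbv⟩
      · exact hu b ⟨hb.1, hbv⟩
      · exact absurd ⟨b, hF hb, hbv⟩ hv
  · by_cases hv : v ∈ G.outs Kᶜ
    · obtain ⟨a, ⟨ha, rfl⟩, hu⟩ := hout v hv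
      refine ⟨a, ⟨Or.inr ha, rfl⟩, ?_⟩
      rintro b ⟨hb | hb, hbv⟩
      · rw [← hbv, hK.compl.src_mem_outs] at hv
        exact absurd hb.2 hv
      · exact hu b ⟨hb, hbv⟩
    · obtain ⟨a, ⟨ha, rfl⟩, hu⟩ := (h v).2
      have haK : a ∈ K := not_not.1 fun haK => hv (hK.compl.src_mem_outs.2 haK)
      refine ⟨a, ⟨Or.inl ⟨ha, haK⟩, rfl⟩, ?_⟩
      rintro b ⟨hb | hb, hbv⟩
      · exact hu b ⟨hb.1, hbv⟩
      · exact absurd ⟨b, hF hb, hbv⟩ hv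

/-- Let `f` embed the arcs outside `K` into another digraph `G'` as a closed set of arcs, in such a
way that incidences are preserved and reflected. Then the part outside `K` of a factor of `G` may be
replaced by the pull-back of a factor of `G'`. -/
theorem IsClosed.isFull_union_preimage (hK : G.IsClosed K)
    {G' : Multidigraph V' A'} {f : (Kᶜ : Set A) → A'} (hf : Function.Injective f)
    (ht : ∀ a b, G'.tgt (f a) = G'.tgt (f b) ↔ G.tgt a = G.tgt b)
    (hs : ∀ a b, G'.src (f a) = G'.src (f b) ↔ G.src a = G.src b)
    (hc : G'.IsClosed (range f)) {S : Set A} (h : G.IsFull S) {S' : Set A'} (h' : G'.IsFull S') :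
    G.IsFull (S ∩ K ∪ Subtype.val '' (f ⁻¹' S')) := by
  refine hK.isFull_union h ?_ ?_ ?_
  · rintro _ ⟨a, -, rfl⟩; exact a.2
  · rintro _ ⟨a, ha, rfl⟩
    obtain ⟨b, ⟨hb, hba⟩, hu⟩ := (h' (G'.tgt (f ⟨a, ha⟩))).1
    obtain ⟨c, rfl⟩ := hc.mem_of_tgt ⟨⟨a, ha⟩, rfl⟩ hba.symm
    refine ⟨c, ⟨⟨c, hb, rfl⟩, (ht _ _).1 hba⟩, ?_⟩
    rintro _ ⟨⟨d, hd, rfl⟩, hda⟩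
    exact congrArg Subtype.val (hf (hu (f d) ⟨hd, (ht d ⟨a, ha⟩).2 hda⟩))
  · rintro _ ⟨a, ha, rfl⟩
    obtain ⟨b, ⟨hb, hba⟩, hu⟩ := (h' (G'.src (f ⟨a, ha⟩))).2
    obtain ⟨c, rfl⟩ := hc.mem_of_src ⟨⟨a, ha⟩, rfl⟩ hba.symm
    refine ⟨c, ⟨⟨c, hb, rfl⟩, (hs _ _).1 hba⟩, ?_⟩
    rintro _ ⟨⟨d, hd, rfl⟩, hda⟩
    exact congrArg Subtype.val (hf (hu (f d) ⟨hd, (hs d ⟨a, ha⟩).2 hda⟩))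

theorem inter_union_image_inter (S : Set A) (F : Set (Kᶜ : Set A)) :
    (S ∩ K ∪ Subtype.val '' F) ∩ K = S ∩ K := by
  ext a
  constructor
  · rintro ⟨ha | ⟨b, -, rfl⟩, haK⟩
    · exact ha
    · exact absurd haK b.2
  · exact fun ha => ⟨Or.inl ha, ha.2⟩

theorem preimage_inter_union_image (S : Set A) (F : Set (Kᶜ : Set A)) :
    Subtype.val ⁻¹' (S ∩ K ∪ Subtype.val '' F) = F := by
  ext a
  constructor
  · rintro (ha | ⟨b, hb, hba⟩)
    · exact absurd ha.2 a.2
    · rwa [← Subtype.ext hba]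
  · exact fun ha => Or.inr ⟨a, ha, rfl⟩

end Embedding

section Collapse

variable [Finite V] {G : Multidigraph V A} {K : Set A} {S₀ : Set A}

theorem IsFull.OpenOn.isGluing {h₀ : G.IsFull S₀} (ho : h₀.OpenOn K) (hK : G.IsClosed K)
    (hG : G.Is2dd) :
    (G.sub Kᶜ).IsGluing (fun u v : G.verts Kᶜ => G.route K (S₀ ∩ K) u v) where
  isExit u v huv := isExit_sub.2 ((hK.isExit_compl_iff hG).2 ((h₀.route_iff hK hG).1 huv).1)
  isEntry u v huv := isEntry_sub.2 ((hK.isEntry_compl_iff hG).2 ((h₀.route_iff hK hG).1 huv).2.1)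
  exists_right u hu := by
    obtain ⟨h1, h2⟩ := (hK.isExit_compl_iff hG).1 (isExit_sub.1 hu)
    obtain ⟨w, hw⟩ := ho.exists_route hK hG h1 h2
    exact ⟨⟨w, mem_verts.2 (Or.inr ((h₀.route_iff hK hG).1 hw).2.1.2)⟩, hw⟩
  exists_left v hv := by
    obtain ⟨h1, h2⟩ := (hK.isEntry_compl_iff hG).1 (isEntry_sub.1 hv)
    obtain ⟨w, hw⟩ := ho.exists_route' hK hG h1 h2
    exact ⟨⟨w, mem_verts.2 (Or.inl ((h₀.route_iff hK hG).1 hw).1.1)⟩, hw⟩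
  right_unique _ _ _ h h' := Subtype.ext (h₀.route_right_unique hK hG h h')
  left_unique _ _ _ h h' := Subtype.ext (h₀.route_left_unique hK hG h h')

/-- A factor whose part inside `K` has the route along which `K` is collapsed induces a factor with
the same number of cycles in the collapsed graph. -/
theorem IsFull.OpenOn.exists_isFull_collapse [Finite A] {h₀ : G.IsFull S₀} (ho : h₀.OpenOn K)
    (hK : G.IsClosed K) (hG : G.Is2dd) {S : Set A} {h : G.IsFull S} (hoS : h.OpenOn K)
    (hr : G.route K (S ∩ K) = G.route K (S₀ ∩ K)) :
    ∃ h' : (G.collapse K (G.route K (S₀ ∩ K))).IsFull (Subtype.val ⁻¹' S),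
      h.perm.orb = h'.perm.orb := by
  have hgl := ho.isGluing hK hG
  have hne : ∀ v : G.verts Kᶜ, ¬ (G.sub Kᶜ).IsEntry univ v → (v : V) ∈ G.ins Kᶜ := by
    intro v hv
    by_contra hvT
    exact hv (isEntry_sub.2 ((hK.isEntry_compl_iff hG).2 ⟨hvT, (mem_verts.1 v.2).resolve_left hvT⟩))
  have hne' : ∀ v : G.verts Kᶜ, ¬ (G.sub Kᶜ).IsExit univ v → (v : V) ∈ G.outs Kᶜ := by
    intro v hv
    by_contra hvT
    exact hv (isExit_sub.2 ((hK.isExit_compl_iff hG).2 ⟨(mem_verts.1 v.2).resolve_right hvT, hvT⟩))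
  have hT : ∀ v : G.verts Kᶜ, (v : V) ∈ G.ins Kᶜ → ¬ (G.sub Kᶜ).IsEntry univ v := fun v hv hv' =>
    ((hK.isEntry_compl_iff hG).1 (isEntry_sub.1 hv')).1 hv
  have h' : (G.collapse K (G.route K (S₀ ∩ K))).IsFull (Subtype.val ⁻¹' S) := by
    intro q
    constructor
    · obtain ⟨v, hv, rfl⟩ := hgl.exists_mk_eq q
      obtain ⟨a, ⟨ha, hav⟩, hu⟩ := (h v).1
      have haK : a ∈ Kᶜ := hK.compl.tgt_mem_ins.1 (hav ▸ hne v hv)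
      refine ⟨⟨a, haK⟩, ⟨ha, congrArg (Quot.mk _) (Subtype.ext hav)⟩, ?_⟩
      rintro b ⟨hb, hbv⟩
      have := hgl.eq_of_mk_eq (fun hv => hv.tgt_ne b rfl) hv hbv
      exact Subtype.ext (hu b ⟨hb, congrArg Subtype.val this⟩)
    · obtain ⟨v, hv, rfl⟩ := hgl.exists_mk_eq' q
      obtain ⟨a, ⟨ha, hav⟩, hu⟩ := (h v).2
      have haK : a ∈ Kᶜ := hK.compl.src_mem_outs.1 (hav ▸ hne' v hv)
      refine ⟨⟨a, haK⟩, ⟨ha, congrArg (Quot.mk _) (Subtype.ext hav)⟩, ?_⟩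
      rintro b ⟨hb, hbv⟩
      have := hgl.eq_of_mk_eq' (fun hv => hv.src_ne b rfl) hv hbv
      exact Subtype.ext (hu b ⟨hb, congrArg Subtype.val this⟩)
  refine ⟨h', ?_⟩
  have hstep : ∀ (v u : G.verts Kᶜ), (v : V) ∈ G.outs Kᶜ → h.perm v = u →
      h'.perm (Quot.mk _ v) = Quot.mk _ u := by
    intro v u hv hu
    obtain ⟨a, ha, hav, hau⟩ := h.exists_arc v
    have haK : a ∈ Kᶜ := hK.compl.src_mem_outs.1 (hav ▸ hv)
    have h1 := h'.perm_src (a := ⟨a, haK⟩) ha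
    have hv' : v = (G.sub Kᶜ).src ⟨a, haK⟩ := Subtype.ext hav.symm
    have hu' : u = (G.sub Kᶜ).tgt ⟨a, haK⟩ := Subtype.ext (hu.symm.trans hau.symm)
    rw [hv', hu']
    exact h1
  refine hoS.orb_eq_of_route hK hG
    (j := fun v => Quot.mk _ (⟨v, mem_verts.2 (Or.inl v.2)⟩ : G.verts Kᶜ)) ?_ ?_ ?_ ?_
  · intro u v huv
    have := hgl.eq_of_mk_eq (hT _ u.2) (hT _ v.2) huv
    exact Subtype.ext (Subtype.mk.inj this)
  · intro q
    obtain ⟨v, hv, rfl⟩ := hgl.exists_mk_eq q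
    exact ⟨0, ⟨v, hne v hv⟩, rfl⟩
  · exact fun v u hv hu => hstep _ _ hv hu
  · intro v u w hw hu
    refine ⟨1, one_pos, ?_, fun k hk hk' => by omega⟩
    have hwO := ((h.route_iff hK hG).1 hw).2.1.2
    rw [hr] at hw
    rw [pow_one, ← hstep ⟨w, mem_verts.2 (Or.inr hwO)⟩ ⟨u, mem_verts.2 (Or.inl u.2)⟩ hwO hu]
    exact congrArg _ (Quot.sound hw)

/-- Conversely, a factor of the collapsed graph lifts to one with the same number of cycles. -/
theorem IsFull.OpenOn.exists_isFull_of_collapse [Finite A] {h₀ : G.IsFull S₀} (ho : h₀.OpenOn K)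
    (hK : G.IsClosed K) (hG : G.Is2dd) {S' : Set (Kᶜ : Set A)}
    (h' : (G.collapse K (G.route K (S₀ ∩ K))).IsFull S') :
    ∃ (S : Set A) (h : G.IsFull S), h.perm.orb = h'.perm.orb := by
  have hgl := ho.isGluing hK hG
  have h : G.IsFull (S₀ ∩ K ∪ Subtype.val '' S') :=
    hK.isFull_union_preimage Function.injective_id
      (fun a b => hgl.tgt_eq_iff.trans Subtype.ext_iff)
      (fun a b => hgl.src_eq_iff.trans Subtype.ext_iff) ⟨by simp, by simp⟩ h₀ h'
  have hS := inter_union_image_inter S₀ S'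
  obtain ⟨h'', h3⟩ := ho.exists_isFull_collapse hK hG (h := h) (ho.congr h hK hG hS.symm)
    (congrArg _ hS)
  refine ⟨_, h, h3.trans ?_⟩
  revert h''
  rw [preimage_inter_union_image S₀ S']
  exact fun _ _ => rfl

/-- A subgraph with a unique open route may be collapsed. -/
theorem IsFull.OpenOn.canCollapse [Finite A] {h₀ : G.IsFull S₀} (ho : h₀.OpenOn K)
    (hK : G.IsClosed K) (hG : G.Is2dd) (hsix : G.ACsHaveCard 6) (hodd : G.IsOdd)
    (hne : (G.ins Kᶜ).Nonempty)
    (huniq : ∀ (S : Set A) (h : G.IsFull S), h.OpenOn K →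
      G.route K (S ∩ K) = G.route K (S₀ ∩ K)) : G.CanCollapse K := by
  have hgl := ho.isGluing hK hG
  have h2dd : (G.collapse K (G.route K (S₀ ∩ K))).Is2dd :=
    hgl.is2dd_identify (hK.compl.is2Digraph_sub hG)
  refine ⟨G.route K (S₀ ∩ K), fun σ => ⟨?_, ?_⟩, h2dd,
    hgl.aCsHaveCard_identify (aCsHaveCard_sub hsix), ?_, ?_⟩
  · rintro ⟨F, hF, hi, rfl⟩
    have hFK := union_inter_compl_inter (S := S₀) hF.1
    have := huniq _ (hF.isFull_union h₀ hK hG)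
      ((IsFull.openOn_iff _ hK hG).2 (by rw [hFK]; exact hi))
    rwa [hFK] at this
  · rintro rfl
    exact ⟨_, h₀.isFactor_inter hK hG, (h₀.openOn_iff hK hG).1 ho, rfl⟩
  · rw [isOdd_iff h2dd]
    intro S' h'
    obtain ⟨S, h, hS⟩ := ho.exists_isFull_of_collapse hK hG h'
    exact hS ▸ (isOdd_iff hG).1 hodd S h
  · rw [hamiltonian_iff, hamiltonian_iff]
    constructor
    · rintro ⟨S, h, h1⟩
      have hoS := h.openOn_of_orb_eq_one h1 hne
      obtain ⟨h', h2⟩ := ho.exists_isFull_collapse hK hG hoS (huniq S h hoS)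
      exact ⟨_, h', h2 ▸ h1⟩
    · rintro ⟨S', h', h1⟩
      obtain ⟨S, h, hS⟩ := ho.exists_isFull_of_collapse hK hG h'
      exact ⟨S, h, hS ▸ h1⟩

end Collapse

end Multidigraph

/-! ### Hexagons -/

namespace Multidigraph

variable {V A V' A' W : Type*}

/-- The alternating cycle with the six arcs `(i, false)` from `o i` to `t i` and `(i, true)` from
`o (i + 1)` to `t i`. -/
def hexagon (o t : Fin 3 → W) : Multidigraph W (Fin 3 × Bool) where
  src p := o (if p.2 then p.1 + 1 else p.1)
  tgt p := t p.1

section Hexagon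

variable {o t : Fin 3 → W}

theorem isAC_hexagon (o t : Fin 3 → W) : (hexagon o t).IsAC univ := by
  refine ⟨3, fun i => (if i < 2 then 0 else if i < 4 then 1 else 2, decide (i % 2 = 1)),
    by norm_num, ?_, ?_, ?_⟩
  · intro i hi j hj hij
    simp only [mem_Iio] at hi hj
    interval_cases i <;> interval_cases j <;> simp at hij ⊢
  · ext ⟨i, b⟩
    simp only [mem_image, mem_Iio, mem_univ, iff_true]
    refine ⟨2 * i.1 + b.toNat, ?_, ?_⟩
    · have := i.2; have := b.toNat_le; omega
    · fin_cases i <;> cases b <;> rfl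
  · intro i hi
    interval_cases i <;> constructor <;> intro h <;> first | rfl | exact absurd h (by decide)

theorem hexagon_degLeTwo (ho : Function.Injective o) (ht : Function.Injective t) :
    (hexagon o t).DegLeTwo := by
  constructor
  · intro a b c hab hac
    have h1 := ht hab
    have h2 := ht hac
    clear hab hac
    revert a b c
    decide
  · intro a b c hab hac
    have h1 := ho hab
    have h2 := ho hac
    clear hab hac
    revert a b c
    decide

theorem hexagon_aCs (ho : Function.Injective o) (ht : Function.Injective t) :
    (hexagon o t).ACs = {univ} := by
  refine eq_singleton_iff_unique_mem.2 ⟨isAC_hexagon o t, fun X hX => ?_⟩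
  exact IsAC.eq_of_inter (hexagon_degLeTwo ho ht) hX (isAC_hexagon o t)
    (by rw [inter_univ]; exact hX.nonempty)

theorem hexagon_aCsHaveCard (ho : Function.Injective o) (ht : Function.Injective t) :
    (hexagon o t).ACsHaveCard 6 := by
  intro X hX
  rw [hexagon_aCs ho ht] at hX
  rw [mem_singleton_iff.1 hX, ncard_univ, Nat.card_eq_fintype_card]
  rfl

theorem hexagon_inDeg (ht : Function.Injective t) (i : Fin 3) :
    (hexagon o t).inDeg univ (t i) = 2 := by
  have : {p | p ∈ univ ∧ (hexagon o t).tgt p = t i} = {(i, false), (i, true)} := by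
    ext ⟨k, b⟩
    cases b <;> simp [hexagon, ht.eq_iff]
  rw [inDeg, this, ncard_pair (by simp)]

theorem hexagon_outDeg (ho : Function.Injective o) (i : Fin 3) :
    (hexagon o t).outDeg univ (o i) = 2 := by
  have : {p | p ∈ univ ∧ (hexagon o t).src p = o i} = {(i, false), (i - 1, true)} := by
    ext ⟨k, b⟩
    cases b <;> simp [hexagon, ho.eq_iff, eq_sub_iff_add_eq]
  rw [outDeg, this, ncard_pair (by simp)]

/-- A factor of a digraph contains one of the two perfect matchings of each closed hexagon and
avoids the other one. -/
theorem IsFull.hexagon_alternative {G' : Multidigraph V' A'} {f : Fin 3 × Bool → A'}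
    (hf : Function.Injective f)
    (ht : ∀ a b, G'.tgt (f a) = G'.tgt (f b) ↔ a.1 = b.1)
    (hs : ∀ a b, G'.src (f a) = G'.src (f b) ↔
      (if a.2 then a.1 + 1 else a.1) = if b.2 then b.1 + 1 else b.1)
    (hc : G'.IsClosed (range f)) {S : Set A'} (h : G'.IsFull S) :
    ∃ b, ∀ p, f p ∈ S ↔ p.2 = b := by
  have h1 : ∀ i, f (i, false) ∈ S ↔ f (i, true) ∉ S := by
    intro i
    constructor
    · intro h0 h1
      have := hf (h.eq_of_tgt h0 h1 ((ht _ _).2 rfl))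
      simp at this
    · intro h1
      obtain ⟨a, ⟨ha, hai⟩, -⟩ := (h (G'.tgt (f (i, false)))).1
      obtain ⟨⟨k, b⟩, rfl⟩ := hc.mem_of_tgt ⟨_, rfl⟩ hai.symm
      have hk : k = i := (ht _ _).1 hai
      subst hk
      cases b
      · exact ha
      · exact absurd ha h1
  have h2 : ∀ i, f (i + 1, false) ∈ S ↔ f (i, true) ∉ S := by
    intro i
    constructor
    · intro h0 h1
      have := hf (h.eq_of_src h0 h1 ((hs _ _).2 rfl))
      simp at this
    · intro h1
      obtain ⟨a, ⟨ha, hai⟩, -⟩ := (h (G'.src (f (i + 1, false)))).2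
      obtain ⟨⟨k, b⟩, rfl⟩ := hc.mem_of_src ⟨_, rfl⟩ hai.symm
      have hk := (hs _ _).1 hai
      cases b
      · have hk : k = i + 1 := hk
        rwa [hk] at ha
      · have hk : k + 1 = i + 1 := hk
        rw [add_right_cancel hk] at ha
        exact absurd ha h1
  have h3 : ∀ i, f (i, false) ∈ S ↔ f (0, false) ∈ S := by
    have h4 : ∀ i, f (i + 1, false) ∈ S ↔ f (i, false) ∈ S := fun i => (h2 i).trans (h1 i).symm
    intro i
    fin_cases i
    · rfl
    · exact h4 0
    · exact (h4 1).trans (h4 0)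
  by_cases h0 : f (0, false) ∈ S
  · refine ⟨false, ?_⟩
    rintro ⟨i, _ | _⟩
    · simpa using (h3 i).2 h0
    · simpa using (h1 i).1 ((h3 i).2 h0)
  · refine ⟨true, ?_⟩
    rintro ⟨i, _ | _⟩
    · simpa using fun h => h0 ((h3 i).1 h)
    · simpa using by_contra fun h => h0 ((h3 i).1 ((h1 i).2 h))

end Hexagon

section Saturated

variable [Finite A] {G : Multidigraph V A} {K : Set A}

theorem is2Digraph_hexagon_id : (hexagon (id : Fin 3 → Fin 3) id).Is2Digraph := fun i =>
  Or.inr (Or.inr ⟨hexagon_inDeg (t := id) Function.injective_id i,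
    hexagon_outDeg (o := id) Function.injective_id i⟩)

theorem not_isEntry_hexagon_id (i : Fin 3) : ¬ (hexagon (id : Fin 3 → Fin 3) id).IsEntry univ i :=
  fun h => by
    have := (hexagon_inDeg (o := id) (t := id) Function.injective_id i).symm.trans h.1
    omega

theorem not_isExit_hexagon_id (i : Fin 3) : ¬ (hexagon (id : Fin 3 → Fin 3) id).IsExit univ i :=
  fun h => by
    have := (hexagon_outDeg (o := id) (t := id) Function.injective_id i).symm.trans h.2
    omega

/-- A Hamiltonian 2-dd may be replaced as a whole by the hexagon with three saturated vertices whose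
two factors are a Hamiltonian circuit and a set of three loops. -/
theorem canReplaceBySingleAC_of_eq_univ (hG : G.Is2dd) (hK : K = univ) (hsix : G.ACsHaveCard 6)
    (hham : G.Hamiltonian) : G.CanReplaceBySingleAC K := by
  subst hK
  have hE : IsEmpty (G.verts univᶜ) := ⟨fun ⟨v, a, ha, _⟩ => ha trivial⟩
  have hA : IsEmpty ((univ : Set A)ᶜ : Set A) := ⟨fun a => a.2 trivial⟩
  have hF1 : IsEmpty {v // (hexagon (id : Fin 3 → Fin 3) id).IsExit univ v} :=
    ⟨fun v => not_isExit_hexagon_id _ v.2⟩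
  have hF2 : IsEmpty {v // (hexagon (id : Fin 3 → Fin 3) id).IsEntry univ v} :=
    ⟨fun v => not_isEntry_hexagon_id _ v.2⟩
  have hcl : G.IsClosed univ := ⟨fun _ _ _ _ => trivial, fun _ _ _ _ => trivial⟩
  let x : {v // (hexagon (id : Fin 3 → Fin 3) id).IsExit univ v} ≃
    {v // (G.sub univᶜ).IsEntry univ v} := Equiv.equivOfIsEmpty _ _
  let y : {v // (G.sub univᶜ).IsExit univ v} ≃
    {v // (hexagon (id : Fin 3 → Fin 3) id).IsEntry univ v} := Equiv.equivOfIsEmpty _ _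
  have hgl := isGluing_spliceRel x y
  have h2dd : (splice (hexagon id id) (G.sub univᶜ) x y).Is2dd :=
    hgl.is2dd_identify (is2Digraph_hexagon_id.disjUnion (hcl.compl.is2Digraph_sub hG))
  refine ⟨Fin 3, Fin 3 × Bool, inferInstance, inferInstance, hexagon id id, is2Digraph_hexagon_id,
    hexagon_aCsHaveCard Function.injective_id Function.injective_id, ?_, x, y, h2dd, ?_, ?_, ?_⟩
  · rw [hexagon_aCs Function.injective_id Function.injective_id, ncard_singleton]
  · exact hgl.aCsHaveCard_identify (aCsHaveCard_disjUnion
      (hexagon_aCsHaveCard Function.injective_id Function.injective_id) (aCsHaveCard_sub hsix))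
  all_goals
    set G' := splice (hexagon id id) (G.sub univᶜ) x y with hG'
    let q : Fin 3 → Quot (spliceRel (hexagon id id) (G.sub univᶜ) x y) := fun i =>
      Quot.mk _ (Sum.inl i)
    have hq : Function.Bijective q := by
      constructor
      · intro i k hik
        exact Sum.inl_injective (hgl.eq_of_mk_eq
          (fun h => not_isEntry_hexagon_id _ (isEntry_disjUnion_inl.1 h))
          (fun h => not_isEntry_hexagon_id _ (isEntry_disjUnion_inl.1 h)) hik)
      · intro p
        induction p using Quot.inductionOn with
        | _ v =>
          rcases v with i | v
          · exact ⟨i, rfl⟩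
          · exact hE.elim v
    have : Finite (Quot (spliceRel (hexagon id id) (G.sub univᶜ) x y)) :=
      Finite.of_surjective q hq.2
    have htgt : ∀ p, G'.tgt (Sum.inl p) = q p.1 := fun p => rfl
    have hsrc : ∀ p, G'.src (Sum.inl p) = q (if p.2 then p.1 + 1 else p.1) := fun p => rfl
    have hcl' : G'.IsClosed (range Sum.inl) := by
      constructor <;>
      · rintro _ (b | b) - -
        · exact ⟨b, rfl⟩
        · exact hA.elim b
    -- the matching of the arcs `(i, true)` is a circuit through the three vertices
    have hone : ∀ (S : Set ((Fin 3 × Bool) ⊕ ((univ : Set A)ᶜ : Set A))) (h : G'.IsFull S),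
        (∀ p, Sum.inl p ∈ S ↔ p.2 = true) → h.perm.orb = 1 := by
      intro S h hb
      have hstep : ∀ i, h.perm (q (i + 1)) = q i := fun i => h.perm_src ((hb (i, true)).2 rfl)
      refine Equiv.Perm.orb_eq_one_iff.2 ⟨⟨q 0⟩, fun u v => ?_⟩
      have h0 : ∀ i, h.perm.SameCycle (q i) (q 0) := by
        intro i
        fin_cases i
        · exact Equiv.Perm.SameCycle.refl _ _
        · exact ⟨1, hstep 0⟩
        · exact ⟨2, by
            rw [zpow_two, Equiv.Perm.mul_apply]
            exact (congrArg _ (hstep 1)).trans (hstep 0)⟩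
      obtain ⟨i, rfl⟩ := hq.2 u
      obtain ⟨k, rfl⟩ := hq.2 v
      exact (h0 i).trans (h0 k).symm
  · rw [isOdd_iff h2dd]
    intro S h
    obtain ⟨b, hb⟩ := h.hexagon_alternative (f := Sum.inl) Sum.inl_injective
      (fun a b => by rw [htgt, htgt, hq.1.eq_iff]) (fun a b => by rw [hsrc, hsrc, hq.1.eq_iff]) hcl'
    -- the matching of the arcs `(i, false)` consists of three loops
    cases b
    · have hstep : ∀ i, h.perm (q i) = q i := fun i => h.perm_src ((hb (i, false)).2 rfl)
      have h1 : h.perm = 1 := by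
        ext v
        obtain ⟨i, rfl⟩ := hq.2 v
        exact hstep i
      rw [h1, Equiv.Perm.orb_one, ← Nat.card_congr (Equiv.ofBijective q hq),
        Nat.card_eq_fintype_card]
      decide
    · rw [hone S h hb]
      exact odd_one
  · refine iff_of_true hham (hamiltonian_iff.2 ?_)
    have h : G'.IsFull (range fun i : Fin 3 => Sum.inl (i, true)) := by
      intro v
      obtain ⟨i, rfl⟩ := hq.2 v
      constructor
      · refine ⟨_, ⟨⟨i, rfl⟩, htgt _⟩, ?_⟩
        rintro _ ⟨⟨k, rfl⟩, hk⟩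
        rw [htgt] at hk
        have hk' : k = i := hq.1 hk
        rw [hk']
      · refine ⟨_, ⟨⟨i - 1, rfl⟩, by simp [hsrc]⟩, ?_⟩
        rintro _ ⟨⟨k, rfl⟩, hk⟩
        rw [hsrc] at hk
        have hk' : k + 1 = i := hq.1 hk
        rw [← hk', add_sub_cancel_right]
    exact ⟨_, h, hone _ h (by rintro ⟨i, b⟩; simp [eq_comm])⟩

end Saturated

end Multidigraph

/-! ### Replacement by a hexagon without saturated vertices -/

namespace Multidigraph

variable {V A : Type*}

/-- The hexagon with entry vertices `inl i` and exit vertices `inr i`. -/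
def openHexagon : Multidigraph (Fin 3 ⊕ Fin 3) (Fin 3 × Bool) := hexagon Sum.inl Sum.inr

theorem isEntry_openHexagon (i : Fin 3) : openHexagon.IsEntry univ (Sum.inl i) := by
  refine ⟨?_, hexagon_outDeg Sum.inl_injective i⟩
  refine inDeg_of_notMem ?_
  rintro ⟨a, -, ha⟩
  exact Sum.inr_ne_inl ha

theorem isExit_openHexagon (i : Fin 3) : openHexagon.IsExit univ (Sum.inr i) := by
  refine ⟨hexagon_inDeg Sum.inr_injective i, ?_⟩
  refine outDeg_of_notMem ?_
  rintro ⟨a, -, ha⟩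
  exact Sum.inl_ne_inr ha

theorem is2Digraph_openHexagon : openHexagon.Is2Digraph := by
  rintro (i | i)
  · exact Or.inl (isEntry_openHexagon i)
  · exact Or.inr (Or.inl (isExit_openHexagon i))

/-- The numbering of the entry vertices of the open hexagon. -/
noncomputable def entryEquiv : Fin 3 ≃ {v // openHexagon.IsEntry univ v} :=
  Equiv.ofBijective (fun i => ⟨Sum.inl i, isEntry_openHexagon i⟩) (by
    constructor
    · exact fun i k hik => Sum.inl_injective (Subtype.mk.inj hik)
    · rintro ⟨i | i, hi⟩
      · exact ⟨i, rfl⟩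
      · exact absurd hi (isExit_openHexagon i).not_isEntry)

/-- The numbering of the exit vertices of the open hexagon. -/
noncomputable def exitEquiv : Fin 3 ≃ {v // openHexagon.IsExit univ v} :=
  Equiv.ofBijective (fun i => ⟨Sum.inr i, isExit_openHexagon i⟩) (by
    constructor
    · exact fun i k hik => Sum.inr_injective (Subtype.mk.inj hik)
    · rintro ⟨i | i, hi⟩
      · exact absurd (isEntry_openHexagon i) hi.not_isEntry
      · exact ⟨i, rfl⟩)

/-- A fixed-point-free permutation of three points is a 3-cycle. -/
theorem exists_equiv_fin_three {E : Type*} (hE : Nat.card E = 3) (c : Equiv.Perm E)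
    (hc : ∀ e, c e ≠ e) : ∃ ε : Fin 3 ≃ E, ∀ i, ε (i + 1) = c (ε i) := by
  have : Finite E := Nat.finite_of_card_ne_zero (by omega)
  let g : E ≃ Fin 3 := Finite.equivFinOfCardEq hE
  have key : ∀ d : Equiv.Perm (Fin 3), (∀ i, d i ≠ i) →
      ∃ ε : Equiv.Perm (Fin 3), ∀ i, ε (i + 1) = d (ε i) := by decide
  obtain ⟨ε, hε⟩ := key ((g.symm.trans c).trans g) (fun i h => hc (g.symm i) (by
    apply g.injective; simpa using h))
  exact ⟨ε.trans g.symm, fun i => by simp [hε]⟩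

section Splice

variable [Finite V] [Finite A] {G : Multidigraph V A} {K : Set A}
  {x : {v // openHexagon.IsExit univ v} ≃ {v // (G.sub Kᶜ).IsEntry univ v}}
  {y : {v // (G.sub Kᶜ).IsExit univ v} ≃ {v // openHexagon.IsEntry univ v}}

/-- Let an open hexagon be spliced with the complement of `K`, in such a way that the two matchings
of the hexagon lead from the entry vertices `ε i` and `ε (i + 1)`, respectively, to the exit vertex
`δ i` of `K`. A factor whose part inside `K` has one of these two routes induces, by means of the
corresponding matching, a factor of the spliced graph with the same number of cycles. -/
theorem IsFull.OpenOn.exists_isFull_splice (hK : G.IsClosed K) (hG : G.Is2dd) {ε δ : Fin 3 → V}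
    (hy : ∀ u : {v // (G.sub Kᶜ).IsExit univ v}, ((u : G.verts Kᶜ) : V) = ε (entryEquiv.symm (y u)))
    (hx : ∀ i, ((x (exitEquiv i) : G.verts Kᶜ) : V) = δ i) {S : Set A} {h : G.IsFull S}
    (ho : h.OpenOn K) {b : Bool}
    (hr : ∀ i, G.route K (S ∩ K) (ε (if b then i + 1 else i)) (δ i))
    {S' : Set ((Fin 3 × Bool) ⊕ (Kᶜ : Set A))} (hl' : ∀ p, Sum.inl p ∈ S' ↔ p.2 = b)
    (hr' : ∀ a : (Kᶜ : Set A), Sum.inr a ∈ S' ↔ (a : A) ∈ S) :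
    ∃ h' : (splice openHexagon (G.sub Kᶜ) x y).IsFull S', h.perm.orb = h'.perm.orb := by
  have hgl := isGluing_spliceRel x y
  set G' := splice openHexagon (G.sub Kᶜ) x y with hG'
  have hinr : ∀ i, ¬ (disjUnion openHexagon (G.sub Kᶜ)).IsEntry univ (Sum.inl (Sum.inr i)) :=
    fun i h => (isExit_openHexagon i).not_isEntry (isEntry_disjUnion_inl.1 h)
  have hinl : ∀ i, ¬ (disjUnion openHexagon (G.sub Kᶜ)).IsExit univ (Sum.inl (Sum.inl i)) :=
    fun i h => (isExit_disjUnion_inl.1 h).not_isEntry (isEntry_openHexagon i)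
  have hins : ∀ v : G.verts Kᶜ,
      ¬ (disjUnion openHexagon (G.sub Kᶜ)).IsEntry univ (Sum.inr v) ↔ (v : V) ∈ G.ins Kᶜ := by
    intro v
    have := mem_verts.1 v.2
    rw [isEntry_disjUnion_inr, isEntry_sub, hK.isEntry_compl_iff hG]
    tauto
  have houts : ∀ v : G.verts Kᶜ,
      ¬ (disjUnion openHexagon (G.sub Kᶜ)).IsExit univ (Sum.inr v) ↔ (v : V) ∈ G.outs Kᶜ := by
    intro v
    have := mem_verts.1 v.2
    rw [isExit_disjUnion_inr, isExit_sub, hK.isExit_compl_iff hG]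
    tauto
  have hsb : Function.Surjective fun i : Fin 3 => if b then i + 1 else i := by
    cases b <;> decide
  have hsi : Function.Injective fun i : Fin 3 => if b then i + 1 else i :=
    Finite.injective_iff_surjective.2 hsb
  have h' : G'.IsFull S' := by
    intro q
    constructor
    · obtain ⟨(i | i) | v, hv, rfl⟩ := hgl.exists_mk_eq q
      · exact absurd (isEntry_disjUnion_inl.2 (isEntry_openHexagon i)) hv
      · refine ⟨Sum.inl (i, b), ⟨(hl' _).2 rfl, rfl⟩, ?_⟩
        rintro c ⟨hc, hcv⟩
        have hcv := hgl.eq_of_mk_eq (fun hv => hv.tgt_ne c rfl) hv hcv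
        rcases c with ⟨k, b'⟩ | c
        · have hk : k = i := Sum.inr_injective (Sum.inl_injective hcv)
          have hb : b' = b := (hl' _).1 hc
          rw [hk, hb]
        · exact absurd hcv Sum.inr_ne_inl
      · obtain ⟨a, ⟨ha, hav⟩, hu⟩ := (h v).1
        have haK : a ∈ Kᶜ := hK.compl.tgt_mem_ins.1 (hav ▸ (hins v).1 hv)
        refine ⟨Sum.inr ⟨a, haK⟩, ⟨(hr' _).2 ha,
          congrArg (fun v => Quot.mk _ (Sum.inr v)) (Subtype.ext hav)⟩, ?_⟩
        rintro c ⟨hc, hcv⟩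
        have hcv := hgl.eq_of_mk_eq (fun hv => hv.tgt_ne c rfl) hv hcv
        rcases c with p | c
        · exact absurd hcv Sum.inl_ne_inr
        · have := Sum.inr_injective hcv
          exact congrArg Sum.inr (Subtype.ext (hu c ⟨(hr' _).1 hc, congrArg Subtype.val this⟩))
    · obtain ⟨(i | i) | v, hv, rfl⟩ := hgl.exists_mk_eq' q
      · obtain ⟨l, rfl⟩ := hsb i
        refine ⟨Sum.inl (l, b), ⟨(hl' _).2 rfl, rfl⟩, ?_⟩
        rintro c ⟨hc, hcv⟩
        have hcv := hgl.eq_of_mk_eq' (fun hv => hv.src_ne c rfl) hv hcv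
        rcases c with ⟨k, b'⟩ | c
        · have hb : b' = b := (hl' _).1 hc
          subst hb
          have hk : k = l := hsi (Sum.inl_injective (Sum.inl_injective hcv))
          rw [hk]
        · exact absurd hcv Sum.inr_ne_inl
      · exact absurd (isExit_disjUnion_inl.2 (isExit_openHexagon i)) hv
      · obtain ⟨a, ⟨ha, hav⟩, hu⟩ := (h v).2
        have haK : a ∈ Kᶜ := hK.compl.src_mem_outs.1 (hav ▸ (houts v).1 hv)
        refine ⟨Sum.inr ⟨a, haK⟩, ⟨(hr' _).2 ha,
          congrArg (fun v => Quot.mk _ (Sum.inr v)) (Subtype.ext hav)⟩, ?_⟩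
        rintro c ⟨hc, hcv⟩
        have hcv := hgl.eq_of_mk_eq' (fun hv => hv.src_ne c rfl) hv hcv
        rcases c with p | c
        · exact absurd hcv Sum.inl_ne_inr
        · have := Sum.inr_injective hcv
          exact congrArg Sum.inr (Subtype.ext (hu c ⟨(hr' _).1 hc, congrArg Subtype.val this⟩))
  refine ⟨h', ?_⟩
  have hstep : ∀ (v u : G.verts Kᶜ), (v : V) ∈ G.outs Kᶜ → h.perm v = u →
      h'.perm (Quot.mk _ (Sum.inr v)) = Quot.mk _ (Sum.inr u) := by
    intro v u hv hu
    obtain ⟨a, ha, hav, hau⟩ := h.exists_arc v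
    have haK : a ∈ Kᶜ := hK.compl.src_mem_outs.1 (hav ▸ hv)
    have h1 := h'.perm_src (a := Sum.inr ⟨a, haK⟩) ((hr' _).2 ha)
    have hv' : v = (G.sub Kᶜ).src ⟨a, haK⟩ := Subtype.ext hav.symm
    have hu' : u = (G.sub Kᶜ).tgt ⟨a, haK⟩ := Subtype.ext (hu.symm.trans hau.symm)
    rw [hv', hu']
    exact h1
  have hδ : ∀ (i : Fin 3) (w : G.verts Kᶜ), (w : V) = δ i →
      (Quot.mk _ (Sum.inl (Sum.inr i)) : Quot (spliceRel openHexagon (G.sub Kᶜ) x y)) =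
        Quot.mk _ (Sum.inr w) := by
    intro i w hw
    refine Quot.sound (Or.inl ⟨exitEquiv i, rfl, ?_⟩)
    rw [Subtype.ext (hw.trans (hx i).symm)]
  have hδO : ∀ i, δ i ∈ G.outs Kᶜ := fun i => ((h.route_iff hK hG).1 (hr i)).2.1.2
  refine ho.orb_eq_of_route hK hG
    (j := fun v => Quot.mk _ (Sum.inr (⟨v, mem_verts.2 (Or.inl v.2)⟩ : G.verts Kᶜ))) ?_ ?_ ?_ ?_
  · intro u v huv
    have := hgl.eq_of_mk_eq ((hins _).2 u.2) ((hins _).2 v.2) huv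
    exact Subtype.ext (Subtype.mk.inj (Sum.inr_injective this))
  · intro p
    obtain ⟨(i | i) | v, hv, rfl⟩ := hgl.exists_mk_eq p
    · exact absurd (isEntry_disjUnion_inl.2 (isEntry_openHexagon i)) hv
    · refine ⟨1, ⟨h.perm (δ i), (h.perm_mem_ins_compl hK).2 (hδO i)⟩, ?_⟩
      rw [pow_one, hδ i ⟨δ i, mem_verts.2 (Or.inr (hδO i))⟩ rfl]
      exact (hstep _ _ (hδO i) rfl).symm
    · exact ⟨0, ⟨v, (hins v).1 hv⟩, rfl⟩
  · exact fun v u hv hu => hstep _ _ hv hu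
  · intro v u w hw hu
    -- the exit of `K` that `v` is routed to, as a vertex of the hexagon
    have hvE : (G.sub Kᶜ).IsExit univ ⟨v, mem_verts.2 (Or.inl v.2)⟩ :=
      isExit_sub.2 ((hK.isExit_compl_iff hG).2 ((h.route_iff hK hG).1 hw).1)
    obtain ⟨i, hi⟩ := hsb (entryEquiv.symm (y ⟨_, hvE⟩))
    have hvi : (v : V) = ε (if b then i + 1 else i) := (hy ⟨_, hvE⟩).trans (congrArg ε hi.symm)
    have hwi : w = δ i := h.route_right_unique hK hG hw (hvi ▸ hr i)
    have hv1 : (Quot.mk _ (Sum.inr (⟨v, mem_verts.2 (Or.inl v.2)⟩ : G.verts Kᶜ)) :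
        Quot (spliceRel openHexagon (G.sub Kᶜ) x y)) =
        Quot.mk _ (Sum.inl (Sum.inl (if b then i + 1 else i))) := by
      refine Quot.sound (Or.inr ⟨⟨_, hvE⟩, rfl, ?_⟩)
      have h1 : y ⟨_, hvE⟩ = entryEquiv (if b then i + 1 else i) := by
        exact (Equiv.symm_apply_eq _).1 hi.symm
      rw [h1]
      rfl
    have hv2 : h'.perm (Quot.mk _ (Sum.inl (Sum.inl (if b then i + 1 else i)))) =
        Quot.mk _ (Sum.inl (Sum.inr i)) := h'.perm_src (a := Sum.inl (i, b)) ((hl' _).2 rfl)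
    -- the first step crosses the hexagon, the second one leads back to `ins Kᶜ`
    refine ⟨2, two_pos, ?_, fun k hk hk' => ?_⟩
    · rw [pow_two, Equiv.Perm.mul_apply, hv1, hv2,
        hδ i ⟨w, mem_verts.2 (Or.inr (hwi ▸ hδO i))⟩ hwi]
      exact hstep _ _ (hwi ▸ hδO i) hu
    · obtain rfl : k = 1 := by omega
      rw [pow_one, hv1, hv2]
      rintro ⟨t, ht⟩
      exact Sum.inr_ne_inl (hgl.eq_of_mk_eq ((hins _).2 t.2) (hinr i) ht)

/-- Conversely, a factor of the spliced graph lifts to one with the same number of cycles. -/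
theorem exists_isFull_of_splice (hK : G.IsClosed K) (hG : G.Is2dd) {ε δ : Fin 3 → V}
    (hy : ∀ u : {v // (G.sub Kᶜ).IsExit univ v}, ((u : G.verts Kᶜ) : V) = ε (entryEquiv.symm (y u)))
    (hx : ∀ i, ((x (exitEquiv i) : G.verts Kᶜ) : V) = δ i) {S : Bool → Set A}
    {h : ∀ b, G.IsFull (S b)} (ho : ∀ b, (h b).OpenOn K)
    (hr : ∀ b i, G.route K (S b ∩ K) (ε (if b then i + 1 else i)) (δ i))
    {S' : Set ((Fin 3 × Bool) ⊕ (Kᶜ : Set A))}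
    (h' : (splice openHexagon (G.sub Kᶜ) x y).IsFull S') :
    ∃ (T : Set A) (hT : G.IsFull T), hT.perm.orb = h'.perm.orb := by
  have hgl := isGluing_spliceRel x y
  have hcl : (splice openHexagon (G.sub Kᶜ) x y).IsClosed (range Sum.inl) := by
    constructor
    · rintro _ (b | b) ⟨a, rfl⟩ hab
      · exact ⟨b, rfl⟩
      · exact absurd (hgl.tgt_eq_iff.1 hab) Sum.inl_ne_inr
    · rintro _ (b | b) ⟨a, rfl⟩ hab
      · exact ⟨b, rfl⟩
      · exact absurd (hgl.src_eq_iff.1 hab) Sum.inl_ne_inr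
  have hcr : (splice openHexagon (G.sub Kᶜ) x y).IsClosed (range Sum.inr) := by
    have := hcl.compl
    rwa [isCompl_range_inl_range_inr.compl_eq] at this
  obtain ⟨b, hb⟩ := h'.hexagon_alternative (f := Sum.inl) Sum.inl_injective
    (fun a b => hgl.tgt_eq_iff.trans (Sum.inl_injective.eq_iff.trans Sum.inr_injective.eq_iff))
    (fun a b => hgl.src_eq_iff.trans (Sum.inl_injective.eq_iff.trans Sum.inl_injective.eq_iff)) hcl
  have hT : G.IsFull (S b ∩ K ∪ Subtype.val '' (Sum.inr ⁻¹' S')) :=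
    hK.isFull_union_preimage Sum.inr_injective
      (fun a b => hgl.tgt_eq_iff.trans (Sum.inr_injective.eq_iff.trans Subtype.ext_iff))
      (fun a b => hgl.src_eq_iff.trans (Sum.inr_injective.eq_iff.trans Subtype.ext_iff))
      hcr (h b) h'
  have hTK := inter_union_image_inter (S b) (Sum.inr ⁻¹' S')
  obtain ⟨h'', h3⟩ := IsFull.OpenOn.exists_isFull_splice hK hG hy hx
    ((ho b).congr hT hK hG hTK.symm) (b := b) (by rw [hTK]; exact hr b) hb
    (fun a => (Set.ext_iff.1 (preimage_inter_union_image (S b) (Sum.inr ⁻¹' S')) a).symm)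
  exact ⟨_, hT, h3⟩

end Splice

section Replace

variable [Finite V] {G : Multidigraph V A} {K : Set A} {S₀ S₁ : Set A}

/-- The route of an open factor as an equivalence. -/
theorem IsFull.OpenOn.exists_routeEquiv {h₀ : G.IsFull S₀} (ho : h₀.OpenOn K) (hK : G.IsClosed K)
    (hG : G.Is2dd) : ∃ r : {u // G.IsEntry K u} ≃ {w // G.IsExit K w},
      ∀ u : {u // G.IsEntry K u}, G.route K (S₀ ∩ K) u (r u) := by
  have hex : ∀ u : {u // G.IsEntry K u}, ∃ w : {w // G.IsExit K w}, G.route K (S₀ ∩ K) u w := by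
    intro u
    obtain ⟨w, hw⟩ := ho.exists_route hK hG ((hK.isEntry_iff hG).1 u.2).1
      ((hK.isEntry_iff hG).1 u.2).2
    exact ⟨⟨w, hw.2.1⟩, hw⟩
  choose r hr using hex
  refine ⟨Equiv.ofBijective r ⟨fun u v huv => ?_, fun w => ?_⟩, hr⟩
  · exact Subtype.ext (h₀.route_left_unique hK hG (hr u) (huv ▸ hr v))
  · obtain ⟨u, hu⟩ := ho.exists_route' hK hG ((hK.isExit_iff hG).1 w.2).1
      ((hK.isExit_iff hG).1 w.2).2
    exact ⟨⟨u, hu.1⟩, Subtype.ext (h₀.route_right_unique hK hG (hr ⟨u, hu.1⟩) hu)⟩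

/-- A subgraph with three entry vertices and at least two open routes may be replaced by a single
hexagon that has two of these routes. -/
theorem IsFull.OpenOn.canReplaceBySingleAC [Finite A] {h₀ : G.IsFull S₀} (ho₀ : h₀.OpenOn K)
    {h₁ : G.IsFull S₁} (ho₁ : h₁.OpenOn K) (hK : G.IsClosed K) (hG : G.Is2dd)
    (hsix : G.ACsHaveCard 6) (hodd : G.IsOdd) (h3 : {u | G.IsEntry K u}.ncard = 3)
    (hne : G.route K (S₀ ∩ K) ≠ G.route K (S₁ ∩ K)) : G.CanReplaceBySingleAC K := by
  -- the two routes differ at all three entry vertices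
  have hdis : ∀ u, G.IsEntry K u → ∀ w, ¬ (G.route K (S₀ ∩ K) u w ∧ G.route K (S₁ ∩ K) u w) := by
    intro u hu
    have hle := three_le_of_route_ne hG hodd hK ho₀ ho₁ hne
    rw [← h3] at hle
    have := eq_of_subset_of_ncard_le (fun u hu => hu.1) hle (toFinite {u | G.IsEntry K u})
    exact ((Set.ext_iff.1 this u).2 hu).2
  obtain ⟨r₀, hr₀⟩ := ho₀.exists_routeEquiv hK hG
  obtain ⟨r₁, hr₁⟩ := ho₁.exists_routeEquiv hK hG
  obtain ⟨ε, hε⟩ := exists_equiv_fin_three (E := {u // G.IsEntry K u}) h3 (r₀.trans r₁.symm)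
    (fun e he => by
      have h1 : r₀ e = r₁ e := (Equiv.symm_apply_eq _).1 he
      exact hdis e e.2 (r₀ e) ⟨hr₀ e, h1 ▸ hr₁ e⟩)
  -- so the matchings of the hexagon have the routes `r₀` and `r₁`
  have hε1 : ∀ i, r₁ (ε (i + 1)) = r₀ (ε i) := fun i => by rw [hε]; simp
  -- identification of the ends of `K` with those of its complement
  let a : {w // G.IsExit K w} ≃ {v // (G.sub Kᶜ).IsEntry univ v} :=
    { toFun := fun w => ⟨⟨w, mem_verts.2 (Or.inr ((hK.isExit_iff hG).1 w.2).2)⟩,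
        isEntry_sub.2 ((hK.isEntry_compl_iff hG).2 ((hK.isExit_iff hG).1 w.2))⟩
      invFun := fun v => ⟨v.1, (hK.isExit_iff hG).2 ((hK.isEntry_compl_iff hG).1
        (isEntry_sub.1 v.2))⟩
      left_inv := fun _ => rfl
      right_inv := fun _ => rfl }
  let c : {u // G.IsEntry K u} ≃ {v // (G.sub Kᶜ).IsExit univ v} :=
    { toFun := fun w => ⟨⟨w, mem_verts.2 (Or.inl ((hK.isEntry_iff hG).1 w.2).1)⟩,
        isExit_sub.2 ((hK.isExit_compl_iff hG).2 ((hK.isEntry_iff hG).1 w.2))⟩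
      invFun := fun v => ⟨v.1, (hK.isEntry_iff hG).2 ((hK.isExit_compl_iff hG).1
        (isExit_sub.1 v.2))⟩
      left_inv := fun _ => rfl
      right_inv := fun _ => rfl }
  let x : {v // openHexagon.IsExit univ v} ≃ {v // (G.sub Kᶜ).IsEntry univ v} :=
    exitEquiv.symm.trans ((ε.trans r₀).trans a)
  let y : {v // (G.sub Kᶜ).IsExit univ v} ≃ {v // openHexagon.IsEntry univ v} :=
    (ε.trans c).symm.trans entryEquiv
  have hx : ∀ i, ((x (exitEquiv i) : G.verts Kᶜ) : V) = r₀ (ε i) := fun i => by simp [x, a]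
  have hy : ∀ u : {v // (G.sub Kᶜ).IsExit univ v},
      ((u : G.verts Kᶜ) : V) = (fun i => (ε i : V)) (entryEquiv.symm (y u)) := fun u => by
    simp [y, c]
  have hgl := isGluing_spliceRel x y
  have h2dd : (splice openHexagon (G.sub Kᶜ) x y).Is2dd :=
    hgl.is2dd_identify (is2Digraph_openHexagon.disjUnion (hK.compl.is2Digraph_sub hG))
  let S : Bool → Set A := fun b => if b then S₁ else S₀
  have hS : ∀ b, G.IsFull (S b) := by rintro (_ | _); exacts [h₀, h₁]
  have ho : ∀ b, (hS b).OpenOn K := by rintro (_ | _); exacts [ho₀, ho₁]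
  have hr : ∀ b i, G.route K (S b ∩ K) (ε (if b then i + 1 else i)) (r₀ (ε i)) := by
    rintro (_ | _) i
    · exact hr₀ (ε i)
    · exact hε1 i ▸ hr₁ (ε (i + 1))
  refine ⟨Fin 3 ⊕ Fin 3, Fin 3 × Bool, inferInstance, inferInstance, openHexagon,
    is2Digraph_openHexagon, hexagon_aCsHaveCard Sum.inl_injective Sum.inr_injective, ?_, x, y, h2dd,
    ?_, ?_, ?_⟩
  · rw [openHexagon, hexagon_aCs Sum.inl_injective Sum.inr_injective, ncard_singleton]
  · exact hgl.aCsHaveCard_identify (aCsHaveCard_disjUnion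
      (hexagon_aCsHaveCard Sum.inl_injective Sum.inr_injective) (aCsHaveCard_sub hsix))
  · rw [isOdd_iff h2dd]
    intro S' h'
    obtain ⟨T, hT, hT'⟩ := exists_isFull_of_splice hK hG (ε := fun i => (ε i : V)) hy hx ho hr h'
    exact hT' ▸ (isOdd_iff hG).1 hodd T hT
  · rw [hamiltonian_iff, hamiltonian_iff]
    constructor
    · rintro ⟨T, hT, h1⟩
      have hne' : ∃ u w, G.route K (S₀ ∩ K) u w ∧ ¬ G.route K (S₁ ∩ K) u w :=
        ⟨ε 0, r₀ (ε 0), hr₀ _, fun h => hdis _ (ε 0).2 _ ⟨hr₀ _, h⟩⟩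
      have key : ∃ b, ((hS b).union hT hK hG).perm.orb = 1 :=
        (orb_union_eq_one hG hodd hK ho₀ ho₁ hne' h3 hT h1).elim (fun h => ⟨false, h⟩)
          (fun h => ⟨true, h⟩)
      obtain ⟨b, hb⟩ := key
      have hSK := inter_union_inter_compl (K := K) (S b) T
      obtain ⟨h', h2⟩ := IsFull.OpenOn.exists_isFull_splice hK hG (ε := fun i => (ε i : V)) hy hx
        ((ho b).congr ((hS b).union hT hK hG) hK hG hSK.symm) (b := b)
        (by rw [hSK]; exact hr b)
        (S' := Sum.inl '' {p | p.2 = b} ∪ Sum.inr '' (Subtype.val ⁻¹' (S b ∩ K ∪ T ∩ Kᶜ)))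
        (by simp) (by simp +contextual)
      exact ⟨_, h', h2 ▸ hb⟩
    · rintro ⟨S', h', h1⟩
      obtain ⟨T, hT, hT'⟩ := exists_isFull_of_splice hK hG (ε := fun i => (ε i : V)) hy hx ho hr h'
      exact ⟨T, hT, hT' ▸ h1⟩

end Replace

end Multidigraph

/-! ### Two alternating cycles -/

namespace Multidigraph

variable {V A : Type*}

section Components

/-- A property of vertices that is constant along arcs, but not constant, separates components. -/
theorem two_le_numComponents [Finite V] {G : Multidigraph V A} (c : V → Prop)
    (hc : ∀ a, c (G.src a) ↔ c (G.tgt a)) (h1 : ∃ v, c v) (h2 : ∃ v, ¬ c v) :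
    2 ≤ G.numComponents := by
  let f : Quot (G.Step univ) → Prop := Quot.lift c (by
    rintro _ _ ⟨a, -, rfl, rfl⟩
    exact propext (hc a))
  obtain ⟨u, hu⟩ := h1
  obtain ⟨v, hv⟩ := h2
  rw [numComponents, ← Nat.card_eq_two_iff.2 ⟨True, False, by simp, by
    ext p; simpa using Classical.em p⟩]
  refine Nat.card_le_card_of_surjective f fun p => ?_
  by_cases hp : p
  · exact ⟨Quot.mk _ u, propext (iff_of_true hu hp)⟩
  · exact ⟨Quot.mk _ v, propext (iff_of_false hv hp)⟩

variable [Finite V] {G : Multidigraph V A} {K : Set A}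

/-- Splitting all entry and exit vertices of `K` separates `K` from its complement. -/
theorem IsClosed.two_le_numComponents_split (hK : G.IsClosed K) (hG : G.Is2dd) (h1 : K.Nonempty)
    (h2 : Kᶜ.Nonempty) : 2 ≤ (G.split {v | G.IsEntry K v ∨ G.IsExit K v}).numComponents := by
  classical
  set T := {v | G.IsEntry K v ∨ G.IsExit K v} with hT
  have hsame : ∀ v, v ∉ T → (v ∈ G.ins Kᶜ ↔ v ∈ G.outs Kᶜ) := by
    intro v hv
    rw [hT, mem_ofPred_eq, hK.isEntry_iff hG, hK.isExit_iff hG] at hv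
    tauto
  have htgt : ∀ a, (G.split T).tgt a = Sum.inl (G.tgt a) := fun a => rfl
  refine two_le_numComponents (Sum.elim (fun v => v ∈ G.ins Kᶜ) fun v => (v : V) ∈ G.outs Kᶜ)
    (fun a => ?_) ?_ ?_
  · rw [htgt, Sum.elim_inl, hK.compl.tgt_mem_ins, ← hK.compl.src_mem_outs]
    by_cases h : G.src a ∈ T
    · have hsrc : (G.split T).src a = Sum.inr ⟨G.src a, h⟩ := dif_pos h
      rw [hsrc, Sum.elim_inr]
    · have hsrc : (G.split T).src a = Sum.inl (G.src a) := dif_neg h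
      rw [hsrc, Sum.elim_inl, hsame _ h]
  · obtain ⟨a, ha⟩ := h2
    exact ⟨Sum.inl (G.tgt a), hK.compl.tgt_mem_ins.2 ha⟩
  · obtain ⟨a, ha⟩ := h1
    exact ⟨Sum.inl (G.tgt a), fun h => hK.compl.tgt_mem_ins.1 h ha⟩

/-- In a connected 2-dd, a subgraph without entry and exit vertices is the whole graph. -/
theorem IsClosed.eq_univ_of_connected (hK : G.IsClosed K) (hG : G.Is2dd) (hconn : G.Connected)
    (h1 : K.Nonempty) (hE : ∀ v, ¬ G.IsEntry K v) (hX : ∀ v, ¬ G.IsExit K v) : K = univ := by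
  by_contra hne
  obtain ⟨b, hb⟩ := (ne_univ_iff_exists_notMem K).1 hne
  have hsame : ∀ v, v ∈ G.ins Kᶜ ↔ v ∈ G.outs Kᶜ := by
    intro v
    have h1 := hE v
    have h2 := hX v
    rw [hK.isEntry_iff hG] at h1
    rw [hK.isExit_iff hG] at h2
    tauto
  have := two_le_numComponents (G := G) (fun v => v ∈ G.ins Kᶜ)
    (fun a => by rw [hsame, hK.compl.src_mem_outs, hK.compl.tgt_mem_ins])
    ⟨G.tgt b, hK.compl.tgt_mem_ins.2 hb⟩
    (by obtain ⟨a, ha⟩ := h1; exact ⟨G.tgt a, fun h => hK.compl.tgt_mem_ins.1 h ha⟩)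
  rw [hconn] at this
  omega

end Components

section TwoACs

variable {G : Multidigraph V A} {X Y M M' N N' : Set A}

theorem IsSplitting.ncard_ins (hG : G.DegLeTwo) (h : G.IsSplitting X M M') :
    (G.ins X).ncard = M.ncard := by
  have hX : G.ins X = G.tgt '' M := by
    refine subset_antisymm ?_ (image_mono h.subset)
    rintro _ ⟨a, ha, rfl⟩
    obtain ⟨b, hb, hba⟩ := h.exists_tgt ha
    exact ⟨b, hb, hba⟩
  have hinj : InjOn G.tgt M := fun a ha b hb hab => h.eq_of_tgt hG ha hb hab
  rw [hX, hinj.ncard_image]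

theorem IsSplitting.ncard_outs (hG : G.DegLeTwo) (h : G.IsSplitting X M M') :
    (G.outs X).ncard = M.ncard := by
  have hX : G.outs X = G.src '' M := by
    refine subset_antisymm ?_ (image_mono h.subset)
    rintro _ ⟨a, ha, rfl⟩
    obtain ⟨b, hb, hba⟩ := h.exists_src ha
    exact ⟨b, hb, hba⟩
  have hinj : InjOn G.src M := fun a ha b hb hab => h.eq_of_src hG ha hb hab
  rw [hX, hinj.ncard_image]

theorem IsSplitting.ncard_eq_three [Finite A] (hG : G.DegLeTwo) (h : G.IsSplitting X M M')
    (h6 : X.ncard = 6) : M.ncard = 3 := by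
  have h1 := h.ncard_ins hG
  have h2 := h.symm.ncard_ins hG
  have h3 := ncard_union_eq h.disjoint
  rw [h.union] at h3
  omega

/-- There are no parallel arcs, as they would form an alternating cycle with two arcs. -/
theorem eq_of_parallel (hsix : G.ACsHaveCard 6) {a b : A} (ht : G.tgt a = G.tgt b)
    (hs : G.src a = G.src b) : a = b := by
  by_contra hab
  have := hsix _ (isAC_pair hab ht hs)
  rw [ncard_pair hab] at this
  omega

/-- Inside two alternating cycles, a factor may be replaced by any matchings of these cycles. -/
theorem isFull_matchings (hG : G.DegLeTwo) {S : Set A} (h : G.IsFull S) (hX : G.IsClosed X)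
    (hY : G.IsClosed Y) (hXY : Disjoint X Y) (hM : G.IsSplitting X M M')
    (hN : G.IsSplitting Y N N') : G.IsFull (S ∩ (X ∪ Y)ᶜ ∪ (M ∪ N)) := by
  refine (hX.union hY).compl.isFull_union h ?_ ?_ ?_
  · rw [compl_compl]
    exact union_subset_union hM.subset hN.subset
  · rw [compl_compl]
    rintro _ ⟨a, ha | ha, rfl⟩
    · obtain ⟨b, hb, hba⟩ := hM.exists_tgt ha
      refine ⟨b, ⟨Or.inl hb, hba⟩, ?_⟩
      rintro c ⟨hc | hc, hca⟩
      · exact hM.eq_of_tgt hG hc hb (hca.trans hba.symm)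
      · exact absurd (hN.subset hc) (Set.disjoint_left.1 hXY (hX.mem_of_tgt ha hca.symm))
    · obtain ⟨b, hb, hba⟩ := hN.exists_tgt ha
      refine ⟨b, ⟨Or.inr hb, hba⟩, ?_⟩
      rintro c ⟨hc | hc, hca⟩
      · exact absurd (hY.mem_of_tgt ha hca.symm) (Set.disjoint_left.1 hXY (hM.subset hc))
      · exact hN.eq_of_tgt hG hc hb (hca.trans hba.symm)
  · rw [compl_compl]
    rintro _ ⟨a, ha | ha, rfl⟩
    · obtain ⟨b, hb, hba⟩ := hM.exists_src ha
      refine ⟨b, ⟨Or.inl hb, hba⟩, ?_⟩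
      rintro c ⟨hc | hc, hca⟩
      · exact hM.eq_of_src hG hc hb (hca.trans hba.symm)
      · exact absurd (hN.subset hc) (Set.disjoint_left.1 hXY (hX.mem_of_src ha hca.symm))
    · obtain ⟨b, hb, hba⟩ := hN.exists_src ha
      refine ⟨b, ⟨Or.inr hb, hba⟩, ?_⟩
      rintro c ⟨hc | hc, hca⟩
      · exact absurd (hY.mem_of_src ha hca.symm) (Set.disjoint_left.1 hXY (hM.subset hc))
      · exact hN.eq_of_src hG hc hb (hca.trans hba.symm)

theorem mem_of_mem_matchings (hXY : Disjoint X Y) (hM : G.IsSplitting X M M')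
    (hN : G.IsSplitting Y N N') {S : Set A} {a : A} (ha : a ∈ S ∩ (X ∪ Y)ᶜ ∪ (M ∪ N)) :
    (a ∈ X → a ∈ M) ∧ (a ∈ Y → a ∈ N) := by
  rcases ha with ⟨-, ha⟩ | ha | ha
  · exact ⟨fun h => absurd (Or.inl h) ha, fun h => absurd (Or.inr h) ha⟩
  · exact ⟨fun _ => ha, fun h => absurd h (Set.disjoint_left.1 hXY (hM.subset ha))⟩
  · exact ⟨fun h => absurd (hN.subset ha) (Set.disjoint_left.1 hXY h), fun _ => ha⟩

variable [Finite V] [Finite A]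

/-- If at most four vertices are saturated, one of the two matchings of `Y` has at most one arc
between saturated vertices. -/
theorem exists_isSplitting_interior (hG : G.DegLeTwo) (hsix : G.ACsHaveCard 6)
    (hY : G.IsAC Y) (hle : (G.ins X ∩ G.outs Y).ncard + (G.ins Y ∩ G.outs X).ncard ≤ 4) :
    ∃ N N', G.IsSplitting Y N N' ∧ ∀ a ∈ N, ∀ b ∈ N, G.src a ∈ G.ins X → G.src b ∈ G.ins X →
      G.tgt a ∈ G.outs X → G.tgt b ∈ G.outs X → a = b := by
  obtain ⟨N, N', hN⟩ := hY.exists_isSplitting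
  have hsub : ∀ {a}, a ∈ N → G.src a ∈ G.outs Y ∧ G.tgt a ∈ G.ins Y := fun ha =>
    ⟨⟨_, hN.subset ha, rfl⟩, ⟨_, hN.subset ha, rfl⟩⟩
  by_cases hp : (G.ins X ∩ G.outs Y).ncard ≤ 1
  · refine ⟨N, N', hN, fun a ha b hb h1 h2 _ _ => hN.eq_of_src hG ha hb ?_⟩
    exact (ncard_le_one (toFinite _)).1 hp _ ⟨h1, (hsub ha).1⟩ _ ⟨h2, (hsub hb).1⟩
  by_cases hq : (G.ins Y ∩ G.outs X).ncard ≤ 1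
  · refine ⟨N, N', hN, fun a ha b hb _ _ h1 h2 => hN.eq_of_tgt hG ha hb ?_⟩
    exact (ncard_le_one (toFinite _)).1 hq _ ⟨(hsub ha).2, h1⟩ _ ⟨(hsub hb).2, h2⟩
  -- two saturated vertices of either kind: avoid the arc from the entry `c` to the exit `d` in `Y`
  obtain ⟨c, ⟨hcY, hcX⟩⟩ : (G.outs Y \ G.ins X).Nonempty := by
    have h1 := ncard_inter_add_ncard_sdiff_eq_ncard (G.outs Y) (G.ins X) (toFinite _)
    rw [hN.ncard_outs hG, hN.ncard_eq_three hG (hsix Y hY), inter_comm] at h1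
    exact nonempty_of_ncard_ne_zero (by omega)
  obtain ⟨d, ⟨hdY, hdX⟩⟩ : (G.ins Y \ G.outs X).Nonempty := by
    have h1 := ncard_inter_add_ncard_sdiff_eq_ncard (G.ins Y) (G.outs X) (toFinite _)
    rw [hN.ncard_ins hG, hN.ncard_eq_three hG (hsix Y hY)] at h1
    exact nonempty_of_ncard_ne_zero (by omega)
  have key : ∀ N N', G.IsSplitting Y N N' → (∀ a ∈ N, G.src a = c → G.tgt a ≠ d) →
      ∀ a ∈ N, ∀ b ∈ N, G.src a ∈ G.ins X → G.src b ∈ G.ins X →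
        G.tgt a ∈ G.outs X → G.tgt b ∈ G.outs X → a = b := by
    intro N N' hN hcd
    obtain ⟨_, he₁, rfl⟩ := hcY
    obtain ⟨_, he₂, rfl⟩ := hdY
    obtain ⟨n₁, hn₁, hn₁c⟩ := hN.exists_src he₁
    obtain ⟨n₂, hn₂, hn₂d⟩ := hN.exists_tgt he₂
    have hne : n₁ ≠ n₂ := fun h => hcd n₁ hn₁ hn₁c (h ▸ hn₂d)
    have hpair : ({n₁, n₂} : Set A) ⊆ N := by
      rintro _ (rfl | rfl) <;> assumption
    have h1 : (N \ {n₁, n₂}).ncard ≤ 1 := by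
      rw [ncard_sdiff hpair, hN.ncard_eq_three hG (hsix Y hY), ncard_pair hne]
    have hmem : ∀ a ∈ N, G.src a ∈ G.ins X → G.tgt a ∈ G.outs X → a ∈ N \ {n₁, n₂} := by
      rintro a ha hs ht
      refine ⟨ha, ?_⟩
      rintro (rfl | rfl)
      · exact hcX (hn₁c ▸ hs)
      · exact hdX (hn₂d ▸ ht)
    intro a ha b hb h2 h3 h4 h5
    exact (ncard_le_one (toFinite _)).1 h1 _ (hmem a ha h2 h4) _ (hmem b hb h3 h5)
  by_cases hcd : ∀ a ∈ N, G.src a = c → G.tgt a ≠ d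
  · exact ⟨N, N', hN, key N N' hN hcd⟩
  · refine ⟨N', N, hN.symm, key N' N hN.symm fun b hb hbc hbd => ?_⟩
    push Not at hcd
    obtain ⟨a, ha, hac, had⟩ := hcd
    have := eq_of_parallel hsix (had.trans hbd.symm) (hac.trans hbc.symm)
    exact Set.disjoint_left.1 hN.disjoint ha (this ▸ hb)

/-- A subgraph that consists of two alternating cycles with six arcs and has at most four saturated
vertices has an open factor. A cycle inside the subgraph alternates between `X` and `Y`, and its
arcs in `Y` join saturated vertices. If the matching of `Y` has only one such arc, the cycle is a
2-cycle, which is avoided by the choice of the matching of `X`. -/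
theorem exists_openOn (hG : G.Is2dd) (hsix : G.ACsHaveCard 6) (hclean : G.Clean) (hX : G.IsAC X)
    (hY : G.IsAC Y) (hne : X ≠ Y)
    (hle : (G.ins X ∩ G.outs Y).ncard + (G.ins Y ∩ G.outs X).ncard ≤ 4) :
    ∃ (S : Set A) (h : G.IsFull S), h.OpenOn (X ∪ Y) := by
  have hdeg := hG.degLeTwo
  have hXc := hX.isClosed hdeg
  have hYc := hY.isClosed hdeg
  have hK := hXc.union hYc
  have hXY : Disjoint X Y := by
    by_contra hdis
    exact hne (hX.eq_of_inter hdeg hY (Set.not_disjoint_iff_nonempty_inter.1 hdis))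
  have hcleanX : ∀ v, v ∈ G.ins X → v ∉ G.outs X := fun v h1 h2 =>
    hclean X hX v ⟨hXc.inDeg_of_mem hG h1, hXc.outDeg_of_mem hG h2⟩
  have hcleanY : ∀ v, v ∈ G.ins Y → v ∉ G.outs Y := fun v h1 h2 =>
    hclean Y hY v ⟨hYc.inDeg_of_mem hG h1, hYc.outDeg_of_mem hG h2⟩
  obtain ⟨N, N', hN, hNi⟩ := exists_isSplitting_interior hdeg hsix hY hle
  -- a matching of `X` that does not close the arc of `N` between saturated vertices to a 2-cycle
  have hMex : ∃ M M', G.IsSplitting X M M' ∧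
      ∀ m ∈ M, ∀ n ∈ N, G.src m = G.tgt n → G.tgt m ≠ G.src n := by
    obtain ⟨M, M', hM⟩ := hX.exists_isSplitting
    by_cases hgood : ∀ m ∈ M, ∀ n ∈ N, G.src m = G.tgt n → G.tgt m ≠ G.src n
    · exact ⟨M, M', hM, hgood⟩
    · refine ⟨M', M, hM.symm, fun m' hm' n' hn' h1' h2' => ?_⟩
      push Not at hgood
      obtain ⟨m, hm, n, hn, h1, h2⟩ := hgood
      have hnn : n = n' := hNi n hn n' hn' (h2 ▸ ⟨m, hM.subset hm, rfl⟩)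
        (h2' ▸ ⟨m', hM.symm.subset hm', rfl⟩) (h1 ▸ ⟨m, hM.subset hm, rfl⟩)
        (h1' ▸ ⟨m', hM.symm.subset hm', rfl⟩)
      subst hnn
      have := eq_of_parallel hsix (h2.trans h2'.symm) (h1.trans h1'.symm)
      exact Set.disjoint_left.1 hM.disjoint hm (this ▸ hm')
  obtain ⟨M, M', hM, hMN⟩ := hMex
  obtain ⟨S₀, h₀⟩ := hG.exists_isFull
  have h := isFull_matchings hdeg h₀ hXc hYc hXY hM hN
  refine ⟨_, h, fun v => ?_⟩
  by_contra! hno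
  have hins : ∀ k : ℕ, (h.perm ^ k) v ∈ G.ins X ∨ (h.perm ^ k) v ∈ G.ins Y := fun k => by
    have := hno k
    rw [hK.mem_ins_compl hG, not_not, ins, image_union] at this
    exact this
  have houts : ∀ k : ℕ, (h.perm ^ k) v ∈ G.outs X ∨ (h.perm ^ k) v ∈ G.outs Y := fun k => by
    have := hins (k + 1)
    rwa [pow_succ', Equiv.Perm.mul_apply, h.perm_mem_ins hXc, h.perm_mem_ins hYc] at this
  have hXtoY : ∀ k : ℕ, (h.perm ^ k) v ∈ G.ins X → (h.perm ^ k) v ∈ G.outs Y := fun k hk =>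
    (houts k).resolve_left (hcleanX _ hk)
  have hYtoX : ∀ k : ℕ, (h.perm ^ k) v ∈ G.ins Y → (h.perm ^ k) v ∈ G.outs X := fun k hk =>
    (houts k).resolve_right (hcleanY _ hk)
  have hsuccX : ∀ k : ℕ, (h.perm ^ k) v ∈ G.ins X → (h.perm ^ (k + 1)) v ∈ G.ins Y := fun k hk => by
    rw [pow_succ', Equiv.Perm.mul_apply, h.perm_mem_ins hYc]
    exact hXtoY k hk
  have hsuccY : ∀ k : ℕ, (h.perm ^ k) v ∈ G.ins Y → (h.perm ^ (k + 1)) v ∈ G.ins X := fun k hk => by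
    rw [pow_succ', Equiv.Perm.mul_apply, h.perm_mem_ins hXc]
    exact hYtoX k hk
  obtain ⟨k, hk⟩ : ∃ k : ℕ, (h.perm ^ k) v ∈ G.ins X :=
    (hins 0).elim (fun h => ⟨0, h⟩) fun h => ⟨1, hsuccY 0 h⟩
  have hk1 := hsuccX k hk
  have hk2 := hsuccY _ hk1
  have hk3 := hsuccX _ hk2
  have harc : ∀ i : ℕ, ∃ a ∈ S₀ ∩ (X ∪ Y)ᶜ ∪ (M ∪ N), G.src a = (h.perm ^ i) v ∧
      G.tgt a = (h.perm ^ (i + 1)) v := fun i => by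
    rw [pow_succ', Equiv.Perm.mul_apply]
    exact h.exists_arc _
  obtain ⟨n, hn, hns, hnt⟩ := harc k
  obtain ⟨m, hm, hms, hmt⟩ := harc (k + 1)
  obtain ⟨n', hn', hns', hnt'⟩ := harc (k + 1 + 1)
  have hnN : n ∈ N := (mem_of_mem_matchings hXY hM hN hn).2 (hYc.tgt_mem_ins.1 (hnt ▸ hk1))
  have hmM : m ∈ M := (mem_of_mem_matchings hXY hM hN hm).1 (hXc.tgt_mem_ins.1 (hmt ▸ hk2))
  have hnN' : n' ∈ N := (mem_of_mem_matchings hXY hM hN hn').2 (hYc.tgt_mem_ins.1 (hnt' ▸ hk3))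
  have hnn : n = n' := hNi n hnN n' hnN' (hns ▸ hk) (hns' ▸ hk2) (hnt ▸ hYtoX _ hk1)
    (hnt' ▸ hYtoX _ hk3)
  exact hMN m hmM n hnN (hms.trans hnt.symm) (hmt.trans (hns'.symm.trans (hnn ▸ rfl)))

/-- An odd 2-dd that consists of two alternating cycles with six arcs is Hamiltonian. All cycles of
a factor alternate between the two alternating cycles, so that a factor has one or three cycles; in
the latter case it consists of 2-cycles, and passing to the other matching of one alternating cycle
destroys them all. -/
theorem hamiltonian_of_union_eq_univ (hG : G.Is2dd) (hsix : G.ACsHaveCard 6) (hclean : G.Clean)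
    (hodd : G.IsOdd) (hX : G.IsAC X) (hY : G.IsAC Y) (hne : X ≠ Y) (hU : X ∪ Y = univ) :
    G.Hamiltonian := by
  have hdeg := hG.degLeTwo
  have hXc := hX.isClosed hdeg
  have hYc := hY.isClosed hdeg
  have hXY : Disjoint X Y := by
    by_contra hdis
    exact hne (hX.eq_of_inter hdeg hY (Set.not_disjoint_iff_nonempty_inter.1 hdis))
  have hcleanX : ∀ v, v ∈ G.ins X → v ∉ G.outs X := fun v h1 h2 =>
    hclean X hX v ⟨hXc.inDeg_of_mem hG h1, hXc.outDeg_of_mem hG h2⟩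
  have hcleanY : ∀ v, v ∈ G.ins Y → v ∉ G.outs Y := fun v h1 h2 =>
    hclean Y hY v ⟨hYc.inDeg_of_mem hG h1, hYc.outDeg_of_mem hG h2⟩
  have hins : ∀ v, v ∈ G.ins X ∨ v ∈ G.ins Y := fun v => by
    obtain ⟨a, rfl⟩ := hG.exists_tgt v
    have : a ∈ X ∪ Y := hU ▸ mem_univ a
    exact this.imp (fun h => ⟨a, h, rfl⟩) fun h => ⟨a, h, rfl⟩
  have houts : ∀ v, v ∈ G.outs X ∨ v ∈ G.outs Y := fun v => by
    obtain ⟨a, rfl⟩ := hG.exists_src v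
    have : a ∈ X ∪ Y := hU ▸ mem_univ a
    exact this.imp (fun h => ⟨a, h, rfl⟩) fun h => ⟨a, h, rfl⟩
  have hinsX : ∀ v, v ∈ G.ins X ↔ v ∈ G.outs Y := fun v =>
    ⟨fun h => (houts v).resolve_left (hcleanX v h),
      fun h => (hins v).resolve_right fun h' => hcleanY v h' h⟩
  have hinsY : ∀ v, v ∈ G.ins Y ↔ v ∈ G.outs X := fun v =>
    ⟨fun h => (houts v).resolve_right (hcleanY v h),
      fun h => (hins v).resolve_left fun h' => hcleanX v h' h⟩
  have hstepX : ∀ {S : Set A} (h : G.IsFull S) v, v ∈ G.outs X → h.perm v ∈ G.outs Y :=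
    fun h v hv => (hinsX _).1 ((h.perm_mem_ins hXc).2 hv)
  have hstepY : ∀ {S : Set A} (h : G.IsFull S) v, v ∈ G.outs Y → h.perm v ∈ G.outs X :=
    fun h v hv => (hinsY _).1 ((h.perm_mem_ins hYc).2 hv)
  obtain ⟨M, M', hM⟩ := hX.exists_isSplitting
  obtain ⟨N, N', hN⟩ := hY.exists_isSplitting
  have hcard : Nat.card (G.outs X) = 3 := by
    rw [Nat.card_coe_set_eq, hM.ncard_outs hdeg, hM.ncard_eq_three hdeg (hsix X hX)]
  have key : ∀ {S : Set A} (h : G.IsFull S),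
      h.perm.orb = 1 ∨ ∀ v ∈ G.outs X, h.perm (h.perm v) = v := by
    intro S h
    obtain ⟨θ, hθ⟩ := Equiv.Perm.exists_isFirstReturn (j := (Subtype.val : G.outs X → V))
      Subtype.val_injective h.perm
    have hθv : ∀ v, (θ v : V) = h.perm (h.perm v) := by
      intro v
      rw [hθ.eq Subtype.val_injective (w := ⟨_, hstepY h _ (hstepX h v v.2)⟩) two_pos
        (by rw [pow_two, Equiv.Perm.mul_apply]) (fun k hk hk' => ?_)]
      obtain rfl : k = 1 := by omega
      rw [Subtype.range_val, pow_one]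
      exact hcleanX _ ((h.perm_mem_ins hXc).2 v.2)
    have horb : h.perm.orb = θ.orb := hθ.orb_eq Subtype.val_injective fun v => by
      rw [Subtype.range_val]
      exact (houts v).elim (fun hv => ⟨0, hv⟩) fun hv => ⟨1, hstepY h v hv⟩
    by_cases h1 : θ = 1
    · exact Or.inr fun v hv => by rw [← hθv ⟨v, hv⟩, h1]; rfl
    · refine Or.inl (horb.trans (Equiv.Perm.orb_eq_one_of_card_eq_three hcard ?_ h1))
      rw [← horb]
      exact (isOdd_iff hG).1 hodd _ h
  obtain ⟨S₀, h₀⟩ := hG.exists_isFull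
  have h := isFull_matchings hdeg h₀ hXc hYc hXY hM hN
  have h' := isFull_matchings hdeg h₀ hXc hYc hXY hM.symm hN
  rw [hamiltonian_iff]
  rcases key h with h1 | h1
  · exact ⟨_, h, h1⟩
  rcases key h' with h1' | h1'
  · exact ⟨_, h', h1'⟩
  exfalso
  obtain ⟨_, a₀, ha₀, rfl⟩ : (G.outs X).Nonempty := hX.nonempty.image _
  obtain ⟨a, ha, haa⟩ := hM.exists_src ha₀
  obtain ⟨a', ha', haa'⟩ := hM.symm.exists_src ha₀
  have hp : h.perm (G.src a₀) = G.tgt a := haa ▸ h.perm_src (Or.inr (Or.inl ha))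
  have hp' : h'.perm (G.src a₀) = G.tgt a' := haa' ▸ h'.perm_src (Or.inr (Or.inl ha'))
  have hv : G.src a₀ ∈ G.outs X := ⟨a₀, ha₀, rfl⟩
  have hcongr : ∀ v ∈ G.outs Y, h.perm v = h'.perm v := by
    rintro _ ⟨b₀, hb₀, rfl⟩
    obtain ⟨b, hb, hbb⟩ := hN.exists_src hb₀
    rw [← hbb, h.perm_src (Or.inr (Or.inr hb)), h'.perm_src (Or.inr (Or.inr hb))]
  have h2 := h1 _ hv
  rw [hcongr _ (hstepX h _ hv), ← h1' _ hv, EmbeddingLike.apply_eq_iff_eq, h1' _ hv, hp, hp'] at h2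
  have := eq_of_parallel hsix h2 (haa.trans haa'.symm)
  exact Set.disjoint_left.1 hM.disjoint ha (this ▸ ha')

/-- The numbers of entry and of exit vertices are both `6 - s`, where `s` is the number of saturated
vertices. For `s = 5`, these two vertices form a split-set. -/
theorem canCollapse_or_canReplaceBySingleAC (h2dd : G.Is2dd) (hsix : G.ACsHaveCard 6)
    (hclean : G.Clean) (hodd : G.IsOdd) (hconn : G.Connected) (hsplit : ¬ G.Splittable 2)
    (hX : G.IsAC X) (hY : G.IsAC Y) (hne : X ≠ Y) (hsat : 2 < {v | G.IsSat (X ∪ Y) v}.ncard) :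
    G.CanCollapse (X ∪ Y) ∨ G.CanReplaceBySingleAC (X ∪ Y) := by
  have hdeg := h2dd.degLeTwo
  have hXc := hX.isClosed hdeg
  have hYc := hY.isClosed hdeg
  have hKc := hXc.union hYc
  have hXY : ∀ a ∈ X, a ∉ Y := fun a h1 h2 => hne (hX.eq_of_inter hdeg hY ⟨a, h1, h2⟩)
  obtain ⟨M, M', hM⟩ := hX.exists_isSplitting
  obtain ⟨N, N', hN⟩ := hY.exists_isSplitting
  have hM3 := hM.ncard_eq_three hdeg (hsix X hX)
  have hN3 := hN.ncard_eq_three hdeg (hsix Y hY)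
  -- `X ∪ Y` has six end-vertices of arcs and six start-vertices of arcs
  have hins : (G.ins (X ∪ Y)).ncard = 6 := by
    rw [ins, image_union, ncard_union_eq]
    · have := hM.ncard_ins hdeg
      have := hN.ncard_ins hdeg
      simp only [ins] at *
      omega
    · rw [Set.disjoint_left]
      rintro _ ⟨a, ha, rfl⟩ ⟨b, hb, hba⟩
      exact hXY b (hXc.mem_of_tgt ha hba.symm) hb
  have houts : (G.outs (X ∪ Y)).ncard = 6 := by
    rw [outs, image_union, ncard_union_eq]
    · have := hM.ncard_outs hdeg
      have := hN.ncard_outs hdeg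
      simp only [outs] at *
      omega
    · rw [Set.disjoint_left]
      rintro _ ⟨a, ha, rfl⟩ ⟨b, hb, hba⟩
      exact hXY b (hXc.mem_of_src ha hba.symm) hb
  have hsatset : {v | G.IsSat (X ∪ Y) v} = G.ins (X ∪ Y) ∩ G.outs (X ∪ Y) := by
    ext v
    rw [mem_ofPred_eq, hKc.isSat_iff h2dd, hKc.mem_ins_compl h2dd, hKc.mem_outs_compl h2dd, not_not,
      not_not, mem_inter_iff]
  have hentset : {v | G.IsEntry (X ∪ Y) v} = G.outs (X ∪ Y) \ G.ins (X ∪ Y) := by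
    ext v
    rw [mem_ofPred_eq, hKc.isEntry_iff h2dd, hKc.mem_ins_compl h2dd, hKc.mem_outs_compl h2dd,
      not_not, mem_sdiff, and_comm]
  have hexset : {v | G.IsExit (X ∪ Y) v} = G.ins (X ∪ Y) \ G.outs (X ∪ Y) := by
    ext v
    rw [mem_ofPred_eq, hKc.isExit_iff h2dd, hKc.mem_ins_compl h2dd, hKc.mem_outs_compl h2dd,
      not_not, mem_sdiff]
  have hent := ncard_inter_add_ncard_sdiff_eq_ncard (G.outs (X ∪ Y)) (G.ins (X ∪ Y)) (toFinite _)
  rw [← hentset, inter_comm, ← hsatset, houts] at hent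
  have hex := ncard_inter_add_ncard_sdiff_eq_ncard (G.ins (X ∪ Y)) (G.outs (X ∪ Y)) (toFinite _)
  rw [← hexset, ← hsatset, hins] at hex
  set s := {v | G.IsSat (X ∪ Y) v}.ncard with hs
  by_cases h6 : s = 6
  · right
    have hE := (ncard_eq_zero (toFinite _)).1 (show {v | G.IsEntry (X ∪ Y) v}.ncard = 0 by omega)
    have hX' := (ncard_eq_zero (toFinite _)).1 (show {v | G.IsExit (X ∪ Y) v}.ncard = 0 by omega)
    have hU := hKc.eq_univ_of_connected h2dd hconn (hX.nonempty.mono subset_union_left)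
      (fun v hv => (eq_empty_iff_forall_notMem.1 hE) v hv)
      (fun v hv => (eq_empty_iff_forall_notMem.1 hX') v hv)
    exact canReplaceBySingleAC_of_eq_univ h2dd hU hsix
      (hamiltonian_of_union_eq_univ h2dd hsix hclean hodd hX hY hne hU)
  have hEne : {v | G.IsEntry (X ∪ Y) v}.Nonempty := nonempty_of_ncard_ne_zero (by omega)
  obtain ⟨e, he⟩ := hEne
  have hT : (G.ins (X ∪ Y)ᶜ).Nonempty := ⟨e, ((hKc.isEntry_iff h2dd).1 he).1⟩
  by_cases h5 : s = 5
  · exfalso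
    refine hsplit ⟨{v | G.IsEntry (X ∪ Y) v ∨ G.IsExit (X ∪ Y) v}, ?_, fun v _ => h2dd v, ?_⟩
    · have : Disjoint {v | G.IsEntry (X ∪ Y) v} {v | G.IsExit (X ∪ Y) v} :=
        Set.disjoint_left.2 fun v h1 h2 => h2.not_isEntry h1
      have h2 := ncard_union_eq this
      have h3 : {v | G.IsEntry (X ∪ Y) v ∨ G.IsExit (X ∪ Y) v} =
        {v | G.IsEntry (X ∪ Y) v} ∪ {v | G.IsExit (X ∪ Y) v} := rfl
      rw [h3]
      omega
    · rw [hconn]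
      exact hKc.two_le_numComponents_split h2dd (hX.nonempty.mono subset_union_left)
        (image_nonempty.1 hT)
  -- the saturated vertices, according to which of the two cycles enters them
  have hle : (G.ins X ∩ G.outs Y).ncard + (G.ins Y ∩ G.outs X).ncard ≤ 4 := by
    have hdis : Disjoint (G.ins X ∩ G.outs Y) (G.ins Y ∩ G.outs X) := by
      rw [Set.disjoint_left]
      rintro v ⟨h1, -⟩ ⟨-, h2⟩
      exact hclean X hX v ⟨hXc.inDeg_of_mem h2dd h1, hXc.outDeg_of_mem h2dd h2⟩
    rw [← ncard_union_eq hdis]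
    have hsub : G.ins X ∩ G.outs Y ∪ G.ins Y ∩ G.outs X ⊆ {v | G.IsSat (X ∪ Y) v} := by
      rw [hsatset, ins, ins, ins, outs, outs, outs, image_union, image_union]
      rintro v (⟨h1, h2⟩ | ⟨h1, h2⟩)
      · exact ⟨Or.inl h1, Or.inr h2⟩
      · exact ⟨Or.inr h1, Or.inl h2⟩
    have := ncard_le_ncard hsub (toFinite _)
    omega
  obtain ⟨S₀, h₀, ho₀⟩ := exists_openOn h2dd hsix hclean hX hY hne hle
  by_cases huniq : ∀ (S : Set A) (h : G.IsFull S), h.OpenOn (X ∪ Y) →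
      G.route (X ∪ Y) (S ∩ (X ∪ Y)) = G.route (X ∪ Y) (S₀ ∩ (X ∪ Y))
  · exact Or.inl (ho₀.canCollapse hKc h2dd hsix hodd hT huniq)
  · push Not at huniq
    obtain ⟨S, h, ho, hr⟩ := huniq
    -- two open routes differ at three entry vertices, so that exactly three vertices are saturated
    have h3 : 3 ≤ {v | G.IsEntry (X ∪ Y) v}.ncard :=
      (three_le_of_route_ne h2dd hodd hKc ho ho₀ hr).trans
        (ncard_le_ncard (fun u hu => hu.1) (toFinite _))
    exact Or.inr (ho.canReplaceBySingleAC ho₀ hKc h2dd hsix hodd (by omega) hr)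

end TwoACs

end Multidigraph

theorem mainTheorem8 {V A : Type*} [Finite V] [Finite A] (G : Multidigraph V A)
    (h2dd : G.Is2dd) (hsix : G.ACsHaveCard 6) (hclean : G.Clean)
    (hodd : G.IsOdd) (hconn : G.Connected) (hsplit : ¬ G.Splittable 2)
    (𝒦 : Set (Set A)) (hK : 𝒦 ⊆ G.ACs) (hcard : 𝒦.ncard = 2)
    (hsat : 2 < {v | G.IsSat (⋃₀ 𝒦) v}.ncard) :
    G.CanCollapse (⋃₀ 𝒦) ∨ G.CanReplaceBySingleAC (⋃₀ 𝒦) := by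
  obtain ⟨X, Y, hne, rfl⟩ := ncard_eq_two.1 hcard
  rw [sUnion_pair] at hsat ⊢
  exact Multidigraph.canCollapse_or_canReplaceBySingleAC h2dd hsix hclean hodd hconn hsplit
    (hK (mem_insert _ _)) (hK (mem_insert_of_mem _ rfl)) hne hsat
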